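/- Let $N\ge 2$, $\ell\ge 0$, $m=N\ell$, and let $\vec k=(k_1,\dots,k_m)$ with $0\le k_i\le N$ and $\sum_i k_i=m$. Work over $\mathbb C(q)=\mathbb C(v)$, $v=-q^{-1}$, and let $\overline{\phantom{x}}$ be the $\mathbb C$-linear field involution $q\mapsto q^{-1}$. Let $\Lambda_q^k(\mathbb C_q^N)$ have standard basis $\{x_S : S\subseteq\{1,\dots,N\},\ |S|=k\}$ and put $\Lambda_q^{\vec k}(\mathbb C_q^N)=\Lambda_q^{k_m}(\mathbb C_q^N)\otimes\cdots\otimes\Lambda_q^{k_1}(\mathbb C_q^N)$. **Webs.** A monomial $\mathfrak{sl}_N$-web is a diagram obtained by glueing and juxtaposing strands, cups, caps, trivalent vertices and tags with labels in $\{0,\dots,N\}$. With $\ell(S,T)=|\{(i,j)\in S\times T: i<j\}|$ and $S^c=\{1,\dots,N\}\setminus S$, webs are identified with intertwiners as follows (labels read from left to right; $a^+$ stands for $\Lambda_q^a$ and $a^-$ for $(\Lambda_q^a)^*$): the split $a+b\to(a,b)$ is $x_S\mapsto\sum_{T\subset S,\,|T|=a}v^{-\ell(T,S\setminus T)}x_T\otimes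 x_{S\setminus T}$; the merge $(a,b)\to a+b$ is $x_S\otimes x_T\mapsto v^{\ell(T,S)}x_{S\cup T}$ if $S\cap T=\emptyset$ and $0$ otherwise; the tag $a^+\to(N-a)^-$ on the left is $D_a: x_S\mapsto v^{\ell(S^c,S)}x_{S^c}^*$, on the right $(-1)^{a(N-a)}D_a$; the tags $(N-a)^-\to a^+$ are the inverses of these; the cup with boundary $a^+a^-$ and the cap with boundary $a^-a^+$ are the usual copairing and pairing $c_a$, $p_a$; the cup with boundary $a^-a^+$ is $(D_{N-a}\otimes D_a^{-1})\,c_{N-a}$ and the cap with boundary $a^+a^-$ is $p_{N-a}\,(D_a\otimes D_{N-a}^{-1})$. Let $(N^\ell)=(N,\dots,N,0,\dots,0)$ ($\ell$ entries $N$ and $m-\ell$ entries $0$), so $\Lambda_q^{(N^\ell)}(\mathbb C_q^N)$ is one-dimensional, spanned by its only standard basis vector. The web space $W(\vec k,N)\subset\Lambda_q^{\vec k}(\mathbb C_q^N)$ is the span of the monomial webs from $(N^\ell)$ to $\vec k$, a web being identified with the image of that basis vector. For a web $u$ let $u^*$ be its reflection in the $x$-axis with all orientations reversed, and for a web $w$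 from $(N^\ell)$ to $(N^\ell)$ let $\mathrm{ev}(w)$ be the scalar by which it acts. Put $d(\vec k)=\frac12\bigl(N(N-1)\ell-\sum_i k_i(k_i-1)\bigr)$. **Bar involution.** Let $\psi$ be the $q$-antilinear map on tensor products of the spaces $\Lambda_q^k(\mathbb C_q^N)$ that fixes every $x_S$ in a single factor and satisfies $\psi(x\otimes y)=\overline\Theta(\psi(x)\otimes\psi(y))$, where $\Theta$ is the quasi $R$-matrix of $\mathbf U_q(\mathfrak{sl}_N)$ for the coproduct $\Delta(E_{+i})=E_{+i}\otimes K_i+1\otimes E_{+i}$, $\Delta(E_{-i})=E_{-i}\otimes 1+K_i^{-1}\otimes E_{-i}$, $\Delta(K_i^{\pm1})=K_i^{\pm1}\otimes K_i^{\pm1}$: the unique element of the completion of $1\otimes1+\mathbf U^+\otimes\mathbf U^-$ (with $\mathbf U^{\pm}$ the parts of positive and negative weight) such that $\Theta\Delta(u)=\overline\Delta(u)\Theta$ for all $u$, where bars denote the factorwise $q$-antilinear algebra involution $E_{\pm i}\mapsto E_{\pm i}$, $K_i\mapsto K_i^{-1}$, and $\overline\Delta(u)=\overline{\Delta(\overline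 u)}$. **Tableaux.** Let $\mathrm{Col}^{(N^\ell)}_{\vec k}$ be the set of column-strict tableaux with $\ell$ rows of length $N$ in which the entry $i$ occurs $k_i$ times ($1\le i\le m$). For such $\tau$ put $x^\tau=x_{S_m}\otimes\cdots\otimes x_{S_1}$, where $S_i$ is the set of numbers of the columns of $\tau$ that contain $i$. **Statement.** There is a unique form $\langle\cdot,\cdot\rangle$ on $W(\vec k,N)$ that is $v$-antilinear in the first entry, $v$-linear in the second, and satisfies $\langle u,w\rangle=v^{d(\vec k)}\,\mathrm{ev}(u^*w)$ for all monomial webs $u,w$; the map $\psi$ preserves $W(\vec k,N)$; and there is a unique $v$-bilinear form $(\cdot,\cdot)$ on $W(\vec k,N)$, the $v$-bilinear web form, such that $\langle x,y\rangle=\overline{(x,\psi(y))}$ for all $x,y\in W(\vec k,N)$. This form is symmetric. Every monomial web $w\in W(\vec k,N)$ can be written uniquely as $w=\sum_{\tau\in\mathrm{Col}^{(N^\ell)}_{\vec k}}c^\tau(v)\,x^\tau$ with $c^\tau(v)\in\mathbb C(v)$, and $$(w,w)=\sum_{\tau\in\mathrm{Col}^{(N^\ell)}_{\vec k}}c^\tau(v)^2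 .$$ Moreover, $(\cdot,\cdot)$ is the restriction to $W(\vec k,N)$ of Lusztig's symmetric bilinear form on $\Lambda_q^{\vec k}(\mathbb C_q^N)$, for which the standard basis is orthonormal. -/

import Mathlib

namespace SLWeb

open Finset

noncomputable section

/-! ## The ground field and its bar involution -/

/-- The ground field `ℂ(q)`. -/
abbrev K : Type := RatFunc ℂ

/-- The quantum parameter `q`. -/
def q : K := RatFunc.X

/-- The second quantum parameter `v = -q⁻¹`; note that `ℂ(v) = ℂ(q)`. -/
def v : K := -q⁻¹

theorem aeval_inv_injective :
    Function.Injective (Polynomial.aeval (R := ℂ) (q⁻¹ : K)) := by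
  have h : Transcendental ℂ (q⁻¹ : K) := fun hinv =>
    (RatFunc.transcendental_X : Transcendental ℂ (RatFunc.X : K))
      (by simpa [q] using IsAlgebraic.inv hinv)
  exact transcendental_iff_injective.mp h

/-- The bar involution of the field: the `ℂ`-algebra map with `q ↦ q⁻¹`, hence `v ↦ v⁻¹`. -/
def bar : K →+* K :=
  RatFunc.liftRingHom (Polynomial.aeval (R := ℂ) (q⁻¹ : K)).toRingHom
    (nonZeroDivisors_le_comap_nonZeroDivisors_of_injective _ aeval_inv_injective)

/-! ## Webs -/

/-- A boundary label: a colour together with an orientation (`true` is up, `false` is down). -/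
abbrev Label : Type := ℕ × Bool

/-- `a⁺`, which stands for `Λ_q^a`. -/
abbrev up (a : ℕ) : Label := (a, true)

/-- `a⁻`, which stands for `(Λ_q^a)^*`. -/
abbrev dn (a : ℕ) : Label := (a, false)

/-- Monomial `sl_N`-web diagrams, read from bottom to top. `Web N s t` is the type of the diagrams
with bottom boundary `s` and top boundary `t`; the labels are listed from the left of the picture
to the right. A diagram is obtained by glueing (`comp f g` puts `g` on top of `f`) and juxtaposing
(`tens f g` puts `g` to the right of `f`) strands, cups, caps, trivalent vertices and tags.
Every other trivalent vertex is a rotation of `split` or `merge`, obtained with cups and caps. -/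
inductive Web (N : ℕ) : List Label → List Label → Type
  /-- the empty diagram -/
  | empty : Web N [] []
  /-- a vertical strand -/
  | strand (x : Label) (hx : x.1 ≤ N) : Web N [x] [x]
  /-- the cup whose left end points up -/
  | cupL (a : ℕ) (ha : a ≤ N) : Web N [] [up a, dn a]
  /-- the cup whose right end points up -/
  | cupR (a : ℕ) (ha : a ≤ N) : Web N [] [dn a, up a]
  /-- the cap whose left end points up -/
  | capL (a : ℕ) (ha : a ≤ N) : Web N [up a, dn a] []
  /-- the cap whose right end points up -/
  | capR (a : ℕ) (ha : a ≤ N) : Web N [dn a, up a] []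
  /-- an edge `a + b` splitting into `a` and `b` -/
  | split (a b : ℕ) (hab : a + b ≤ N) : Web N [up (a + b)] [up a, up b]
  /-- edges `a` and `b` merging into `a + b` -/
  | merge (a b : ℕ) (hab : a + b ≤ N) : Web N [up a, up b] [up (a + b)]
  /-- the tag on the left at which the edges `a` (below) and `N - a` (above) both end -/
  | sinkL (a : ℕ) (ha : a ≤ N) : Web N [up a] [dn (N - a)]
  /-- the same with the tag on the right -/
  | sinkR (a : ℕ) (ha : a ≤ N) : Web N [up a] [dn (N - a)]
  /-- the tag on the left at which the edges `N - a` (below) and `a` (above) both start -/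
  | sourceL (a : ℕ) (ha : a ≤ N) : Web N [dn (N - a)] [up a]
  /-- the same with the tag on the right -/
  | sourceR (a : ℕ) (ha : a ≤ N) : Web N [dn (N - a)] [up a]
  | comp {r s t : List Label} (f : Web N r s) (g : Web N s t) : Web N r t
  | tens {r s t u : List Label} (f : Web N r s) (g : Web N t u) : Web N (r ++ t) (s ++ u)

/-- `w ↦ w^*`: reflection in the `x`-axis followed by the reversal of all orientations. -/
def Web.star {N : ℕ} {s t : List Label} : Web N s t → Web N t s
  | .empty => .empty
  | .strand x hx => .strand x hx
  | .cupL a ha => .capL a ha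
  | .cupR a ha => .capR a ha
  | .capL a ha => .cupL a ha
  | .capR a ha => .cupR a ha
  | .split a b hab => .merge a b hab
  | .merge a b hab => .split a b hab
  | .sinkL a ha => .sourceL a ha
  | .sinkR a ha => .sourceR a ha
  | .sourceL a ha => .sinkL a ha
  | .sourceR a ha => .sinkR a ha
  | .comp f g => .comp g.star f.star
  | .tens f g => .tens f.star g.star

/-! ## The intertwiner of a web

A basis tensor of `Λ_q^{a_1} ⊗ ⋯ ⊗ Λ_q^{a_r}` (a factor being dualised where the label is down)
is given by the list `[S_1, …, S_r]` of subsets of `{1, …, N}` with `|S_i| = a_i`: the factor is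
`x_{S_i}` where the label is up, and the dual basis vector `x_{S_i}^*` where it is down. -/

/-- `ℓ(S,T)`, the number of pairs `(i,j) ∈ S × T` with `i < j`. -/
def ell {N : ℕ} (S T : Finset (Fin N)) : ℤ :=
  (((S ×ˢ T).filter fun p => p.1 < p.2).card : ℤ)

/-- The basis tensors of a boundary. -/
def basisStates (N : ℕ) : List Label → Finset (List (Finset (Fin N)))
  | [] => {[]}
  | x :: o => ((powersetCard x.1 univ) ×ˢ basisStates N o).image fun p => p.1 :: p.2

/-- The copairing `1 → Λ^a ⊗ (Λ^a)^*`, `1 ↦ ∑ x_S ⊗ x_S^*`. -/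
def cupLCoeff {N : ℕ} : List (Finset (Fin N)) → List (Finset (Fin N)) → K
  | [], [S, T] => if S = T then 1 else 0
  | _, _ => 0

/-- The pairing `(Λ^a)^* ⊗ Λ^a → 1`, `x_S^* ⊗ x_T ↦ δ_{S,T}`. -/
def capRCoeff {N : ℕ} : List (Finset (Fin N)) → List (Finset (Fin N)) → K
  | [S, T], [] => if S = T then 1 else 0
  | _, _ => 0

/-- The copairing `1 → (Λ^a)^* ⊗ Λ^a`, which is
`(D_{N-a} ⊗ D_a^{-1}) ∘ c_{N-a}` with `c_{N-a}` the usual copairing of `Λ^{N-a}`. -/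
def cupRCoeff {N : ℕ} : List (Finset (Fin N)) → List (Finset (Fin N)) → K
  | [], [S, T] => if S = T then v ^ (ell S Sᶜ - ell Sᶜ S) else 0
  | _, _ => 0

/-- The pairing `Λ^a ⊗ (Λ^a)^* → 1`, which is
`p_{N-a} ∘ (D_a ⊗ D_{N-a}^{-1})` with `p_{N-a}` the usual pairing of `Λ^{N-a}`. -/
def capLCoeff {N : ℕ} : List (Finset (Fin N)) → List (Finset (Fin N)) → K
  | [S, T], [] => if S = T then v ^ (ell Sᶜ S - ell S Sᶜ) else 0
  | _, _ => 0

/-- `M'_{a,b} : x_S ↦ ∑_{T ⊂ S} v^{-ℓ(T, S∖T)} x_T ⊗ x_{S∖T}`. -/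
def splitCoeff {N : ℕ} : List (Finset (Fin N)) → List (Finset (Fin N)) → K
  | [S], [T, U] => if Disjoint T U ∧ T ∪ U = S then v ^ (-ell T U) else 0
  | _, _ => 0

/-- `M_{a,b} : x_S ⊗ x_T ↦ v^{ℓ(T,S)} x_{S ∪ T}` if `S`, `T` are disjoint, and `0` otherwise. -/
def mergeCoeff {N : ℕ} : List (Finset (Fin N)) → List (Finset (Fin N)) → K
  | [S, T], [U] => if Disjoint S T ∧ S ∪ T = U then v ^ ell T S else 0
  | _, _ => 0

/-- `D_a : Λ^a → (Λ^{N-a})^*`, `D_a(x_S)(x_T) = v^{ℓ(T,S)}` if `S`, `T` are disjoint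
(that is, `T = Sᶜ`), and `0` otherwise. -/
def sinkCoeff {N : ℕ} : List (Finset (Fin N)) → List (Finset (Fin N)) → K
  | [S], [T] => if T = Sᶜ then v ^ ell T S else 0
  | _, _ => 0

/-- `D_a^{-1} : (Λ^{N-a})^* → Λ^a`. -/
def sourceCoeff {N : ℕ} : List (Finset (Fin N)) → List (Finset (Fin N)) → K
  | [T], [S] => if T = Sᶜ then v ^ (-ell T S) else 0
  | _, _ => 0

/-- The intertwiner of a web as a matrix: `w.coeff x y` is the coefficient of the basis tensor `y`
of the top boundary in the image of the basis tensor `x` of the bottom boundary. -/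
def Web.coeff {N : ℕ} {s t : List Label} :
    Web N s t → List (Finset (Fin N)) → List (Finset (Fin N)) → K
  | .empty => fun x y => if x = y then 1 else 0
  | .strand _ _ => fun x y => if x = y then 1 else 0
  | .cupL _ _ => cupLCoeff
  | .cupR _ _ => cupRCoeff
  | .capL _ _ => capLCoeff
  | .capR _ _ => capRCoeff
  | .split _ _ _ => splitCoeff
  | .merge _ _ _ => mergeCoeff
  | .sinkL _ _ => sinkCoeff
  | .sinkR a _ => fun x y => (-1) ^ (a * (N - a)) * sinkCoeff x y
  | .sourceL _ _ => sourceCoeff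
  | .sourceR a _ => fun x y => (-1) ^ (a * (N - a)) * sourceCoeff x y
  | .comp (s := b) f g => fun x y => ∑ z ∈ basisStates N b, f.coeff x z * g.coeff z y
  | .tens (r := a) (s := b) f g => fun x y =>
      f.coeff (x.take a.length) (y.take b.length) * g.coeff (x.drop a.length) (y.drop b.length)

/-! ## The tensor space `Λ_q^k(ℂ_q^N)` and its web subspace -/

/-- The labels of the standard basis of `Λ_q^{k_m} ⊗ ⋯ ⊗ Λ_q^{k_1}`: the family `S` stands for
`x_S = x_{S_m} ⊗ ⋯ ⊗ x_{S_1}`, the factors being written backwards. -/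
abbrev BasisIndex (N : ℕ) {m : ℕ} (k : Fin m → ℕ) : Type :=
  {S : Fin m → Finset (Fin N) // ∀ i, (S i).card = k i}

/-- `Λ_q^k(ℂ_q^N)`, through its coordinates in the standard basis. -/
abbrev TensorSpace (N : ℕ) {m : ℕ} (k : Fin m → ℕ) : Type := BasisIndex N k → K

/-- The object `(k_1, …, k_m)`, all labels up; it is read from right to left in pictures. -/
def boundary {m : ℕ} (k : Fin m → ℕ) : List Label :=
  (List.ofFn fun i => up (k i)).reverse

/-- The basis tensor `x_S`, with its factors listed from left to right. -/
def stateList {N m : ℕ} (S : Fin m → Finset (Fin N)) : List (Finset (Fin N)) :=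
  (List.ofFn S).reverse

/-- The weight `(N^ℓ) = (N, …, N, 0, …, 0)`, with `m = Nℓ` entries of which `ℓ` are `N`. -/
def topWeight (N ℓ : ℕ) : Fin (N * ℓ) → ℕ := fun i => if (i : ℕ) < ℓ then N else 0

/-- The only basis tensor of the one-dimensional space `Λ_q^{(N^ℓ)}(ℂ_q^N)`. -/
def topState (N ℓ : ℕ) : List (Finset (Fin N)) :=
  stateList fun i : Fin (N * ℓ) => if (i : ℕ) < ℓ then univ else ∅

/-- Monomial webs in `Hom((N^ℓ), k)`. -/
abbrev MonomialWeb (N ℓ : ℕ) (k : Fin (N * ℓ) → ℕ) : Type :=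
  Web N (boundary (topWeight N ℓ)) (boundary k)

/-- A web in `Hom((N^ℓ), k)` as an element of `Λ_q^k(ℂ_q^N)`: the image under its intertwiner of
the basis vector of `Λ_q^{(N^ℓ)}(ℂ_q^N)`. -/
def webVector {N ℓ : ℕ} {k : Fin (N * ℓ) → ℕ} (w : MonomialWeb N ℓ k) : TensorSpace N k :=
  fun S => w.coeff (topState N ℓ) (stateList S.1)

/-- The web space `W(k, N)`, with webs identified with their intertwiners. -/
def webSpace (N ℓ : ℕ) (k : Fin (N * ℓ) → ℕ) : Submodule K (TensorSpace N k) :=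
  Submodule.span K (Set.range (webVector (N := N) (ℓ := ℓ) (k := k)))

/-- A monomial web as an element of `W(k, N)`. -/
def webElement {N ℓ : ℕ} {k : Fin (N * ℓ) → ℕ} (w : MonomialWeb N ℓ k) : webSpace N ℓ k :=
  ⟨webVector w, Submodule.subset_span ⟨w, rfl⟩⟩

/-- `ev : End((N^ℓ)) → ℂ(v)`: the scalar by which a web acts on the one-dimensional space
`Λ_q^{(N^ℓ)}(ℂ_q^N)`. -/
def ev {N ℓ : ℕ} (w : MonomialWeb N ℓ (topWeight N ℓ)) : K :=
  w.coeff (topState N ℓ) (topState N ℓ)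

/-- `d(k) = (N(N-1)ℓ - ∑ k_i(k_i-1)) / 2`; the number that is halved is even. -/
def normExp (N ℓ : ℕ) (k : Fin (N * ℓ) → ℕ) : ℤ :=
  ((N : ℤ) * (N - 1) * ℓ - ∑ i, (k i : ℤ) * (k i - 1)) / 2

/-! ## The bar involution `ψ` on tensor products

`U_q(sl_N)` acts on `(Λ_q^•(ℂ_q^N))^{⊗ n}`, with basis the tensors
`x_{S (n-1)} ⊗ ⋯ ⊗ x_{S 0}`. Indices start at `0`: `E_i`, `F_i`, `K_i` with `i + 1 < N` involve
the elements `i` and `i + 1` of `{0, …, N - 1}`. -/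

/-- Endomorphisms of `Λ_q^•(ℂ_q^N)` as matrices in the standard basis. -/
abbrev Op (N : ℕ) : Type := Matrix (Finset (Fin N)) (Finset (Fin N)) K

/-- Endomorphisms of `(Λ_q^•(ℂ_q^N))^{⊗ n}` as matrices in the standard basis. -/
abbrev TensorOp (N n : ℕ) : Type :=
  Matrix (Fin n → Finset (Fin N)) (Fin n → Finset (Fin N)) K

/-- `A ⊗ B`, with `A` acting on the leftmost factor (the one of highest index). -/
def kron {N n : ℕ} (A : Op N) (B : TensorOp N n) : TensorOp N (n + 1) :=
  Matrix.of fun S T => A (S (Fin.last n)) (T (Fin.last n)) * B (Fin.init S) (Fin.init T)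

/-- The operator on `Λ_q^•` that replaces `a` by `b` in `x_S` if `a ∈ S` and `b ∉ S`,
and kills `x_S` otherwise. -/
def moveOp {N : ℕ} (a b : Fin N) : Op N :=
  Matrix.of fun S' S => if a ∈ S ∧ b ∉ S ∧ S' = insert b (S.erase a) then 1 else 0

/-- `E_{+i}` on `Λ_q^•`. -/
def E₁ (N i : ℕ) : Op N :=
  if h : i + 1 < N then moveOp ⟨i + 1, h⟩ ⟨i, Nat.lt_of_succ_lt h⟩ else 0

/-- `E_{-i}` on `Λ_q^•`. -/
def F₁ (N i : ℕ) : Op N :=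
  if h : i + 1 < N then moveOp ⟨i, Nat.lt_of_succ_lt h⟩ ⟨i + 1, h⟩ else 0

/-- The exponent of `q` in the eigenvalue of `K_i` on `x_S`. -/
def weight {N : ℕ} (i : ℕ) (S : Finset (Fin N)) : ℤ :=
  ((S.filter fun j : Fin N => j.val = i).card : ℤ) -
    ((S.filter fun j : Fin N => j.val = i + 1).card : ℤ)

/-- `K_i⁻¹` on `Λ_q^•`. -/
def Kinv₁ (N i : ℕ) : Op N := Matrix.diagonal fun S => q ^ (-weight i S)

/-- `E_{-i}` on `(Λ_q^•)^{⊗ n}`, through `Δ(E_{-i}) = E_{-i} ⊗ 1 + K_i⁻¹ ⊗ E_{-i}`. -/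
def F (N i : ℕ) : (n : ℕ) → TensorOp N n
  | 0 => 0
  | n + 1 => kron (F₁ N i) 1 + kron (Kinv₁ N i) (F N i n)

/-- The root vector of the positive root `α_i + ⋯ + α_{i+d}`, built from `e i = E_{+i}`. -/
def rootE {N : ℕ} (p : K) (e : ℕ → Op N) (i : ℕ) : ℕ → Op N
  | 0 => e i
  | d + 1 => rootE p e i d * e (i + d + 1) - p⁻¹ • (e (i + d + 1) * rootE p e i d)

/-- The root vector of the negative root `-(α_i + ⋯ + α_{i+d})`, built from `f i = E_{-i}`. -/
def rootF {N n : ℕ} (p : K) (f : ℕ → TensorOp N n) (i : ℕ) : ℕ → TensorOp N n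
  | 0 => f i
  | d + 1 => f (i + d + 1) * rootF p f i d - p • (rootF p f i d * f (i + d + 1))

/-- The quasi `R`-matrix `Θ` of `U_q(sl_N)` acting on `Λ_q^• ⊗ (Λ_q^•)^{⊗ n}`, for `p = q`; it is
the ordered product over the positive roots `β = α_i + ⋯ + α_{i+d}` (in lexicographic order) of
the `q`-exponentials of `(q - q⁻¹) E_β ⊗ E_{-β}`, which stop after the linear term because
`E_β ^ 2 = 0` on `Λ_q^•`. Since the factorwise bar involution fixes all `E_{±i}` and inverts `q`,
the operator for `p = q⁻¹` is `Θ` barred. -/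
def theta (N n : ℕ) (p : K) : TensorOp N (n + 1) :=
  ((List.range (N - 1)).flatMap fun i => (List.range (N - 1 - i)).map fun d =>
    1 + (p - p⁻¹) • kron (rootE p (E₁ N) i d) (rootF p (fun j => F N j n) i d)).prod

/-- The matrix of `ψ`: `ψ` fixes the standard basis of `Λ_q^•`, and
`ψ(x ⊗ y) = Θ̄ (ψ(x) ⊗ ψ(y))`, with `x` in the leftmost factor. -/
def psiMatrix (N : ℕ) : (n : ℕ) → TensorOp N n
  | 0 => 1
  | n + 1 => theta N n q⁻¹ * kron 1 (psiMatrix N n)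

/-- The `q`-antilinear bar involution `ψ` of `Λ_q^k(ℂ_q^N)`. -/
def psi {N m : ℕ} {k : Fin m → ℕ} (x : TensorSpace N k) : TensorSpace N k :=
  fun S => ∑ T : BasisIndex N k, psiMatrix N m S.1 T.1 * bar (x T)

/-! ## Tableaux -/

/-- `Col_k^{(N^ℓ)}`: column-strict tableaux with `ℓ` rows of length `N` and entries in
`{1, …, Nℓ}`, in which the entry `i` occurs `k_i` times. -/
def Col (N ℓ : ℕ) (k : Fin (N * ℓ) → ℕ) : Type :=
  {T : Fin ℓ → Fin N → Fin (N * ℓ) // (∀ c, StrictMono fun r => T r c) ∧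
    ∀ i, (univ.filter fun p : Fin ℓ × Fin N => T p.1 p.2 = i).card = k i}

instance (N ℓ : ℕ) (k : Fin (N * ℓ) → ℕ) : Fintype (Col N ℓ k) := by
  classical
  unfold Col
  exact Fintype.ofFinite _

/-- The label of `x^τ`: its `i`-th set holds the numbers of the columns that contain `i`. -/
def Col.index {N ℓ : ℕ} {k : Fin (N * ℓ) → ℕ} (τ : Col N ℓ k) : BasisIndex N k :=
  ⟨fun i => univ.filter fun c => ∃ r, τ.1 r c = i, fun i => by
    rw [← τ.2.2 i]
    symm
    refine Finset.card_bij (fun p _ => p.2) ?_ ?_ ?_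
    · intro p hp
      simp only [mem_filter, mem_univ, true_and] at hp ⊢
      exact ⟨p.1, hp⟩
    · intro p hp p' hp' h
      simp only [mem_filter, mem_univ, true_and] at hp hp'
      have h₁ : τ.1 p.1 p.2 = τ.1 p'.1 p.2 := by rw [hp, h, hp']
      exact Prod.ext ((τ.2.1 p.2).injective h₁) h
    · intro c hc
      simp only [mem_filter, mem_univ, true_and] at hc
      obtain ⟨r, hr⟩ := hc
      exact ⟨(r, c), by simpa using hr, rfl⟩⟩

/-- The basis tensor `x^τ` of `Λ_q^k(ℂ_q^N)`. -/
def tableauTensor {N ℓ : ℕ} {k : Fin (N * ℓ) → ℕ} (τ : Col N ℓ k) : TensorSpace N k :=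
  Pi.single τ.index 1

/-! ## The forms -/

/-- Lusztig's symmetric bilinear form on `Λ_q^k(ℂ_q^N)`: the standard basis is orthonormal. -/
def lusztigForm {N m : ℕ} {k : Fin m → ℕ} (x y : TensorSpace N k) : K := ∑ S, x S * y S

/-- `S` is the `v`-sesquilinear web form: it is `v`-antilinear in the first entry, `v`-linear in
the second, and `⟨u, w⟩ = v^{d(k)} ev(u^* w)` for monomial webs `u`, `w`. -/
def IsSesquilinearWebForm {N ℓ : ℕ} {k : Fin (N * ℓ) → ℕ}
    (S : webSpace N ℓ k →ₛₗ[bar] webSpace N ℓ k →ₗ[K] K) : Prop :=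
  ∀ u w : MonomialWeb N ℓ k,
    S (webElement u) (webElement w) = v ^ normExp N ℓ k * ev (w.comp u.star)

/-- `B` is the `v`-bilinear web form attached to the sesquilinear web form `S`: it is bilinear and
`⟨x, y⟩` is the bar of `(x, ψ(y))`. -/
def IsBilinearWebForm {N ℓ : ℕ} {k : Fin (N * ℓ) → ℕ}
    (S : webSpace N ℓ k →ₛₗ[bar] webSpace N ℓ k →ₗ[K] K)
    (B : LinearMap.BilinForm K (webSpace N ℓ k)) : Prop :=
  ∀ x y y' : webSpace N ℓ k, (y' : TensorSpace N k) = psi (y : TensorSpace N k) →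
    S x y = bar (B x y')

end

end SLWeb

/-! Let `L` be Lusztig's form. The theorem rests on two facts about monomial webs `u`, `w`: `ev(u^*
w) = v^d(k) L(u, w)` (`ev_comp_star`), and `ψ` fixes the vector of every monomial web
(`psi_webVector`). The second, applied to closed webs, says that `ev` is bar invariant (`bar_ev`).
Barring the first then gives `v^d(k) ev(u^* w) = bar L(u, w) = bar L(u, ψ w)`. Hence `bar L(x, ψ y)`
is the sesquilinear web form and `L` is the bilinear one. Uniqueness holds because monomial webs
span and `ψ` is an involution on the web space.

For the formula for `ev`: the matrices of a generator and of its reflection are transposes up to a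
power of `v`, and the exponent is a difference of sums over the two boundaries (`Web.star_coeff`).
At the bottom that sum is `0`. At the top it is minus the sum of `ell Sᶜ S` over the factors. By
conservation of weight each column number occurs exactly `ℓ` times in a basis tensor of a web
(`webVector_support`), which makes this sum of `ell Sᶜ S` equal to `d(k)` (`sum_ell_compl`). The
same support condition says that only tensors of tableaux occur.

For the invariance under `ψ`: replacing `x_T^*` by a multiple of `x_{Tᶜ}` turns tags into scalars,
and cups and caps into splits and merges with `x_univ`. What remains is that merge and split commute
with `ψ`. Both commute with the lowering operators, and so does `ψ`, up to barring (`Psi_Fop`). So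
the defect in commutation intertwines lowering operators. It vanishes when the leftmost factor is a
highest weight vector, hence everywhere, since lowering reaches all other `x_S`
(`eq_zero_of_lower_consOp`; the split uses the dual argument). The bottom vector of a web is a
tensor product of highest weight vectors, which `ψ` fixes.

`Psi_Fop` comes from the intertwining property of the quasi `R`-matrix (`quasiR_intertwines`),
proved from the explicit product. Raising root vectors act on the exterior algebra as moves of one
element, weighted by the number of elements passed. Factors with the same starting index multiply to
a linear block. For each lowering generator only two adjacent blocks change the coproduct into the
barred one; the other blocks commute with it. -/

namespace SLWeb

/-! ### Root vectors of a sequence that satisfies the quantum Serre relations -/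

section RootVectors

variable {𝕜 A : Type*} [Field 𝕜] [Ring A] [Algebra 𝕜 A]

/-- The quantum Serre relations of type `A` for a sequence of elements of an algebra. -/
structure Serre (p : 𝕜) (f : ℕ → A) : Prop where
  comm : ∀ i j, i + 1 < j → f i * f j = f j * f i
  low : ∀ i, f i * f i * f (i + 1) + f (i + 1) * f i * f i = (p + p⁻¹) • (f i * f (i + 1) * f i)
  high : ∀ i, f (i + 1) * f (i + 1) * f i + f i * f (i + 1) * f (i + 1) =
    (p + p⁻¹) • (f (i + 1) * f i * f (i + 1))

/-- The root vector of `-(α_i + ⋯ + α_{i+d})`. -/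
def rootVec (p : 𝕜) (f : ℕ → A) (i : ℕ) : ℕ → A
  | 0 => f i
  | d + 1 => f (i + d + 1) * rootVec p f i d - p • (rootVec p f i d * f (i + d + 1))

variable {p : 𝕜} {f : ℕ → A}

theorem Serre.symm (h : Serre p f) : Serre p⁻¹ f where
  comm := h.comm
  low i := by rw [h.low, inv_inv, add_comm]
  high i := by rw [h.high, inv_inv, add_comm]

theorem rootVec_commute_above (h : Serre p f) (i d l : ℕ) (hl : i + d + 1 < l) :
    f l * rootVec p f i d = rootVec p f i d * f l := by
  induction d with
  | zero => exact (h.comm _ _ hl).symm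
  | succ d ih =>
    have h₁ := ih (by omega)
    have h₂ := h.comm (i + d + 1) l (by omega)
    simp only [rootVec, mul_sub, sub_mul, mul_smul_comm, smul_mul_assoc]
    rw [← mul_assoc, ← h₂, mul_assoc, h₁, mul_assoc (rootVec p f i d), h₂, ← mul_assoc (f l), h₁]
    simp only [mul_assoc]

theorem rootVec_commute_below (h : Serre p f) (i d l : ℕ) (hl : l + 1 < i) :
    f l * rootVec p f i d = rootVec p f i d * f l := by
  induction d with
  | zero => exact h.comm _ _ hl
  | succ d ih =>
    have h₂ := h.comm l (i + d + 1) (by omega)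
    simp only [rootVec, mul_sub, sub_mul, mul_smul_comm, smul_mul_assoc]
    rw [← mul_assoc, h₂, mul_assoc, ih, mul_assoc (rootVec p f i d), ← h₂, ← mul_assoc (f l), ih]
    simp only [mul_assoc]

/-- Beyond the simple case, the new generator `x` commutes with the shorter root vector `g` and sees
only the last letter `y`. The Serre relation of `x` and `y`, multiplied by `g` on the right and on
the left, yields this one. -/
theorem rootVec_serre_last (h : Serre p f) (i d : ℕ) :
    f (i + d + 1) * f (i + d + 1) * rootVec p f i d +
      rootVec p f i d * f (i + d + 1) * f (i + d + 1) =
    (p + p⁻¹) • (f (i + d + 1) * rootVec p f i d * f (i + d + 1)) := by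
  cases d with
  | zero => exact h.high i
  | succ d =>
    have h₁ := rootVec_commute_above h i d (i + (d + 1) + 1) (by omega)
    have h₂ := h.high (i + d + 1)
    rw [show i + (d + 1) + 1 = i + d + 1 + 1 by ring] at *
    simp only [rootVec]
    generalize rootVec p f i d = g at *
    generalize f (i + d + 1 + 1) = x at *
    generalize f (i + d + 1) = y at *
    have e₁ : x * x * (y * g) = x * x * y * g := by simp only [mul_assoc]
    have e₂ : x * x * (g * y) = g * (x * x * y) := by
      rw [mul_assoc, ← mul_assoc x g, h₁, mul_assoc g, ← mul_assoc x g, h₁]; simp only [mul_assoc]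
    have e₃ : y * g * x * x = y * x * x * g := by
      rw [mul_assoc y, ← h₁, ← mul_assoc, mul_assoc (y * x), ← h₁]; simp only [mul_assoc]
    have e₄ : x * (g * y) * x = g * (x * y * x) := by
      rw [← mul_assoc x, h₁]; simp only [mul_assoc]
    have e₅ : x * (y * g) * x = x * y * x * g := by
      rw [mul_assoc, mul_assoc y, ← h₁]; simp only [mul_assoc]
    have e₆ : g * y * x * x = g * (y * x * x) := by simp only [mul_assoc]
    simp only [mul_sub, sub_mul, mul_smul_comm, smul_mul_assoc, e₁, e₂, e₃, e₄, e₅, e₆]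
    have h₃ := congrArg (· * g) h₂
    have h₄ := congrArg (g * ·) h₂
    simp only [add_mul, mul_add, smul_mul_assoc, mul_smul_comm] at h₃ h₄
    rw [smul_sub, smul_comm (p + p⁻¹) p, ← h₃, ← h₄]
    module

theorem rootVec_last (hp : p ≠ 0) (h : Serre p f) (i d : ℕ) :
    f (i + d + 1) * rootVec p f i (d + 1) = p⁻¹ • (rootVec p f i (d + 1) * f (i + d + 1)) := by
  have h₁ := rootVec_serre_last h i d
  simp only [rootVec]
  generalize rootVec p f i d = g at *
  generalize f (i + d + 1) = x at *
  simp only [mul_sub, sub_mul, mul_smul_comm, smul_mul_assoc, smul_sub, smul_smul,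
    inv_mul_cancel₀ hp, one_smul, ← mul_assoc]
  rw [eq_sub_of_add_eq h₁]
  module

/-- The root vector of two letters gives the relation `low`; all later letters commute with `f i`
and leave the factor `p` unchanged. -/
theorem rootVec_first (hp : p ≠ 0) (h : Serre p f) (i d : ℕ) :
    f i * rootVec p f i (d + 1) = p • (rootVec p f i (d + 1) * f i) := by
  induction d with
  | zero =>
    have h₁ := h.low i
    simp only [rootVec, add_zero]
    generalize f (i + 1) = g at *
    generalize f i = x at *
    simp only [mul_sub, sub_mul, mul_smul_comm, smul_mul_assoc, smul_sub, ← mul_assoc]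
    rw [eq_sub_of_add_eq h₁]
    match_scalars <;> field_simp
    ring
  | succ d ih =>
    have h₂ := h.comm i (i + (d + 1) + 1) (by omega)
    rw [rootVec]
    generalize rootVec p f i (d + 1) = g at *
    generalize f (i + (d + 1) + 1) = x at *
    rw [mul_sub, mul_smul_comm, ← mul_assoc, h₂, mul_assoc, ih, ← mul_assoc, ih, sub_mul,
      smul_mul_assoc, smul_mul_assoc, mul_assoc (g) (f i), h₂, mul_smul_comm]
    simp only [smul_sub, mul_assoc]

/-- Iterated `p`-commutators can be bracketed from either end because the two end letters commute.
-/
theorem rootVec_left (h : Serre p f) (i d : ℕ) :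
    rootVec p f (i + 1) d * f i - p • (f i * rootVec p f (i + 1) d) = rootVec p f i (d + 1) := by
  induction d with
  | zero => simp [rootVec]
  | succ d ih =>
    have h₂ := h.comm i (i + (d + 1) + 1) (by omega)
    rw [rootVec.eq_def p f i (d + 1 + 1)]
    simp only [← ih]
    rw [rootVec, show i + 1 + d + 1 = i + (d + 1) + 1 by ring]
    generalize rootVec p f (i + 1) d = g at *
    generalize f (i + (d + 1) + 1) = x at *
    simp only [mul_sub, sub_mul, mul_smul_comm, smul_mul_assoc, smul_sub, ← mul_assoc]
    rw [h₂, mul_assoc g x, ← h₂]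
    simp only [← mul_assoc]
    module

/-- Here `F` is both the `p`-commutator of `a` and `g` and that of `y` and `H`. The two descriptions
evaluate `p • (a * H - H * a)` as `x * F - p ^ 2 • (F * x)` and as `F * x - p ^ 2 • (x * F)`.
Equating them gives the commutation multiplied by `1 + p ^ 2`. -/
theorem rootVec_mid_base (hp : p ≠ 0) (hp₂ : 1 + p ^ 2 ≠ 0) (h : Serre p f) (i d : ℕ) :
    f (i + d + 1) * rootVec p f i (d + 2) = rootVec p f i (d + 2) * f (i + d + 1) := by
  have hR := rootVec_last hp h i d
  have hA := rootVec_first hp h (i + d + 1) 0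
  have hC := rootVec_commute_above h i d (i + d + 1 + 1) (by omega)
  have e₁ : rootVec p f i (d + 2) = f (i + d + 1 + 1) * rootVec p f i (d + 1) -
    p • (rootVec p f i (d + 1) * f (i + d + 1 + 1)) := rfl
  have e₂ : rootVec p f i (d + 1) =
    f (i + d + 1) * rootVec p f i d - p • (rootVec p f i d * f (i + d + 1)) := rfl
  have e₃ : rootVec p f (i + d + 1) (0 + 1) = f (i + d + 1 + 1) * f (i + d + 1) -
    p • (f (i + d + 1) * f (i + d + 1 + 1)) := rfl
  generalize rootVec p f (i + d + 1) (0 + 1) = a at *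
  generalize rootVec p f i (d + 2) = F at *
  generalize rootVec p f i (d + 1) = H at *
  generalize rootVec p f i d = g at *
  generalize f (i + d + 1 + 1) = y at *
  generalize f (i + d + 1) = x at *
  have e₄ : F = a * g - p • (g * a) := by
    rw [e₁, e₂, e₃]
    simp only [mul_sub, sub_mul, mul_smul_comm, smul_mul_assoc, smul_sub, ← mul_assoc]
    rw [mul_assoc x g y, ← hC]
    simp only [← mul_assoc]
    module
  have hxg : x * g = H + p • (g * x) := by rw [e₂]; module
  have e₅ : x * F = p • (a * H - H * a) + (p ^ 2) • (F * x) := by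
    rw [e₄, mul_sub, mul_smul_comm, ← mul_assoc, hA, ← mul_assoc, hxg, smul_mul_assoc, mul_assoc,
      hxg, add_mul, smul_mul_assoc, mul_assoc g x a, hA]
    simp only [mul_add, sub_mul, mul_smul_comm, smul_mul_assoc, ← mul_assoc]
    module
  have e₆ : x * F = x * y * H - H * x * y := by
    rw [e₁, mul_sub, mul_smul_comm, ← mul_assoc, ← mul_assoc, hR, smul_mul_assoc, smul_smul,
      mul_inv_cancel₀ hp, one_smul]
  have hHx : H * x = p • (x * H) := by rw [hR, smul_smul, mul_inv_cancel₀ hp, one_smul]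
  have e₇ : F * x = p • (y * x * H - H * y * x) := by
    rw [e₁, sub_mul, smul_mul_assoc, mul_assoc y H x, hHx, mul_smul_comm, smul_sub]
    simp only [mul_assoc]
  have e₈ : p • (a * H - H * a) = F * x - (p ^ 2) • (x * F) := by
    rw [e₆, e₇, e₃]
    simp only [mul_sub, sub_mul, mul_smul_comm, smul_mul_assoc, smul_sub, ← mul_assoc]
    module
  rw [e₈] at e₅
  have e₉ : (1 + p ^ 2) • (x * F) = (1 + p ^ 2) • (F * x) := by
    rw [add_smul, one_smul]
    nth_rewrite 1 [e₅]
    module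
  exact smul_right_injective A hp₂ e₉

theorem rootVec_mid (hp : p ≠ 0) (hp₂ : 1 + p ^ 2 ≠ 0) (h : Serre p f) (i d l : ℕ)
    (hil : i < l) (hl : l < i + d) :
    f l * rootVec p f i d = rootVec p f i d * f l := by
  induction d with
  | zero => omega
  | succ d ih =>
    rcases Nat.lt_or_ge l (i + d) with hd | hd
    · have h₁ := ih hd
      have h₂ := h.comm l (i + d + 1) (by omega)
      simp only [rootVec, mul_sub, sub_mul, mul_smul_comm, smul_mul_assoc]
      rw [← mul_assoc, h₂, mul_assoc, h₁, mul_assoc (rootVec p f i d), ← h₂, ← mul_assoc (f l), h₁]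
      simp only [mul_assoc]
    · obtain ⟨e, rfl⟩ : ∃ e, d = e + 1 := ⟨d - 1, by omega⟩
      obtain rfl : l = i + e + 1 := by omega
      exact rootVec_mid_base hp hp₂ h i e

/-- Every letter of the shorter root vector but the first is interior to the longer one and commutes
with it, so only the first letter contributes the factor `p`. -/
theorem rootVec_same_start (hp : p ≠ 0) (hp₂ : 1 + p ^ 2 ≠ 0) (h : Serre p f) (i j k : ℕ)
    (hjk : j < k) :
    rootVec p f i j * rootVec p f i k = p • (rootVec p f i k * rootVec p f i j) := by
  induction j with
  | zero =>
    obtain ⟨e, rfl⟩ : ∃ e, k = e + 1 := ⟨k - 1, by omega⟩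
    exact rootVec_first hp h i e
  | succ j ih =>
    have h₁ := ih (by omega)
    have h₂ := rootVec_mid hp hp₂ h i k (i + j + 1) (by omega) (by omega)
    rw [rootVec.eq_def p f i (j + 1)]
    simp only [mul_sub, sub_mul, mul_smul_comm, smul_mul_assoc]
    rw [mul_assoc, h₁, mul_assoc (rootVec p f i j), h₂, ← mul_assoc (rootVec p f i j), h₁,
      mul_smul_comm, ← mul_assoc, h₂]
    simp only [smul_sub, smul_mul_assoc, mul_assoc]

/-- The coproduct preserves the Serre relations. -/
theorem serre_add {t : 𝕜} (ht : t ≠ 0) {a b : ℕ → A} (ha : Serre t a) (hb : Serre t b)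
    (h₀ : ∀ i, b i * a i = t ^ 2 • (a i * b i))
    (h₁ : ∀ i, b i * a (i + 1) = t⁻¹ • (a (i + 1) * b i))
    (h₂ : ∀ i, b (i + 1) * a i = t⁻¹ • (a i * b (i + 1)))
    (h₃ : ∀ i j, i + 1 < j → b i * a j = a j * b i)
    (h₄ : ∀ i j, i + 1 < j → b j * a i = a i * b j) :
    Serre t fun i => a i + b i := by
  -- `low` and `high` are one cubic relation with the two neighbours exchanged. It is checked by
  -- moving every `b` to the right of every `a`.
  have key : ∀ a₁ b₁ a₂ b₂ : A, a₁ * a₁ * a₂ + a₂ * a₁ * a₁ = (t + t⁻¹) • (a₁ * a₂ * a₁) →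
      b₁ * b₁ * b₂ + b₂ * b₁ * b₁ = (t + t⁻¹) • (b₁ * b₂ * b₁) →
      b₁ * a₁ = t ^ 2 • (a₁ * b₁) →
      b₁ * a₂ = t⁻¹ • (a₂ * b₁) → b₂ * a₁ = t⁻¹ • (a₁ * b₂) →
      (a₁ + b₁) * (a₁ + b₁) * (a₂ + b₂) + (a₂ + b₂) * (a₁ + b₁) * (a₁ + b₁) =
      (t + t⁻¹) • ((a₁ + b₁) * (a₂ + b₂) * (a₁ + b₁)) := by
    intro a₁ b₁ a₂ b₂ hA hB h11 h12 h21
    have h11' : ∀ z, z * b₁ * a₁ = t ^ 2 • (z * a₁ * b₁) := fun z => by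
      rw [mul_assoc, h11, mul_smul_comm, mul_assoc]
    have h12' : ∀ z, z * b₁ * a₂ = t⁻¹ • (z * a₂ * b₁) := fun z => by
      rw [mul_assoc, h12, mul_smul_comm, mul_assoc]
    have h21' : ∀ z, z * b₂ * a₁ = t⁻¹ • (z * a₁ * b₂) := fun z => by
      rw [mul_assoc, h21, mul_smul_comm, mul_assoc]
    simp only [mul_add, add_mul, h11, h12, h21, h11', h12', h21', smul_mul_assoc, smul_add]
    rw [eq_sub_of_add_eq hA, eq_sub_of_add_eq hB]
    match_scalars <;> field_simp <;> ring
  refine ⟨fun i j hij => ?_, fun i => ?_, fun i => ?_⟩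
  · simp only [mul_add, add_mul, ha.comm i j hij, hb.comm i j hij, h₃ i j hij, h₄ i j hij]
    abel
  · exact key _ _ _ _ (ha.low i) (hb.low i) (h₀ i) (h₁ i) (h₂ i)
  · exact key _ _ _ _ (ha.high i) (hb.high i) (h₀ _) (h₂ i) (h₁ i)

end RootVectors
end SLWeb

namespace SLWeb
open Finset

set_option linter.unusedSimpArgs false
set_option linter.flexible false

/-! ### Operators on the exterior algebra that move one element of a set -/

section MoveOperators

variable {N : ℕ}

/-- The basis vector `x_S` of `Λ_q^•`. -/
noncomputable def ket (S : Finset (Fin N)) : Finset (Fin N) → K := Pi.single S 1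

theorem op_ext {A B : Op N} (h : ∀ S, A.mulVec (ket S) = B.mulVec (ket S)) : A = B :=
  Matrix.ext_of_mulVec_single h

/-- Replacing `a` by `b`. -/
def mv (a b : Fin N) (S : Finset (Fin N)) : Finset (Fin N) := insert b (S.erase a)

theorem mem_mv {a b t : Fin N} {S : Finset (Fin N)} :
    t ∈ mv a b S ↔ t = b ∨ (t ≠ a ∧ t ∈ S) := by
  simp [mv]

/-- The number of elements of `S` strictly between `i` and `j`. -/
def between (i j : Fin N) (S : Finset (Fin N)) : ℕ := ((Ioo i j) ∩ S).card

theorem between_eq_sum (i j : Fin N) (S : Finset (Fin N)) :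
    between i j S = ∑ t ∈ Ioo i j, if t ∈ S then 1 else 0 := by
  rw [between, ← filter_mem_eq_inter, card_filter]

theorem between_mv {i j a b : Fin N} {S : Finset (Fin N)} (ha : a ∈ S) (hb : b ∉ S) :
    between i j (mv a b S) + (if a ∈ Ioo i j then 1 else 0) =
      between i j S + if b ∈ Ioo i j then 1 else 0 := by
  have hab : a ≠ b := fun h => hb (h ▸ ha)
  simp only [between_eq_sum]
  rw [← sum_ite_eq' (Ioo i j) a fun _ => 1, ← sum_ite_eq' (Ioo i j) b fun _ => 1,
    ← sum_add_distrib, ← sum_add_distrib]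
  refine sum_congr rfl fun t _ => ?_
  by_cases h₁ : t = a
  · subst h₁; simp [mem_mv, ha, hab]
  · by_cases h₂ : t = b
    · subst h₂; simp [mem_mv, hb, h₁]
    · simp [mem_mv, h₁, h₂]

theorem between_succ_right {i l l' : Fin N} (hl : l'.val = l.val + 1) (hi : i < l)
    (S : Finset (Fin N)) : between i l' S = between i l S + if l ∈ S then 1 else 0 := by
  have : Ioo i l' = insert l (Ioo i l) := by
    ext t; simp only [mem_Ioo, mem_insert, Fin.lt_def, Fin.ext_iff] at *; omega
  rw [between_eq_sum, between_eq_sum, this, sum_insert (by simp), add_comm]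

theorem between_succ_left {j l l' : Fin N} (hl : l'.val = l.val + 1) (hj : l' < j)
    (S : Finset (Fin N)) : between l j S = between l' j S + if l' ∈ S then 1 else 0 := by
  have : Ioo l j = insert l' (Ioo l' j) := by
    ext t; simp only [mem_Ioo, mem_insert, Fin.lt_def, Fin.ext_iff] at *; omega
  rw [between_eq_sum, between_eq_sum, this, sum_insert (by simp), add_comm]

theorem between_succ_self {l l' : Fin N} (hl : l'.val = l.val + 1)
    (S : Finset (Fin N)) : between l l' S = 0 := by
  have : Ioo l l' = ∅ := by
    ext t; simp only [mem_Ioo, Fin.lt_def, notMem_empty, iff_false] at *; omega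
  rw [between, this]; simp

theorem moveOp_ket (a b : Fin N) (S : Finset (Fin N)) :
    (moveOp a b).mulVec (ket S) = if a ∈ S ∧ b ∉ S then ket (mv a b S) else 0 := by
  ext S'
  by_cases h : a ∈ S ∧ b ∉ S
  · simp [moveOp, h, mv, Pi.single_apply, ket]
  · simp only [ket, Matrix.mulVec_single_one, Matrix.col_apply, moveOp, Matrix.of_apply, if_neg h,
      Pi.zero_apply, ite_eq_right_iff, one_ne_zero, imp_false]
    tauto

/-- The move of `a` to `b`, where every element in between is passed at the cost of `r`. -/
noncomputable def weightedMove (r : K) (a b : Fin N) : Op N :=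
  Matrix.of fun S' S => if a ∈ S ∧ b ∉ S ∧ S' = mv a b S then r ^ between b a S else 0

theorem weightedMove_ket (r : K) (a b : Fin N) (S : Finset (Fin N)) :
    (weightedMove r a b).mulVec (ket S) =
      if a ∈ S ∧ b ∉ S then r ^ between b a S • ket (mv a b S) else 0 := by
  ext S'
  by_cases h : a ∈ S ∧ b ∉ S
  · simp [weightedMove, h, Pi.single_apply, ket]
  · simp only [ket, Matrix.mulVec_single_one, Matrix.col_apply, weightedMove, Matrix.of_apply, if_neg h,
      Pi.zero_apply]
    rw [if_neg (by tauto)]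

/-- The operator `z ^ weight`. -/
noncomputable def weightOp (z : K) (i : ℕ) : Op N := Matrix.diagonal fun S => z ^ weight i S

theorem weightOp_ket (z : K) (i : ℕ) (S : Finset (Fin N)) :
    (weightOp z i).mulVec (ket S) = z ^ weight i S • ket S := by
  ext S'
  simp only [ket, weightOp, Matrix.mulVec_single_one, Matrix.col_apply, Matrix.diagonal_apply,
    Pi.smul_apply, Pi.single_apply, smul_eq_mul, mul_ite, mul_one, mul_zero]
  split_ifs with h <;> simp_all

theorem weight_eq {l l' : Fin N} (hl : l'.val = l.val + 1) (S : Finset (Fin N)) :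
    weight l S = (if l ∈ S then 1 else 0) - if l' ∈ S then 1 else 0 := by
  have h : ∀ a : Fin N, ((S.filter fun j : Fin N => j.val = a.val).card : ℤ) =
      if a ∈ S then 1 else 0 := by
    intro a
    simp only [← Fin.ext_iff, filter_eq']
    split_ifs <;> simp
  rw [weight, h l, ← hl, h l']

theorem Kinv_eq (i : ℕ) : Kinv₁ N i = weightOp q⁻¹ i := by
  simp [Kinv₁, weightOp]

theorem F_one_eq {l l' : Fin N} (hl : l'.val = l.val + 1) : F₁ N l = moveOp l l' := by
  have h : l.val + 1 < N := hl ▸ l'.2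
  rw [F₁, dif_pos h]
  congr 1
  exact Fin.ext hl.symm

theorem E_one_eq {l l' : Fin N} (hl : l'.val = l.val + 1) : E₁ N l = moveOp l' l := by
  have h : l.val + 1 < N := hl ▸ l'.2
  rw [E₁, dif_pos h]
  congr 1
  exact Fin.ext hl.symm

open Matrix in
-- The moves touch disjoint pairs, and `h` ensures that moving `l` to `l'` does not change the
-- number of elements passed between `i` and `j`.
theorem moveOp_comm_weightedMove (r : K) {i j l l' : Fin N} (h₁ : l ≠ i) (h₂ : l ≠ j)
    (h₃ : l' ≠ i) (h₄ : l' ≠ j) (h : l ∈ Ioo i j ↔ l' ∈ Ioo i j) :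
    moveOp l l' * weightedMove r j i = weightedMove r j i * moveOp l l' := by
  refine op_ext fun S => ?_
  simp only [← mulVec_mulVec, moveOp_ket, weightedMove_ket]
  by_cases c₁ : j ∈ S ∧ i ∉ S
  · by_cases c₂ : l ∈ S ∧ l' ∉ S
    · have hb := between_mv (i := i) (j := j) c₂.1 c₂.2
      simp only [h, Nat.add_right_cancel_iff] at hb
      simp only [c₁, c₂, mulVec_smul, moveOp_ket, weightedMove_ket, mem_mv, h₁.symm, h₂.symm,
        h₃.symm, h₄.symm, h₁, h₂, h₃, h₄, not_false_eq_true, and_self, ite_true, ne_eq, or_true,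
        or_false, and_false, hb]
      congr 2
      ext t
      simp only [mem_mv]
      grind
    · simp only [c₁, c₂, mulVec_smul, moveOp_ket, mem_mv, h₁, h₂, h₃, h₄, false_or,
        not_false_eq_true, and_self, ite_true, true_and, ite_false, mulVec_zero, smul_zero, ne_eq]
  · by_cases c₂ : l ∈ S ∧ l' ∉ S
    · simp only [c₁, c₂, weightedMove_ket, mem_mv, h₁.symm, h₂.symm, h₃.symm, h₄.symm, false_or,
        not_false_eq_true, and_self, ite_true, true_and, ite_false, mulVec_zero, ne_eq]
    · simp [c₁, c₂]

open Matrix in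
theorem weightedMove_moveOp_zero (r : K) {i l l' : Fin N} (h : l ≠ l') :
    weightedMove r l i * moveOp l l' = 0 := by
  refine op_ext fun S => ?_
  simp only [← mulVec_mulVec, moveOp_ket, zero_mulVec]
  by_cases c₂ : l ∈ S ∧ l' ∉ S <;> simp [c₂, weightedMove_ket, mem_mv, h]

open Matrix in
theorem moveOp_weightedMove_zero (r : K) {i l l' : Fin N} (h : l ≠ i) :
    moveOp l l' * weightedMove r l i = 0 := by
  refine op_ext fun S => ?_
  simp only [← mulVec_mulVec, weightedMove_ket, zero_mulVec]
  by_cases c₂ : l ∈ S ∧ i ∉ S <;> simp [c₂, moveOp_ket, mem_mv, h, mulVec_smul]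

open Matrix in
theorem weightedMove_moveOp_zero' (r : K) {j l l' : Fin N} :
    weightedMove r j l' * moveOp l l' = 0 := by
  refine op_ext fun S => ?_
  simp only [← mulVec_mulVec, moveOp_ket, zero_mulVec]
  by_cases c₂ : l ∈ S ∧ l' ∉ S <;> simp [c₂, weightedMove_ket, mem_mv]

open Matrix in
theorem moveOp_weightedMove_zero' (r : K) {j l l' : Fin N} :
    moveOp l l' * weightedMove r j l' = 0 := by
  refine op_ext fun S => ?_
  simp only [← mulVec_mulVec, weightedMove_ket, zero_mulVec]
  by_cases c₂ : j ∈ S ∧ l' ∉ S <;> simp [c₂, moveOp_ket, mem_mv, mulVec_smul]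

open Matrix in
theorem weightedMove_same_target (r : K) {j k l : Fin N} :
    weightedMove r j l * weightedMove r k l = 0 := by
  refine op_ext fun S => ?_
  simp only [← mulVec_mulVec, weightedMove_ket, zero_mulVec]
  by_cases c₂ : k ∈ S ∧ l ∉ S <;> simp [c₂, weightedMove_ket, mem_mv, mulVec_smul]

open Matrix in
theorem weightedMove_same_source (r : K) {j i l : Fin N} (h : j ≠ i) :
    weightedMove r j l * weightedMove r j i = 0 := by
  refine op_ext fun S => ?_
  simp only [← mulVec_mulVec, weightedMove_ket, zero_mulVec]
  by_cases c₂ : j ∈ S ∧ i ∉ S <;> simp [c₂, weightedMove_ket, mem_mv, mulVec_smul, h]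

/-- The exponent of the weight of the basis vector `x_i` of the vector representation. -/
def vecWeight (l l' i : Fin N) : ℤ := (if i = l then 1 else 0) - if i = l' then 1 else 0

theorem weight_mv {i j l l' : Fin N} (hl : l'.val = l.val + 1) {S : Finset (Fin N)} (hj : j ∈ S)
    (hi : i ∉ S) : weight l (mv j i S) = vecWeight l l' i - vecWeight l l' j + weight l S := by
  have hij : i ≠ j := fun h => hi (h ▸ hj)
  have hll : l ≠ l' := fun h => by simp [h] at hl
  have key : ∀ a : Fin N, ((if a ∈ mv j i S then 1 else 0) : ℤ) =
      (if i = a then 1 else 0) - (if j = a then 1 else 0) + if a ∈ S then 1 else 0 := by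
    intro a
    by_cases h₁ : i = a
    · subst h₁; simp [mem_mv, hi, hij.symm]
    · by_cases h₂ : j = a
      · subst h₂; simp [mem_mv, hj, h₁, Ne.symm hij]
      · simp [mem_mv, h₁, h₂, Ne.symm h₁, Ne.symm h₂]
  rw [weight_eq hl, weight_eq hl, key, key, vecWeight, vecWeight]
  ring

open Matrix in
theorem weightOp_weightedMove {z : K} (hz : z ≠ 0) (r : K) {i j l l' : Fin N}
    (hl : l'.val = l.val + 1) :
    weightOp z l * weightedMove r j i =
      z ^ (vecWeight l l' i - vecWeight l l' j) • (weightedMove r j i * weightOp z l) := by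
  refine op_ext fun S => ?_
  rw [smul_mulVec]
  simp only [← mulVec_mulVec, weightedMove_ket, weightOp_ket, mulVec_smul]
  by_cases c : j ∈ S ∧ i ∉ S
  · simp only [c, weightOp_ket, mulVec_smul, weight_mv hl c.1 c.2, zpow_add₀ hz, smul_smul,
      not_false_eq_true, and_self, ite_true]
    congr 1
    ring
  · simp [c]

open Matrix in
-- The commutator of a lowering generator with a raising root vector ending in the same simple root.
-- On each `x_S` at most one of the two products survives, according to whether `l'` lies in `S`;
-- the factor `weightOp p l` records which.
theorem moveOp_weightedMove_sub {p : K} (hp : p ≠ 0) {i l l' : Fin N} (hl : l'.val = l.val + 1)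
    (hi : i < l) :
    moveOp l l' * weightedMove (-p⁻¹) l' i - weightedMove (-p⁻¹) l' i * moveOp l l' =
      -(p⁻¹ • (weightedMove (-p⁻¹) l i * weightOp p l)) := by
  have hll : l ≠ l' := fun h => by simp [h] at hl
  have hil : i ≠ l := hi.ne
  have hil' : i ≠ l' := fun h => by subst h; rw [Fin.lt_def] at hi; omega
  refine op_ext fun S => ?_
  rw [neg_mulVec, smul_mulVec, sub_mulVec]
  simp only [← mulVec_mulVec, weightedMove_ket, weightOp_ket, mulVec_smul, moveOp_ket,
    weight_eq hl]
  by_cases ci : i ∈ S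
  · by_cases cl : l ∈ S <;> by_cases cl' : l' ∈ S <;>
      simp [ci, cl, cl', weightedMove_ket, mem_mv, hil, hil']
  by_cases cl : l ∈ S <;> by_cases cl' : l' ∈ S
  · have e : mv l l' (mv l' i S) = mv l i S := by ext t; simp only [mem_mv]; grind
    simp [ci, cl, cl', moveOp_ket, mem_mv, hll, hil, hil', Ne.symm hil, Ne.symm hil',
      e, between_succ_right hl hi, mulVec_smul, mulVec_neg, pow_succ, smul_smul]
    simp only [mul_comm, neg_smul]
  · have e : mv l' i (mv l l' S) = mv l i S := by ext t; simp only [mem_mv]; grind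
    have hb : between i l' (mv l l' S) = between i l S := by
      rw [between_succ_right hl hi]
      have := between_mv (i := i) (j := l) cl cl'
      have h₂ : ¬ l' < l := by rw [Fin.lt_def]; omega
      simp [h₂] at this
      simp [this, mem_mv, hll]
    simp [ci, cl, cl', weightedMove_ket, mem_mv, hil, hil', e, hb, smul_smul, hp]
  · simp [ci, cl, cl', moveOp_ket, mem_mv, hll, Ne.symm hil, mulVec_smul]
  · simp [ci, cl, cl']

open Matrix in
-- The relation between `E`, `F` and `K` of one `sl_2`. The weights on the exterior algebra are
-- `-1`, `0` and `1`, so its quantum integers are the weights themselves.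
theorem weightedMove_moveOp_commutator {p : K} {l l' : Fin N}
    (hl : l'.val = l.val + 1) :
    (p - p⁻¹) • (weightedMove (-p⁻¹) l' l * moveOp l l' - moveOp l l' * weightedMove (-p⁻¹) l' l) =
      weightOp p l - weightOp p⁻¹ l := by
  have hll : l ≠ l' := fun h => by simp [h] at hl
  refine op_ext fun S => ?_
  rw [smul_mulVec, sub_mulVec, sub_mulVec]
  simp only [← mulVec_mulVec, weightedMove_ket, weightOp_ket, moveOp_ket,
    weight_eq hl, between_succ_self hl, pow_zero, one_smul]
  by_cases cl : l ∈ S <;> by_cases cl' : l' ∈ S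
  · simp [cl, cl']
  · have e : mv l' l (mv l l' S) = S := by ext t; simp only [mem_mv]; grind
    simp [cl, cl', weightedMove_ket, mem_mv, e, between_succ_self hl, hll, sub_smul]
  · have e : mv l l' (mv l' l S) = S := by ext t; simp only [mem_mv]; grind
    simp [cl, cl', moveOp_ket, mem_mv, e, Ne.symm hll, sub_smul]
  · simp [cl, cl']

open Matrix in
theorem weightedMove_moveOp_sub {p : K} {j l l' : Fin N} (hl : l'.val = l.val + 1)
    (hj : l' < j) :
    weightedMove (-p⁻¹) j l * moveOp l l' - moveOp l l' * weightedMove (-p⁻¹) j l =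
      -(weightedMove (-p⁻¹) j l' * weightOp p⁻¹ l) := by
  have hll : l ≠ l' := fun h => by simp [h] at hl
  have hjl' : j ≠ l' := hj.ne'
  have hjl : j ≠ l := fun h => by subst h; rw [Fin.lt_def] at hj; omega
  refine op_ext fun S => ?_
  rw [neg_mulVec, sub_mulVec]
  simp only [← mulVec_mulVec, weightedMove_ket, weightOp_ket, mulVec_smul, moveOp_ket,
    weight_eq hl]
  by_cases cj : j ∈ S
  swap
  · by_cases cl : l ∈ S <;> by_cases cl' : l' ∈ S <;>
      simp [cj, cl, cl', weightedMove_ket, mem_mv, hjl, hjl']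
  by_cases cl : l ∈ S <;> by_cases cl' : l' ∈ S
  · simp [cj, cl, cl']
  · have e : mv j l (mv l l' S) = mv j l' S := by ext t; simp only [mem_mv]; grind
    have hb : between l j (mv l l' S) = between l' j S + 1 := by
      rw [between_succ_left hl hj]
      have := between_mv (i := l') (j := j) cl cl'
      have h₂ : ¬ l' < l := by rw [Fin.lt_def]; omega
      simp [h₂] at this
      simp [this, mem_mv]
    simp [cj, cl, cl', weightedMove_ket, mem_mv, hjl, hll, e, hb, smul_smul, pow_succ]
    simp only [mul_comm, neg_smul]
  · simp [cj, cl, cl', moveOp_ket, mem_mv, mulVec_smul, Ne.symm hll, Ne.symm hjl']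
  · have e : mv l l' (mv j l S) = mv j l' S := by ext t; simp only [mem_mv]; grind
    simp [cj, cl, cl', moveOp_ket, mem_mv, Ne.symm hjl', Ne.symm hll, e, mulVec_smul,
      between_succ_left hl hj]

open Matrix in
-- A simple raising move leads from weight `-1` to weight `1`, so both eigenvalues are `p`. This is
-- special to exterior powers.
theorem weightedMove_weightOp_simple {p : K} {l l' : Fin N}
    (hl : l'.val = l.val + 1) :
    weightedMove (-p⁻¹) l' l * weightOp p⁻¹ l = weightOp p l * weightedMove (-p⁻¹) l' l := by
  have hll : l ≠ l' := fun h => by simp [h] at hl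
  refine op_ext fun S => ?_
  simp only [← mulVec_mulVec, weightedMove_ket, weightOp_ket, mulVec_smul]
  by_cases cl : l ∈ S <;> by_cases cl' : l' ∈ S <;>
    simp [cl, cl', weightOp_ket, between_succ_self hl, weight_eq hl, mem_mv, Ne.symm hll]

open Matrix in
-- The terms on the left cancel if `l' ∈ S`. Otherwise the eigenvalues leave `1 - p ^ 2`, and the
-- same set is reached by the move through `l'`.
theorem weightedMove_weightOp_sub {p : K} {j l l' : Fin N} (hl : l'.val = l.val + 1)
    (hj : l' < j) :
    weightedMove (-p⁻¹) j l * weightOp p⁻¹ l - p • (weightOp p l * weightedMove (-p⁻¹) j l) =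
      (1 - p ^ 2) •
        (weightedMove (-p⁻¹) l' l * (weightedMove (-p⁻¹) j l' * weightOp p⁻¹ l)) := by
  have hll : l ≠ l' := fun h => by simp [h] at hl
  have hjl' : j ≠ l' := hj.ne'
  have hjl : j ≠ l := fun h => by subst h; rw [Fin.lt_def] at hj; omega
  refine op_ext fun S => ?_
  rw [smul_mulVec, sub_mulVec, smul_mulVec]
  simp only [← mulVec_mulVec, weightedMove_ket, weightOp_ket, mulVec_smul]
  by_cases cj : j ∈ S
  swap
  · simp [cj]
  by_cases cl : l ∈ S <;> by_cases cl' : l' ∈ S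
  · simp [cj, cl, cl']
  · simp [cj, cl, cl', weightedMove_ket, mem_mv, Ne.symm hjl, hll, mulVec_smul]
  · simp [cj, cl, cl', weightOp_ket, weight_eq hl, mem_mv, Ne.symm hjl', Ne.symm hll, mulVec_smul,
      smul_smul]
  · have e : mv l' l (mv j l' S) = mv j l S := by ext t; simp only [mem_mv]; grind
    simp [cj, cl, cl', weightedMove_ket, weightOp_ket, weight_eq hl, mem_mv, Ne.symm hjl', hll,
      Ne.symm hjl, e, Ne.symm hll, mulVec_smul, smul_smul, between_succ_left hl hj,
      between_succ_self hl]
    rw [← sub_smul]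
    congr 1
    ring

open Matrix in
-- Both products lead to the same set. On the left one more element is passed: there `k` crosses `j`
-- and `j` crosses the new `l'`, on the right `k` crosses only the new `l'`.
theorem weightedMove_exchange {p : K} {j k l l' : Fin N} (hl : l'.val = l.val + 1)
    (hj : l' < j) (hk : j < k) :
    weightedMove (-p⁻¹) j l * weightedMove (-p⁻¹) k l' =
      -(p⁻¹ • (weightedMove (-p⁻¹) k l * weightedMove (-p⁻¹) j l')) := by
  have hll : l ≠ l' := fun h => by simp [h] at hl
  have hjl' : j ≠ l' := hj.ne'
  have hjl : j ≠ l := fun h => by subst h; rw [Fin.lt_def] at hj; omega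
  have hkl' : k ≠ l' := (hj.trans hk).ne'
  have hkl : k ≠ l := fun h => by subst h; rw [Fin.lt_def] at hj hk; omega
  have hjk : j ≠ k := hk.ne
  refine op_ext fun S => ?_
  rw [neg_mulVec, smul_mulVec]
  simp only [← mulVec_mulVec, weightedMove_ket]
  by_cases cj : j ∈ S
  swap
  · by_cases ck : k ∈ S <;> by_cases cl' : l' ∈ S <;>
      simp [cj, ck, cl', weightedMove_ket, mem_mv, hjl', hjk, mulVec_smul]
  by_cases ck : k ∈ S
  swap
  · by_cases cl' : l' ∈ S <;>
      simp [cj, ck, cl', weightedMove_ket, mem_mv, hkl', hjk.symm, mulVec_smul]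
  by_cases cl : l ∈ S <;> by_cases cl' : l' ∈ S
  · simp [cj, ck, cl, cl']
  · simp [cj, ck, cl, cl', weightedMove_ket, mem_mv, hkl.symm, hjl.symm, mulVec_smul]
  · simp [cj, ck, cl, cl']
  · have e : mv j l (mv k l' S) = mv k l (mv j l' S) := by ext t; simp only [mem_mv]; grind
    have h₁ : ¬ k < j := hk.le.not_gt
    have b₁ := between_mv (i := l') (j := j) ck cl'
    have b₂ := between_mv (i := l') (j := k) cj cl'
    simp [h₁] at b₁
    simp [hj, hk] at b₂
    have c₁ : between l j (mv k l' S) = between l' j S + 1 := by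
      rw [between_succ_left hl hj, b₁]; simp [mem_mv]
    have c₂ : between l k (mv j l' S) = between l' k S := by
      rw [between_succ_left hl (hj.trans hk), ← b₂]; simp [mem_mv]
    simp [cj, ck, cl, cl', weightedMove_ket, mem_mv, hkl.symm, hjl.symm, hjk, hjk.symm, hll, e, c₁,
      c₂, ← b₂, mulVec_smul, mulVec_neg, smul_smul, pow_succ]
    congr 1
    ring

open Matrix in
-- The recursion of `rootE`. If `l ∉ S` only the first product survives; if `l ∈ S` only the second
-- does, and its factor `-p⁻¹` is the cost of passing `l`.
theorem weightedMove_moveOp_step {p : K} {i l l' : Fin N} (hl : l'.val = l.val + 1)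
    (hi : i < l) :
    weightedMove (-p⁻¹) l i * moveOp l' l - p⁻¹ • (moveOp l' l * weightedMove (-p⁻¹) l i) =
      weightedMove (-p⁻¹) l' i := by
  have hll : l ≠ l' := fun h => by simp [h] at hl
  have hil : i ≠ l := hi.ne
  have hil' : i ≠ l' := fun h => by subst h; rw [Fin.lt_def] at hi; omega
  refine op_ext fun S => ?_
  rw [sub_mulVec, smul_mulVec]
  simp only [← mulVec_mulVec, weightedMove_ket, moveOp_ket]
  by_cases ci : i ∈ S
  · by_cases cl : l ∈ S <;> by_cases cl' : l' ∈ S <;>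
      simp [ci, cl, cl', weightedMove_ket, mem_mv, hil, hil']
  by_cases cl : l ∈ S <;> by_cases cl' : l' ∈ S
  · have e : mv l' l (mv l i S) = mv l' i S := by ext t; simp only [mem_mv]; grind
    simp [ci, cl, cl', moveOp_ket, mem_mv, hll, hll.symm, hil.symm, hil', e, mulVec_smul,
      between_succ_right hl hi, smul_smul, pow_succ]
    simp only [mul_comm]
  · simp [ci, cl, cl', moveOp_ket, mem_mv, hll.symm, Ne.symm hil', mulVec_smul]
  · have e : mv l i (mv l' l S) = mv l' i S := by ext t; simp only [mem_mv]; grind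
    have hb : between i l (mv l' l S) = between i l S := by
      have := between_mv (i := i) (j := l) cl' cl
      have h₂ : ¬ l' < l := by rw [Fin.lt_def]; omega
      simpa [h₂] using this
    simp [ci, cl, cl', weightedMove_ket, mem_mv, hil, hil', e, hb, between_succ_right hl hi]
  · simp [ci, cl, cl', moveOp_ket, mem_mv, Ne.symm hil', hll.symm, mulVec_smul]

end MoveOperators
end SLWeb

namespace SLWeb
open Finset

/-! ### The quasi R-matrix as an ordered product, and its intertwining property -/

section QuasiR

/-- The core cancellation. Passing the second block costs the error `Y`; passing the first costs
`-Y` and a multiple of `Z`. The first block also acts on the error `Y` and produces `p • Z`, which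
removes the rest because `1 - p ^ 2 + p * (p - p⁻¹) = 0`. -/
theorem adjacent_blocks {𝕜 B : Type*} [Field 𝕜] [Ring B] [Algebra 𝕜 B] {p : 𝕜} (hp : p ≠ 0)
    {E SL SL' Y Z φ k k' : B} (ha : SL' * φ = φ * SL') (hb : SL' * k = k * SL' + Y)
    (hc : (p - p⁻¹) • (E * φ) = (p - p⁻¹) • (φ * E) + k' - k) (hd : SL * φ = φ * SL - Y)
    (he : E * k = k' * E) (hfz : SL * k = k' * SL + (1 - p ^ 2) • Z) (hg : Y * SL' = 0)
    (hh : Z * SL' = 0) (hi : E * Y = p • Z) (hj : SL * Y = 0) :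
    (1 + (p - p⁻¹) • (E + SL)) * (1 + (p - p⁻¹) • SL') * (φ + k) =
      (φ + k') * ((1 + (p - p⁻¹) • (E + SL)) * (1 + (p - p⁻¹) • SL')) := by
  have h₁ : (1 + (p - p⁻¹) • SL') * (φ + k) =
      (φ + k) * (1 + (p - p⁻¹) • SL') + (p - p⁻¹) • Y := by
    simp only [add_mul, mul_add, one_mul, mul_one, smul_mul_assoc, mul_smul_comm, ha, hb]
    module
  have h₂ : (1 + (p - p⁻¹) • (E + SL)) * (φ + k) =
      (φ + k') * (1 + (p - p⁻¹) • (E + SL)) - (p - p⁻¹) • Y +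
        ((p - p⁻¹) * (1 - p ^ 2)) • Z := by
    simp only [add_mul, mul_add, one_mul, mul_one, smul_mul_assoc, mul_smul_comm, hd, he, hfz,
      smul_add, hc]
    module
  rw [mul_assoc, h₁, mul_add, ← mul_assoc, h₂]
  simp only [add_mul, mul_add, sub_mul, one_mul, mul_one, smul_mul_assoc, mul_smul_comm, hg, hh,
    hi, hj, smul_add, smul_zero, mul_assoc]
  match_scalars <;> field_simp <;> ring

variable {N : ℕ} {A B : Type*} [Ring A] [Algebra K A] [Ring B] [Algebra K B]

/-- The root vector of `ε_j - ε_i`. -/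
noncomputable def rootFin (p : K) (f : ℕ → A) (i j : Fin N) : A := rootVec p f i (j - i - 1)

section
variable {p : K} {f : ℕ → A} {i j k l l' : Fin N}

theorem rootFin_commute (hp : p ≠ 0) (hp₂ : 1 + p ^ 2 ≠ 0) (h : Serre p f)
    (hl : l'.val = l.val + 1) (hij : i < j) (hi : i < l) (hj : j ≠ l) (hj' : j ≠ l') :
    f l * rootFin p f i j = rootFin p f i j * f l := by
  rw [Fin.lt_def] at *
  rw [ne_eq, Fin.ext_iff] at hj hj'
  rcases Nat.lt_or_gt_of_ne hj with h₁ | h₁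
  · exact rootVec_commute_above h _ _ _ (by omega)
  · exact rootVec_mid hp hp₂ h _ _ _ (by omega) (by omega)

theorem rootFin_commute_below (h : Serre p f) (hl : l'.val = l.val + 1) (hi : l' < i) :
    f l * rootFin p f i j = rootFin p f i j * f l :=
  rootVec_commute_below h _ _ _ (by rw [Fin.lt_def] at hi; omega)

theorem rootFin_succ (hl : l'.val = l.val + 1) (hi : i < l) :
    rootFin p f i l' = f l * rootFin p f i l - p • (rootFin p f i l * f l) := by
  rw [Fin.lt_def] at hi
  rw [rootFin, rootFin, show l'.val - i - 1 = (l - i - 1) + 1 by omega, rootVec,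
    show i.val + (l - i - 1) + 1 = l by omega]

theorem rootFin_last (hp : p ≠ 0) (h : Serre p f) (hl : l'.val = l.val + 1) (hi : i < l) :
    f l * rootFin p f i l' = p⁻¹ • (rootFin p f i l' * f l) := by
  rw [Fin.lt_def] at hi
  have := rootVec_last hp h i (l - i - 1)
  rwa [show i.val + (l - i - 1) + 1 = l by omega, show l.val - i - 1 + 1 = l' - i - 1 by omega]
    at this

theorem rootFin_simple (hl : l'.val = l.val + 1) : rootFin p f l l' = f l := by
  rw [rootFin, show l'.val - l - 1 = 0 by omega, rootVec]

theorem rootFin_left (h : Serre p f) (hl : l'.val = l.val + 1) (hj : l' < j) :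
    rootFin p f l' j * f l = p • (f l * rootFin p f l' j) + rootFin p f l j := by
  rw [Fin.lt_def] at hj
  have := rootVec_left h l (j - l' - 1)
  rw [← hl, show j.val - l' - 1 + 1 = j - l - 1 by omega] at this
  exact sub_eq_iff_eq_add'.mp this

theorem rootFin_first (hp : p ≠ 0) (h : Serre p f) (hl : l'.val = l.val + 1) (hj : l' < j) :
    f l * rootFin p f l j = p • (rootFin p f l j * f l) := by
  rw [Fin.lt_def] at hj
  have := rootVec_first hp h l (j - l - 2)
  rwa [show j.val - l - 2 + 1 = j - l - 1 by omega] at this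

theorem rootFin_same_start (hp : p ≠ 0) (hp₂ : 1 + p ^ 2 ≠ 0) (h : Serre p f) (hj : l < j)
    (hk : j < k) :
    rootFin p f l j * rootFin p f l k = p • (rootFin p f l k * rootFin p f l j) := by
  rw [Fin.lt_def] at *
  exact rootVec_same_start hp hp₂ h _ _ _ (by omega)

end

/-- A bilinear map that is multiplicative in the way of the tensor product of algebras. -/
def Multiplicative₂ (κ : Op N →ₗ[K] A →ₗ[K] B) : Prop :=
  ∀ a b x y, κ a x * κ b y = κ (a * b) (x * y)

/-- The factor of the quasi `R`-matrix of the roots that start at `i`. -/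
noncomputable def quasiRBlock (κ : Op N →ₗ[K] A →ₗ[K] B) (p : K) (f : ℕ → A) (i : Fin N) : B :=
  1 + (p - p⁻¹) • ∑ j ∈ Ioi i, κ (weightedMove (-p⁻¹) j i) (rootFin p f i j)

/-- The quasi `R`-matrix. -/
noncomputable def quasiR (κ : Op N →ₗ[K] A →ₗ[K] B) (p : K) (f : ℕ → A) : B :=
  ((List.range (N - 1)).flatMap fun i => (List.range (N - 1 - i)).map fun d =>
    1 + (p - p⁻¹) • κ (rootE p (E₁ N) i d) (rootVec p f i d)).prod

theorem rootE_eq {p : K} (i d : ℕ) (h : i + d + 1 < N) :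
    rootE p (E₁ N) i d = weightedMove (-p⁻¹) ⟨i + d + 1, h⟩ ⟨i, by omega⟩ := by
  induction d with
  | zero =>
    rw [rootE, E_one_eq (l := ⟨i, by omega⟩) (l' := ⟨i + 1, h⟩) rfl]
    refine op_ext fun S => ?_
    rw [moveOp_ket, weightedMove_ket, between_succ_self rfl]
    simp
  | succ d ih =>
    rw [rootE, ih (by omega), E_one_eq (l := ⟨i + d + 1, by omega⟩) (l' := ⟨i + d + 1 + 1, h⟩) rfl]
    exact weightedMove_moveOp_step rfl (by simp [Fin.lt_def])

theorem prod_one_add_of_mul_eq_zero {C : Type*} [Ring C] [Algebra K C] (c : K) (x : ℕ → C)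
    (hx : ∀ i j, x i * x j = 0) (n : ℕ) :
    ((List.range n).map fun d => 1 + c • x d).prod = 1 + c • ∑ d ∈ range n, x d := by
  induction n with
  | zero => simp
  | succ n ih =>
    have : (∑ d ∈ range n, x d) * x n = 0 := by
      rw [sum_mul]; exact sum_eq_zero fun d _ => hx d n
    rw [List.range_succ, List.map_append, List.prod_append, ih, sum_range_succ]
    simp only [List.map_singleton, List.prod_singleton, mul_add, add_mul, mul_one, one_mul,
      mul_smul_comm, smul_mul_assoc, this, smul_zero, smul_add]
    abel

/-- Roots that start at `i` all move an element to the same place `i`, so the product of any two of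
their raising vectors is zero and only linear terms remain. -/
theorem quasiRBlock_eq_prod {κ : Op N →ₗ[K] A →ₗ[K] B} (hκ : Multiplicative₂ κ) {p : K}
    {f : ℕ → A} (i : Fin N) :
    ((List.range (N - 1 - i)).map fun d =>
      1 + (p - p⁻¹) • κ (rootE p (E₁ N) i d) (rootVec p f i d)).prod = quasiRBlock κ p f i := by
  set x : ℕ → B := fun d => if h : i.val + d + 1 < N then
    κ (weightedMove (-p⁻¹) ⟨i + d + 1, h⟩ i) (rootVec p f i d) else 0 with hx
  have h₁ : ((List.range (N - 1 - i)).map fun d =>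
      1 + (p - p⁻¹) • κ (rootE p (E₁ N) i d) (rootVec p f i d)) =
      (List.range (N - 1 - i)).map fun d => 1 + (p - p⁻¹) • x d := by
    refine List.map_congr_left fun d hd => ?_
    rw [List.mem_range] at hd
    have : i.val + d + 1 < N := by omega
    rw [rootE_eq i.val d this]
    simp only [hx, this, dif_pos]
  rw [h₁, prod_one_add_of_mul_eq_zero, quasiRBlock]
  · congr 2
    refine sum_bij' (fun d hd => ⟨i + d + 1, by rw [mem_range] at hd; omega⟩)
      (fun j _ => j - i - 1) ?_ ?_ ?_ ?_ ?_
    · intro d hd; simp [Fin.lt_def]; try omega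
    · intro j hj
      have := j.2
      rw [mem_Ioi, Fin.lt_def] at hj
      rw [mem_range]; omega
    · intro d hd; simp only; omega
    · intro j hj
      rw [mem_Ioi, Fin.lt_def] at hj
      ext; simp only; omega
    · intro d hd
      rw [mem_range] at hd
      have : i.val + d + 1 < N := by omega
      simp only [hx, this, dif_pos, rootFin]
      congr 2
      omega
  · intro d e
    simp only [hx]
    split_ifs <;> simp [hκ _ _ _ _, weightedMove_same_target]

variable {κ : Op N →ₗ[K] A →ₗ[K] B} (hκ : Multiplicative₂ κ) {p : K} (hp : p ≠ 0)
  (hp₂ : 1 + p ^ 2 ≠ 0) {f : ℕ → A} (hf : Serre p f) {l l' : Fin N} (hl : l'.val = l.val + 1)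
include hκ hp hp₂ hf hl

/-- Only the roots ending at `l` and at `l'` fail to commute one by one, and their two errors
cancel. -/
theorem quasiRBlock_commute_low {i : Fin N} (hi : i < l) :
    quasiRBlock κ p f i * (κ (moveOp l l') 1 + κ (weightOp p l) (f l)) =
      (κ (moveOp l l') 1 + κ (weightOp p l) (f l)) * quasiRBlock κ p f i := by
  have hll : l ≠ l' := fun h => by simp [h] at hl
  have hil' : i < l' := by rw [Fin.lt_def] at *; omega
  rw [quasiRBlock, add_mul (1 : B), mul_add _ (1 : B), one_mul, mul_one, smul_mul_assoc, mul_smul_comm]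
  congr 2
  rw [← sub_eq_zero, sum_mul, mul_sum, ← sum_sub_distrib]
  set g : Fin N → B := fun j => κ (weightedMove (-p⁻¹) j i) (rootFin p f i j) *
    (κ (moveOp l l') 1 + κ (weightOp p l) (f l)) - (κ (moveOp l l') 1 + κ (weightOp p l) (f l)) *
    κ (weightedMove (-p⁻¹) j i) (rootFin p f i j) with hg
  have hsub : ({l, l'} : Finset (Fin N)) ⊆ Ioi i := by
    intro t ht
    simp only [mem_insert, mem_singleton] at ht
    rcases ht with rfl | rfl <;> simpa
  have expand : ∀ j, g j = κ (weightedMove (-p⁻¹) j i * moveOp l l') (rootFin p f i j) -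
      κ (moveOp l l' * weightedMove (-p⁻¹) j i) (rootFin p f i j) +
      κ (weightedMove (-p⁻¹) j i * weightOp p l) (rootFin p f i j * f l) -
      κ (weightOp p l * weightedMove (-p⁻¹) j i) (f l * rootFin p f i j) := by
    intro j
    simp only [hg, mul_add, add_mul, hκ _ _ _ _, mul_one, one_mul]
    abel
  have hl₁ : ¬ l' < l := by rw [Fin.lt_def]; omega
  have zero : ∀ j ∈ Ioi i, j ∉ ({l, l'} : Finset (Fin N)) → g j = 0 := by
    intro j hj hj'
    simp only [mem_insert, mem_singleton, not_or] at hj'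
    rw [mem_Ioi] at hj
    have hmem : l ∈ Ioo i j ↔ l' ∈ Ioo i j := by
      have h₁ := hj'.1
      have h₂ := hj'.2
      rw [Fin.ext_iff] at h₁ h₂
      simp only [mem_Ioo, hi, hil', true_and, Fin.lt_def]
      omega
    rw [expand, moveOp_comm_weightedMove _ hi.ne' (Ne.symm hj'.1) hil'.ne' (Ne.symm hj'.2) hmem,
      weightOp_weightedMove hp _ hl, rootFin_commute hp hp₂ hf hl hj hi hj'.1 hj'.2]
    simp [vecWeight, hi.ne, hil'.ne, hj'.1, hj'.2]
  rw [← sum_subset hsub zero, sum_pair hll, expand, expand,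
    weightedMove_moveOp_zero _ hll, moveOp_weightedMove_zero _ hi.ne']
  have h₁ : ∀ y, κ (weightedMove (-p⁻¹) l' i * moveOp l l') y -
      κ (moveOp l l' * weightedMove (-p⁻¹) l' i) y =
      p⁻¹ • κ (weightedMove (-p⁻¹) l i * weightOp p l) y := by
    intro y
    rw [← LinearMap.sub_apply, ← map_sub, ← neg_sub, moveOp_weightedMove_sub hp hl hi]
    simp
  rw [h₁, weightOp_weightedMove hp _ hl, weightOp_weightedMove hp _ hl,
    rootFin_last hp hf hl hi, rootFin_succ hl hi]
  simp only [vecWeight, hi.ne, hil'.ne, hll, hll.symm, if_true, if_false, map_sub, map_smul,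
    LinearMap.smul_apply, map_zero, LinearMap.zero_apply, smul_smul]
  norm_num [zpow_neg, hp]
  simp only [smul_sub, smul_smul, inv_mul_cancel₀ hp, one_smul]
  abel

omit hp₂ in
theorem quasiRBlock_commute_high {i : Fin N} (hi : l' < i) :
    quasiRBlock κ p f i * (κ (moveOp l l') 1 + κ (weightOp p⁻¹ l) (f l)) =
      (κ (moveOp l l') 1 + κ (weightOp p⁻¹ l) (f l)) * quasiRBlock κ p f i := by
  have hil : l < i := by rw [Fin.lt_def] at *; omega
  rw [quasiRBlock, add_mul (1 : B), mul_add _ (1 : B), one_mul, mul_one, smul_mul_assoc, mul_smul_comm]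
  congr 2
  rw [sum_mul, mul_sum]
  refine sum_congr rfl fun j hj => ?_
  rw [mem_Ioi] at hj
  have hmem : l ∈ Ioo i j ↔ l' ∈ Ioo i j := by
    simp [hil.not_gt, hi.not_gt]
  simp only [mul_add, add_mul, hκ _ _ _ _, mul_one, one_mul]
  rw [moveOp_comm_weightedMove _ hil.ne (hil.trans hj).ne hi.ne (hi.trans hj).ne hmem,
      weightOp_weightedMove (inv_ne_zero hp) _ hl, rootFin_commute_below hf hl hi]
  simp [vecWeight, hil.ne', hi.ne', (hil.trans hj).ne', (hi.trans hj).ne']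

/-- These two blocks alone turn `weightOp p⁻¹ l` into `weightOp p l`. The sum `Y` collects the
failures of commutation, and `Z` what the simple root vector makes of them. -/
theorem quasiRBlock_pair :
    quasiRBlock κ p f l * quasiRBlock κ p f l' *
        (κ (moveOp l l') 1 + κ (weightOp p⁻¹ l) (f l)) =
      (κ (moveOp l l') 1 + κ (weightOp p l) (f l)) *
        (quasiRBlock κ p f l * quasiRBlock κ p f l') := by
  have hll : l < l' := by rw [Fin.lt_def]; omega
  have hIoi : Ioi l = insert l' (Ioi l') := by
    ext t; simp only [mem_Ioi, mem_insert, Fin.lt_def, Fin.ext_iff]; omega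
  rw [quasiRBlock, quasiRBlock, hIoi, sum_insert (by simp), rootFin_simple hl]
  set e := weightedMove (N := N) (-p⁻¹)
  set E := κ (e l' l) (f l) with hE
  set SL := ∑ j ∈ Ioi l', κ (e j l) (rootFin p f l j) with hSL
  set SL' := ∑ j ∈ Ioi l', κ (e j l') (rootFin p f l' j) with hSL'
  set Y := ∑ j ∈ Ioi l', κ (e j l' * weightOp p⁻¹ l) (rootFin p f l j) with hY
  set Z := ∑ j ∈ Ioi l', κ (e l' l * (e j l' * weightOp p⁻¹ l)) (rootFin p f l j * f l) with hZ
  set φ := κ (moveOp l l') 1 with hφ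
  set k := κ (weightOp p⁻¹ l) (f l) with hk
  set k' := κ (weightOp p l) (f l) with hk'
  have hw : ∀ j ∈ Ioi l', weightOp p⁻¹ l * e j l' = p • (e j l' * weightOp p⁻¹ l) := by
    intro j hj
    rw [mem_Ioi] at hj
    rw [weightOp_weightedMove (inv_ne_zero hp) _ hl]
    simp [vecWeight, hll.ne', hj.ne', (hll.trans hj).ne', e]
  have hms : ∀ j ∈ Ioi l', e j l * moveOp l l' - moveOp l l' * e j l =
      -(e j l' * weightOp p⁻¹ l) := fun j hj => weightedMove_moveOp_sub hl (mem_Ioi.mp hj)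
  have hws : ∀ j ∈ Ioi l', e j l * weightOp p⁻¹ l - p • (weightOp p l * e j l) =
      (1 - p ^ 2) • (e l' l * (e j l' * weightOp p⁻¹ l)) :=
    fun j hj => weightedMove_weightOp_sub hl (mem_Ioi.mp hj)
  have hex : ∀ j t, l' < j → j < t → e j l * e t l' = -(p⁻¹ • (e t l * e j l')) :=
    fun j t hj ht => weightedMove_exchange hl hj ht
  have ha : SL' * φ = φ * SL' := by
    rw [hSL', sum_mul, mul_sum]
    refine sum_congr rfl fun j hj => ?_
    rw [hφ, hκ, hκ, weightedMove_moveOp_zero', moveOp_weightedMove_zero']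
    simp
  have hb : SL' * k = k * SL' + Y := by
    rw [hSL', sum_mul, mul_sum, hY, ← sum_add_distrib]
    refine sum_congr rfl fun j hj => ?_
    rw [hk, hκ, hκ, hw j hj, rootFin_left hf hl (mem_Ioi.mp hj)]
    simp
  have hc : (p - p⁻¹) • (E * φ) = (p - p⁻¹) • (φ * E) + k' - k := by
    rw [add_sub_assoc, ← sub_eq_iff_eq_add', ← smul_sub, hE, hφ, hκ, hκ, mul_one, one_mul,
      ← LinearMap.sub_apply, ← map_sub, ← LinearMap.smul_apply, ← map_smul,
      weightedMove_moveOp_commutator hl]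
    simp [hk, hk']
  have hd : SL * φ = φ * SL - Y := by
    rw [hSL, sum_mul, mul_sum, hY, ← sum_sub_distrib]
    refine sum_congr rfl fun j hj => ?_
    rw [hφ, hκ, hκ, mul_one, one_mul, sub_eq_iff_eq_add'.mp (hms j hj)]
    simp [sub_eq_add_neg]
  have he : E * k = k' * E := by
    rw [hE, hk, hk', hκ, hκ, weightedMove_weightOp_simple hl]
  have hfz : SL * k = k' * SL + (1 - p ^ 2) • Z := by
    rw [hSL, sum_mul, mul_sum, hZ, smul_sum, ← sum_add_distrib]
    refine sum_congr rfl fun j hj => ?_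
    rw [hk, hk', hκ, hκ, sub_eq_iff_eq_add'.mp (hws j hj),
      rootFin_first hp hf hl (mem_Ioi.mp hj)]
    simp
  have hg : Y * SL' = 0 := by
    rw [hY, hSL', sum_mul]
    refine sum_eq_zero fun j hj => ?_
    rw [mul_sum]
    refine sum_eq_zero fun t ht => ?_
    rw [hκ, mul_assoc, hw t ht, mul_smul_comm, ← mul_assoc, weightedMove_same_target]
    simp
  have hh : Z * SL' = 0 := by
    rw [hZ, hSL', sum_mul]
    refine sum_eq_zero fun j hj => ?_
    rw [mul_sum]
    refine sum_eq_zero fun t ht => ?_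
    rw [hκ, mul_assoc, mul_assoc, hw t ht, mul_smul_comm, ← mul_assoc (e j l'),
      weightedMove_same_target]
    simp
  have hi : E * Y = p • Z := by
    rw [hE, hY, mul_sum, hZ, smul_sum]
    refine sum_congr rfl fun j hj => ?_
    rw [hκ, rootFin_first hp hf hl (mem_Ioi.mp hj), map_smul]
  -- The double sum is antisymmetric: exchanging `j` and `t` gives `-p⁻¹` from the moves and `p`
  -- from the root vectors. The diagonal terms vanish because an element cannot be moved twice from
  -- the same place.
  have hj : SL * Y = 0 := by
    set T : Fin N → Fin N → B := fun j t => κ (e j l) (rootFin p f l j) *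
      κ (e t l' * weightOp p⁻¹ l) (rootFin p f l t) with hT
    have h₁ : SL * Y = ∑ j ∈ Ioi l', ∑ t ∈ Ioi l', T j t := by
      rw [hSL, hY, sum_mul_sum]
    have lt : ∀ j t, l' < j → j < t → T j t + T t j = 0 := by
      intro j t hj ht
      simp only [hT]
      rw [hκ, hκ, ← mul_assoc, ← mul_assoc, hex j t hj ht,
        rootFin_same_start hp hp₂ hf (hll.trans hj) ht]
      simp [smul_smul, hp]
    have all : ∀ j ∈ Ioi l', ∀ t ∈ Ioi l', T j t + T t j = 0 := by
      intro j hj t ht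
      rw [mem_Ioi] at hj ht
      rcases lt_trichotomy j t with h | h | h
      · exact lt j t hj h
      · subst h
        simp only [hT]
        rw [hκ, ← mul_assoc, weightedMove_same_source _ hj.ne']
        simp
      · rw [add_comm]; exact lt t j ht h
    have h₂ : (2 : K) • (SL * Y) = 0 := by
      rw [two_smul, congrArg₂ (· + ·) h₁ (h₁.trans sum_comm), ← sum_add_distrib]
      refine sum_eq_zero fun j hj => ?_
      rw [← sum_add_distrib]
      exact sum_eq_zero fun t ht => all j hj t ht
    have := smul_eq_zero.mp h₂
    simpa using this
  exact adjacent_blocks hp ha hb hc hd he hfz hg hh hi hj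

/-- The intertwining property of the quasi `R`-matrix. -/
theorem quasiR_intertwines :
    quasiR κ p f * (κ (moveOp l l') 1 + κ (weightOp p⁻¹ l) (f l)) =
      (κ (moveOp l l') 1 + κ (weightOp p l) (f l)) * quasiR κ p f := by
  set b : ℕ → B := fun i => if h : i < N then quasiRBlock κ p f ⟨i, h⟩ else 1 with hb
  have h₁ : quasiR κ p f = ((List.range (N - 1)).map b).prod := by
    rw [quasiR, List.flatMap, List.prod_flatten, List.map_map]
    congr 1
    refine List.map_congr_left fun i hi => ?_
    rw [List.mem_range] at hi
    have hi' : i < N := by omega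
    simp only [hb, hi', dif_pos, Function.comp_apply]
    exact quasiRBlock_eq_prod hκ (⟨i, hi'⟩ : Fin N)
  -- No positive root starts at the last index. Including this empty block lets the induction treat
  -- the pair at `l`, `l'` uniformly even when `l'` is the last index.
  have h₂ : b (N - 1) = 1 := by
    have hN : N - 1 < N := by have := l.2; omega
    have : Ioi (⟨N - 1, hN⟩ : Fin N) = ∅ := by
      ext t; have := t.2; simp [Fin.lt_def]; omega
    simp only [hb, hN, dif_pos, quasiRBlock, this]
    simp
  have h₃ : quasiR κ p f = ((List.range N).map b).prod := by
    have hN : N = N - 1 + 1 := by have := l.2; omega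
    rw [h₁, hN, List.range_succ, List.map_append, List.prod_append, ← hN]
    simp [h₂]
  set X := κ (moveOp l l') 1 + κ (weightOp p⁻¹ l) (f l)
  set X' := κ (moveOp l l') 1 + κ (weightOp p l) (f l)
  -- Reading the product from the right: blocks above `l'` commute with `X`, the pair at `l`, `l'`
  -- changes it into `X'`, and the blocks below `l` commute with `X'`.
  have low : ∀ n ≤ l.val, ((List.range n).map b).prod * X' = X' * ((List.range n).map b).prod := by
    intro n hn
    induction n with
    | zero => simp
    | succ n ih =>
      have hn' : n < N := by have := l.2; omega
      have hbn : b n * X' = X' * b n := by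
        simp only [hb, hn', dif_pos]
        exact quasiRBlock_commute_low hκ hp hp₂ hf hl (Fin.lt_def.mpr (by simpa using hn))
      simp only [List.range_succ, List.map_append, List.prod_append, List.map_singleton,
        List.prod_singleton]
      rw [mul_assoc, hbn, ← mul_assoc, ih (by omega), mul_assoc]
  have high : ∀ n, l.val + 2 ≤ n → n ≤ N →
      ((List.range n).map b).prod * X = X' * ((List.range n).map b).prod := by
    intro n hn
    induction n, hn using Nat.le_induction with
    | base =>
      intro hN
      have e₁ : b l = quasiRBlock κ p f l := by simp [hb]
      have e₂ : b (l + 1) = quasiRBlock κ p f l' := by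
        have : l.val + 1 < N := by omega
        simp only [hb, this, dif_pos]
        congr 1
        exact Fin.ext hl.symm
      simp only [List.range_succ, List.map_append, List.prod_append, List.map_singleton,
        List.prod_singleton, e₁, e₂]
      rw [mul_assoc, mul_assoc, ← mul_assoc (quasiRBlock κ p f l),
        quasiRBlock_pair hκ hp hp₂ hf hl, ← mul_assoc, low _ le_rfl]
      simp only [mul_assoc]
    | succ n hn ih =>
      intro hN
      have hn' : n < N := by omega
      have hbn : b n * X = X * b n := by
        simp only [hb, hn', dif_pos]
        exact quasiRBlock_commute_high hκ hp hf hl (Fin.lt_def.mpr (by simp; omega))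
      simp only [List.range_succ, List.map_append, List.prod_append, List.map_singleton,
        List.prod_singleton] at ih ⊢
      rw [mul_assoc, hbn, ← mul_assoc, ih (by omega), mul_assoc]
  rw [h₃]
  exact high N (by have := l'.2; omega) le_rfl

end QuasiR
end SLWeb

namespace SLWeb
open Finset

/-! ### Tensors of all lengths, their lowering operators and the bar involution -/

noncomputable section ListSpace

variable {N : ℕ}

/-- The space of tensors of all lengths: a tensor is the function of its coordinates, the leftmost
factor being the head of a list. -/
abbrev LS (N : ℕ) : Type := List (Finset (Fin N)) → K

/-- The operators on tensors of all lengths. -/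
abbrev LOp (N : ℕ) : Type := Module.End K (LS N)

/-- The coefficient of `x_S` in the leftmost factor. -/
def headOp (S : Finset (Fin N)) : LOp N where
  toFun φ y := φ (S :: y)
  map_add' _ _ := rfl
  map_smul' _ _ := rfl

/-- Tensoring with `x_S` on the left. -/
def consOp (S : Finset (Fin N)) : LOp N where
  toFun φ y := match y with
    | [] => 0
    | T :: z => if T = S then φ z else 0
  map_add' φ χ := by
    ext y; cases y
    · simp
    · simp only [Pi.add_apply]; split_ifs <;> simp
  map_smul' c φ := by
    ext y; cases y <;> simp

@[simp] theorem headOp_apply (S : Finset (Fin N)) (φ : LS N) (y) : headOp S φ y = φ (S :: y) := rfl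
@[simp] theorem consOp_nil (S : Finset (Fin N)) (φ : LS N) : consOp S φ [] = 0 := rfl
@[simp] theorem consOp_cons (S T : Finset (Fin N)) (φ : LS N) (z) :
    consOp S φ (T :: z) = if T = S then φ z else 0 := rfl

/-- `A ⊗ X`, with `A` acting on the leftmost factor. -/
def tensOp : Op N →ₗ[K] LOp N →ₗ[K] LOp N :=
  LinearMap.mk₂ K (fun A X =>
    { toFun := fun φ y => match y with
        | [] => 0
        | S :: z => ∑ T, A S T * X (headOp T φ) z
      map_add' := fun φ χ => by
        ext y; cases y
        · simp
        · simp [mul_add, sum_add_distrib]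
      map_smul' := fun c φ => by
        ext y; cases y
        · simp
        · simp [mul_sum, mul_left_comm] })
    (fun A A' X => by
      ext φ y; cases y
      · simp
      · simp [add_mul, sum_add_distrib])
    (fun c A X => by
      ext φ y; cases y
      · simp
      · simp [mul_sum, mul_assoc])
    (fun A X X' => by
      ext φ y; cases y
      · simp
      · simp [mul_add, sum_add_distrib])
    (fun c A X => by
      ext φ y; cases y
      · simp
      · simp [mul_sum, mul_left_comm])

@[simp] theorem tensOp_nil (A : Op N) (X : LOp N) (φ : LS N) : tensOp A X φ [] = 0 := rfl
@[simp] theorem tensOp_cons (A : Op N) (X : LOp N) (φ : LS N) (S z) :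
    tensOp A X φ (S :: z) = ∑ T, A S T * X (headOp T φ) z := rfl

theorem headOp_tensOp_apply (A : Op N) (X : LOp N) (φ : LS N) (S) :
    headOp S (tensOp A X φ) = ∑ T, A S T • X (headOp T φ) := by
  ext z; simp

theorem tensOp_mul : Multiplicative₂ (tensOp (N := N)) := by
  intro A A' X X'
  ext φ y
  cases y with
  | nil => rfl
  | cons S z =>
    simp only [Module.End.mul_apply, tensOp_cons, headOp_tensOp_apply, map_sum, map_smul,
      Finset.sum_apply, Pi.smul_apply, smul_eq_mul, mul_sum, Matrix.mul_apply, sum_mul]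
    rw [sum_comm]
    simp only [mul_assoc]

/-- `tensOp 1 1` is not the identity: it kills the coordinate at the empty list. It resolves every
other tensor along its leftmost factor. -/
theorem tensOp_one_one : tensOp (N := N) 1 1 = ∑ S, consOp S * headOp S := by
  ext φ y
  cases y with
  | nil => simp [LinearMap.sum_apply]
  | cons S z => simp [LinearMap.sum_apply, Matrix.one_apply]

theorem tensOp_consOp (A : Op N) (X : LOp N) (S : Finset (Fin N)) :
    tensOp A X * consOp S = ∑ T, A T S • (consOp T * X) := by
  have h : ∀ T φ, headOp T (consOp S φ) = if T = S then φ else 0 := by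
    intro T φ; ext y; simp only [headOp_apply, consOp_cons]; split_ifs <;> rfl
  ext φ y
  cases y with
  | nil => simp [LinearMap.sum_apply]
  | cons U z =>
    have h' : ∀ T, X (if T = S then φ else 0) z = if T = S then X φ z else 0 := by
      intro T; split_ifs <;> simp
    simp [LinearMap.sum_apply, h, h']

theorem headOp_tensOp (A : Op N) (X : LOp N) (S : Finset (Fin N)) :
    headOp S * tensOp A X = ∑ T, A S T • (X * headOp T) := by
  refine LinearMap.ext fun φ => ?_
  simp [headOp_tensOp_apply, LinearMap.sum_apply]

theorem weightOp_comm (z : K) (i j : ℕ) :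
    weightOp (N := N) z i * weightOp z j = weightOp z j * weightOp z i := by
  simp [weightOp, Matrix.diagonal_mul_diagonal, mul_comm]

/-- `E_{-i}` on tensors with `n` factors, for the coproduct with parameter `p`. -/
def Fop (N : ℕ) (p : K) (i : ℕ) : ℕ → LOp N
  | 0 => 0
  | n + 1 => tensOp (F₁ N i) 1 + tensOp (weightOp p⁻¹ i) (Fop N p i n)

theorem F_one_eq_zero {i : ℕ} (h : ¬ i + 1 < N) : F₁ N i = 0 := by
  rw [F₁, dif_neg h]

theorem Fop_eq_zero {p : K} {i : ℕ} (h : ¬ i + 1 < N) (n : ℕ) : Fop N p i n = 0 := by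
  induction n with
  | zero => rfl
  | succ n ih => rw [Fop, ih, F_one_eq_zero h]; simp

theorem moveOp_eq (a b : Fin N) : moveOp a b = weightedMove 1 a b := by
  refine op_ext fun S => ?_
  rw [moveOp_ket, weightedMove_ket]
  simp

/-- The exponents are the entries of the Cartan matrix of type `A`. -/
theorem weightOp_F_one {p : K} (hp : p ≠ 0) {i j : ℕ} (hi : i + 1 < N) :
    weightOp p⁻¹ i * F₁ N j =
      p ^ (if i = j then 2 else if i = j + 1 ∨ j = i + 1 then -1 else 0 : ℤ) •
        (F₁ N j * weightOp p⁻¹ i) := by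
  by_cases hj : j + 1 < N
  · have h₁ := weightOp_weightedMove (inv_ne_zero hp) 1 (i := ⟨j + 1, hj⟩) (j := ⟨j, by omega⟩)
      (l := (⟨i, by omega⟩ : Fin N)) (l' := ⟨i + 1, hi⟩) rfl
    rw [F_one_eq (l := ⟨j, by omega⟩) (l' := ⟨j + 1, hj⟩) rfl, moveOp_eq, h₁, inv_zpow']
    congr 2
    simp only [vecWeight, Fin.mk.injEq]
    split_ifs <;> omega
  · simp [F_one_eq_zero hj]

theorem F_one_sq (i : ℕ) : F₁ N i * F₁ N i = 0 := by
  by_cases h : i + 1 < N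
  · rw [F_one_eq (l := ⟨i, by omega⟩) (l' := ⟨i + 1, h⟩) rfl]
    nth_rewrite 1 [moveOp_eq]
    exact weightedMove_moveOp_zero 1 (by simp)
  · simp [F_one_eq_zero h]

/-- With `F_one_sq`, every term of the cubic Serre relations vanishes separately on the exterior
algebra, so these relations hold for every `p`. -/
theorem F_one_triple (i : ℕ) : F₁ N i * F₁ N (i + 1) * F₁ N i = 0 ∧
    F₁ N (i + 1) * F₁ N i * F₁ N (i + 1) = 0 := by
  have n₁ : ¬ i = i + 1 + 1 := by omega
  have n₂ : ¬ i + 1 + 1 = i := by omega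
  by_cases h : i + 1 + 1 < N
  · rw [F_one_eq (l := ⟨i, by omega⟩) (l' := ⟨i + 1, by omega⟩) rfl,
      F_one_eq (l := ⟨i + 1, by omega⟩) (l' := ⟨i + 1 + 1, h⟩) rfl]
    constructor
    · refine op_ext fun S => ?_
      simp only [← Matrix.mulVec_mulVec, moveOp_ket, Matrix.zero_mulVec]
      by_cases c : (⟨i, by omega⟩ : Fin N) ∈ S ∧ (⟨i + 1, by omega⟩ : Fin N) ∉ S
      · by_cases d : (⟨i + 2, by omega⟩ : Fin N) ∈ S <;>
          simp [c, d, moveOp_ket, mem_mv, n₁, n₂]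
      · simp [c]
    · refine op_ext fun S => ?_
      simp only [← Matrix.mulVec_mulVec, moveOp_ket, Matrix.zero_mulVec]
      by_cases c : (⟨i + 1, by omega⟩ : Fin N) ∈ S ∧ (⟨i + 1 + 1, by omega⟩ : Fin N) ∉ S
      · by_cases d : (⟨i, by omega⟩ : Fin N) ∈ S <;>
          simp [c, d, moveOp_ket, mem_mv, n₁, n₂]
      · simp [c]
  · simp [F_one_eq_zero h]

theorem F_one_comm {i j : ℕ} (hij : i + 1 < j) : F₁ N i * F₁ N j = F₁ N j * F₁ N i := by
  by_cases h : j + 1 < N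
  · rw [F_one_eq (l := ⟨i, by omega⟩) (l' := ⟨i + 1, by omega⟩) rfl,
      F_one_eq (l := ⟨j, by omega⟩) (l' := ⟨j + 1, h⟩) rfl]
    nth_rewrite 2 [moveOp_eq]
    nth_rewrite 2 [moveOp_eq]
    refine moveOp_comm_weightedMove 1 ?_ ?_ ?_ ?_ ?_ <;> simp [Fin.lt_def] <;> omega
  · simp [F_one_eq_zero h]

theorem serre_F_one {p : K} : Serre p (F₁ N) where
  comm i j h := F_one_comm h
  low i := by rw [(F_one_triple i).1, F_one_sq, mul_assoc, F_one_sq]; simp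
  high i := by rw [(F_one_triple i).2, F_one_sq, mul_assoc, F_one_sq]; simp

theorem serre_Fop {p : K} (hp : p ≠ 0) (n : ℕ) : Serre p fun i => Fop N p i n := by
  induction n with
  | zero => refine ⟨?_, ?_, ?_⟩ <;> simp [Fop]
  | succ n ih =>
    have hk := tensOp_mul (N := N)
    have comm : ∀ i j, tensOp (weightOp p⁻¹ i) (Fop N p i n) * tensOp (F₁ N j) 1 =
        p ^ (if i = j then 2 else if i = j + 1 ∨ j = i + 1 then -1 else 0 : ℤ) •
          (tensOp (F₁ N j) 1 * tensOp (weightOp p⁻¹ i) (Fop N p i n)) := by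
      intro i j
      by_cases hi : i + 1 < N
      · rw [hk, hk, weightOp_F_one hp hi, map_smul, LinearMap.smul_apply, one_mul, mul_one]
      · simp [Fop_eq_zero hi]
    refine serre_add hp (a := fun i => tensOp (F₁ N i) 1)
      (b := fun i => tensOp (weightOp p⁻¹ i) (Fop N p i n)) ⟨?_, ?_, ?_⟩ ⟨?_, ?_, ?_⟩
      ?_ ?_ ?_ ?_ ?_
    · intro i j h
      simp only [hk _ _ _ _, F_one_comm h]
    · intro i
      simp only [hk _ _ _ _, mul_one]
      rw [← LinearMap.add_apply, ← map_add, serre_F_one.low (p := p) i, map_smul,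
        LinearMap.smul_apply]
    · intro i
      simp only [hk _ _ _ _, mul_one]
      rw [← LinearMap.add_apply, ← map_add, serre_F_one.high (p := p) i, map_smul,
        LinearMap.smul_apply]
    · intro i j h
      simp only [hk _ _ _ _, ih.comm i j h]
      rw [weightOp_comm]
    · intro i
      have h := ih.low i
      simp only [hk _ _ _ _]
      rw [weightOp_comm p⁻¹ i (i + 1), mul_assoc (weightOp p⁻¹ (i + 1)),
        mul_assoc (weightOp p⁻¹ i), weightOp_comm p⁻¹ i (i + 1), ← mul_assoc,
        weightOp_comm p⁻¹ i (i + 1), mul_assoc, ← map_smul, ← h, map_add]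
    · intro i
      have h := ih.high i
      simp only [hk _ _ _ _]
      rw [weightOp_comm p⁻¹ (i + 1) i, mul_assoc (weightOp p⁻¹ i),
        mul_assoc (weightOp p⁻¹ (i + 1)), weightOp_comm p⁻¹ (i + 1) i, ← mul_assoc,
        weightOp_comm p⁻¹ (i + 1) i, mul_assoc, ← map_smul, ← h, map_add]
    · intro i
      rw [comm, if_pos rfl]; rfl
    · intro i
      rw [comm, if_neg (by omega), if_pos (by omega), zpow_neg_one]
    · intro i
      rw [comm, if_neg (by omega), if_pos (by omega), zpow_neg_one]
    · intro i j h
      rw [comm, if_neg (by omega), if_neg (by omega), zpow_zero, one_smul]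
    · intro i j h
      rw [comm, if_neg (by omega), if_neg (by omega), zpow_zero, one_smul]

theorem q_ne_zero : q ≠ 0 := RatFunc.X_ne_zero

theorem one_add_q_inv_sq_ne_zero : 1 + q⁻¹ ^ 2 ≠ 0 := by
  intro h
  have h₁ : q ^ 2 + 1 = 0 := by
    have := congrArg (q ^ 2 * ·) h
    simpa [mul_add, ← mul_pow, q_ne_zero] using this
  have h₂ : algebraMap (Polynomial ℂ) K (Polynomial.X ^ 2 + 1) = 0 := by
    rw [← h₁]; simp [q, RatFunc.algebraMap_X]
  rw [map_eq_zero_iff _ (RatFunc.algebraMap_injective ℂ)] at h₂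
  have := congrArg (Polynomial.eval 0) h₂
  simp at this

/-- The barred quasi `R`-matrix on tensors with `n + 1` factors. -/
def Theta (N n : ℕ) : LOp N := quasiR tensOp q⁻¹ fun i => Fop N q i n

/-- The linear part of the bar involution on tensors with `n` factors. -/
def Psi (N : ℕ) : ℕ → LOp N
  | 0 => 1
  | n + 1 => Theta N n * tensOp 1 (Psi N n)

/-- This expresses that `ψ` commutes with `E_{-i}`: `Psi` is only the linear part of an antilinear
map, so the lowering operator to its right carries the barred parameter. The quasi R-matrix handles
the leftmost factor and induction the others. -/
theorem Psi_Fop (i n : ℕ) : Psi N n * Fop N q⁻¹ i n = Fop N q i n * Psi N n := by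
  by_cases hi : i + 1 < N
  · induction n with
    | zero => simp [Fop]
    | succ n ih =>
      have hk := tensOp_mul (N := N)
      have h := quasiR_intertwines tensOp_mul (inv_ne_zero q_ne_zero)
        one_add_q_inv_sq_ne_zero (serre_Fop q_ne_zero n).symm
        (l := (⟨i, by omega⟩ : Fin N)) (l' := ⟨i + 1, hi⟩) rfl
      rw [← F_one_eq rfl] at h
      simp only [inv_inv] at h
      change Theta N n * _ = _ * Theta N n at h
      rw [Psi, Fop, Fop, ← mul_assoc, ← h, mul_assoc, mul_assoc]
      congr 1
      simp only [mul_add, add_mul, hk _ _ _ _, one_mul, mul_one, ih, inv_inv]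
  · simp [Fop_eq_zero hi]

end ListSpace
end SLWeb

namespace SLWeb
open Finset

set_option linter.unusedSimpArgs false
set_option linter.flexible false

/-! ### Maps that commute with the lowering operators and with the bar involution -/

noncomputable section Equivariance

variable {N : ℕ}

theorem prod_flatMap_mul {B : Type*} [Monoid B] {a b : ℕ → ℕ → B} {g : B}
    (h : ∀ i d, a i d * g = g * b i d) (l : List ℕ) (l' : ℕ → List ℕ) :
    (l.flatMap fun i => (l' i).map (a i)).prod * g =
      g * (l.flatMap fun i => (l' i).map (b i)).prod := by
  have inner : ∀ i (m : List ℕ), (m.map (a i)).prod * g = g * (m.map (b i)).prod := by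
    intro i m
    induction m with
    | nil => simp
    | cons d m ih => simp only [List.map_cons, List.prod_cons]; rw [mul_assoc, ih, ← mul_assoc, h,
        mul_assoc]
  induction l with
  | nil => simp
  | cons i l ih =>
    simp only [List.flatMap_cons, List.prod_append]
    rw [mul_assoc, ih, ← mul_assoc, inner, mul_assoc]

theorem prod_flatMap_one {B : Type*} [Monoid B] (l : List ℕ) (l' : ℕ → List ℕ) :
    (l.flatMap fun i => (l' i).map fun _ => (1 : B)).prod = 1 := by
  apply List.prod_eq_one
  simp

theorem rootE_comm (p : K) {J : Op N} (h : ∀ i, J * E₁ N i = E₁ N i * J) (i d : ℕ) :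
    J * rootE p (E₁ N) i d = rootE p (E₁ N) i d * J := by
  induction d with
  | zero => exact h i
  | succ d ih =>
    simp only [rootE, mul_sub, sub_mul, mul_smul_comm, smul_mul_assoc]
    rw [← mul_assoc, ih, mul_assoc, h, mul_assoc, ← mul_assoc J, h, mul_assoc, ih, mul_assoc]

theorem rootE_col (p : K) {S : Finset (Fin N)} (h : ∀ i T, E₁ N i T S = 0) (i d : ℕ) (T) :
    rootE p (E₁ N) i d T S = 0 := by
  induction d generalizing T with
  | zero => exact h i T
  | succ d ih => simp [rootE, Matrix.mul_apply, h, ih]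

theorem rootE_row (p : K) {S : Finset (Fin N)} (h : ∀ i T, E₁ N i S T = 0) (i d : ℕ) (T) :
    rootE p (E₁ N) i d S T = 0 := by
  induction d generalizing T with
  | zero => exact h i T
  | succ d ih => simp [rootE, Matrix.mul_apply, h, ih]

/-- `S` is closed under going to smaller elements. -/
def DownClosed (S : Finset (Fin N)) : Prop :=
  ∀ l l' : Fin N, l'.val = l.val + 1 → l' ∈ S → l ∈ S

/-- `S` is closed under going to larger elements. -/
def UpClosed (S : Finset (Fin N)) : Prop :=
  ∀ l l' : Fin N, l'.val = l.val + 1 → l ∈ S → l' ∈ S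

theorem E_one_cases (i : ℕ) :
    E₁ N i = 0 ∨ ∃ l l' : Fin N, l'.val = l.val + 1 ∧ i = l ∧ E₁ N i = moveOp l' l := by
  by_cases h : i + 1 < N
  · exact Or.inr ⟨⟨i, by omega⟩, ⟨i + 1, h⟩, rfl, rfl,
      E_one_eq (l := ⟨i, by omega⟩) (l' := ⟨i + 1, h⟩) rfl⟩
  · exact Or.inl (dif_neg h)

theorem F_one_cases (i : ℕ) :
    (∀ p n, F₁ N i = 0 ∧ Fop N p i n = 0) ∨
      ∃ l l' : Fin N, l'.val = l.val + 1 ∧ i = l ∧ F₁ N i = moveOp l l' := by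
  by_cases h : i + 1 < N
  · exact Or.inr ⟨⟨i, by omega⟩, ⟨i + 1, h⟩, rfl, rfl,
      F_one_eq (l := ⟨i, by omega⟩) (l' := ⟨i + 1, h⟩) rfl⟩
  · exact Or.inl fun p n => ⟨F_one_eq_zero h, Fop_eq_zero h n⟩

/-- An initial segment gives a highest weight vector. The raising operators kill it, so each factor
of `Theta` acts as the identity. -/
theorem Theta_consOp {S : Finset (Fin N)} (hS : DownClosed S) (n : ℕ) :
    Theta N n * consOp S = consOp S := by
  have hE : ∀ i T, E₁ N i T S = 0 := by
    intro i T
    rcases E_one_cases (N := N) i with h | ⟨l, l', hl, -, h⟩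
    · simp [h]
    · simp only [h, moveOp, Matrix.of_apply]
      rw [if_neg]
      exact fun c => c.2.1 (hS l l' hl c.1)
  have := prod_flatMap_mul (B := LOp N) (g := consOp S) (b := fun _ _ => 1)
    (a := fun i d => 1 + (q⁻¹ - q⁻¹⁻¹) • tensOp (rootE q⁻¹ (E₁ N) i d)
      (rootVec q⁻¹ (fun i => Fop N q i n) i d))
    (fun i d => by
      rw [add_mul, smul_mul_assoc, tensOp_consOp]
      simp [rootE_col _ hE]) (List.range (N - 1)) (fun i => List.range (N - 1 - i))
  rw [prod_flatMap_one, mul_one] at this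
  exact this

/-- Dually, a final segment gives a lowest weight vector, which no raising operator produces. -/
theorem headOp_Theta {S : Finset (Fin N)} (hS : UpClosed S) (n : ℕ) :
    headOp S * Theta N n = headOp S := by
  have hE : ∀ i T, E₁ N i S T = 0 := by
    intro i T
    rcases E_one_cases (N := N) i with h | ⟨l, l', hl, -, h⟩
    · simp [h]
    · simp only [h, moveOp, Matrix.of_apply]
      rw [if_neg]
      rintro ⟨h₁, h₂, rfl⟩
      have := hS l l' hl (by simp)
      simp at this
      exact h₂ (this ▸ h₁)
  have := prod_flatMap_mul (B := LOp N) (g := headOp S) (a := fun _ _ => 1)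
    (b := fun i d => 1 + (q⁻¹ - q⁻¹⁻¹) • tensOp (rootE q⁻¹ (E₁ N) i d)
      (rootVec q⁻¹ (fun i => Fop N q i n) i d))
    (fun i d => by
      rw [mul_add, mul_smul_comm, headOp_tensOp]
      simp [rootE_row _ hE]) (List.range (N - 1)) (fun i => List.range (N - 1 - i))
  rw [prod_flatMap_one, one_mul] at this
  exact this.symm

/-- The left leg of `Theta` contains only raising operators and the right leg only lowering ones, so
commuting with these suffices, here and in `Theta_tensOp_right`. -/
theorem Theta_tensOp_left {J : Op N} (h : ∀ i, J * E₁ N i = E₁ N i * J) (n : ℕ) :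
    Theta N n * tensOp J 1 = tensOp J 1 * Theta N n := by
  refine prod_flatMap_mul (fun i d => ?_) _ _
  rw [add_mul, mul_add, smul_mul_assoc, mul_smul_comm, tensOp_mul, tensOp_mul, rootE_comm _ h,
    one_mul, mul_one, one_mul, mul_one]

theorem rootVec_intertwine {p : K} {f f' : ℕ → LOp N} {g : LOp N} (h : ∀ i, f i * g = g * f' i)
    (i d : ℕ) : rootVec p f i d * g = g * rootVec p f' i d := by
  induction d with
  | zero => exact h i
  | succ d ih =>
    simp only [rootVec, mul_sub, sub_mul, mul_smul_comm, smul_mul_assoc]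
    rw [mul_assoc, ih, ← mul_assoc, h, mul_assoc, mul_assoc, h, ← mul_assoc _ g, ih, mul_assoc]

theorem Theta_tensOp_right {g : LOp N} {m n : ℕ} (h : ∀ i, Fop N q i m * g = g * Fop N q i n) :
    Theta N m * tensOp 1 g = tensOp 1 g * Theta N n := by
  refine prod_flatMap_mul (fun i d => ?_) _ _
  rw [add_mul, mul_add, smul_mul_assoc, mul_smul_comm, tensOp_mul, tensOp_mul,
    rootVec_intertwine h]
  simp only [one_mul, mul_one]

/-- `g`, with bar conjugate `g'`, takes tensors with `s` factors to tensors with `t` factors by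
acting on the leftmost factors, and commutes with the lowering operators and with the bar
involution. -/
structure Equivariant (g g' : LOp N) (s t : ℕ) : Prop where
  lower : ∀ n i, Fop N q i (n + t) * g = g * Fop N q i (n + s)
  bar : ∀ n, Psi N (n + t) * g' = g * Psi N (n + s)

theorem Equivariant.one (s : ℕ) : Equivariant (1 : LOp N) 1 s s :=
  ⟨fun _ _ => by simp, fun _ => by simp⟩

theorem Equivariant.smul {g g' : LOp N} {s t : ℕ} (h : Equivariant g g' s t) (c : K) :
    Equivariant (c • g) (c • g') s t :=
  ⟨fun n i => by simp [h.lower], fun n => by simp [h.bar]⟩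

theorem Equivariant.mul {g g' h h' : LOp N} {r s t : ℕ} (hh : Equivariant h h' s t)
    (hg : Equivariant g g' r s) : Equivariant (h * g) (h' * g') r t :=
  ⟨fun n i => by rw [← mul_assoc, hh.lower, mul_assoc, hg.lower, mul_assoc],
    fun n => by rw [← mul_assoc, hh.bar, mul_assoc, hg.bar, mul_assoc]⟩

theorem Equivariant.shift {g g' : LOp N} {s t : ℕ} (h : Equivariant g g' s t) (c : ℕ) :
    Equivariant g g' (c + s) (c + t) :=
  ⟨fun n i => by simpa only [add_assoc] using h.lower (n + c) i,
    fun n => by simpa only [add_assoc] using h.bar (n + c)⟩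

/-- The condition `lower` is what carries the condition `bar` past one more factor on the left,
since it moves `g` through `Theta`. -/
theorem Equivariant.lift {g g' : LOp N} {s t : ℕ} (h : Equivariant g g' s t) :
    Equivariant (tensOp 1 g) (tensOp 1 g') (s + 1) (t + 1) where
  lower n i := by
    change Fop N q i (n + t + 1) * _ = _ * Fop N q i (n + s + 1)
    simp only [Fop, add_mul, mul_add, tensOp_mul _ _ _ _, h.lower, one_mul, mul_one]
  bar n := by
    change Psi N (n + t + 1) * _ = _ * Psi N (n + s + 1)
    rw [Psi, Psi, mul_assoc, tensOp_mul, h.bar, ← mul_assoc, ← Theta_tensOp_right (h.lower n),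
      mul_assoc, tensOp_mul]

/-- Merging the two leftmost factors. -/
def mergeOp (N : ℕ) (w : K) : LOp N where
  toFun φ y := match y with
    | [] => 0
    | U :: z => ∑ S, ∑ T, (if Disjoint S T ∧ S ∪ T = U then w ^ ell T S else 0) * φ (S :: T :: z)
  map_add' φ χ := by
    ext y; cases y
    · simp
    · simp [mul_add, sum_add_distrib]
  map_smul' c φ := by
    ext y; cases y
    · simp
    · simp only [Pi.smul_apply, smul_eq_mul, RingHom.id_apply, mul_sum, mul_left_comm]

/-- Splitting the leftmost factor. -/
def splitOp (N : ℕ) (w : K) : LOp N where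
  toFun φ y := match y with
    | T :: U :: z => if Disjoint T U then w ^ (-ell T U) * φ ((T ∪ U) :: z) else 0
    | _ => 0
  map_add' φ χ := by
    ext y
    rcases y with _ | ⟨T, _ | ⟨U, z⟩⟩ <;> simp
    split_ifs <;> simp [mul_add]
  map_smul' c φ := by
    ext y
    rcases y with _ | ⟨T, _ | ⟨U, z⟩⟩ <;> simp [mul_left_comm]

@[simp] theorem mergeOp_nil (w : K) (φ : LS N) : mergeOp N w φ [] = 0 := rfl
@[simp] theorem mergeOp_cons (w : K) (φ : LS N) (U z) : mergeOp N w φ (U :: z) =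
    ∑ S, ∑ T, (if Disjoint S T ∧ S ∪ T = U then w ^ ell T S else 0) * φ (S :: T :: z) := rfl
@[simp] theorem splitOp_nil (w : K) (φ : LS N) : splitOp N w φ [] = 0 := rfl
@[simp] theorem splitOp_singleton (w : K) (φ : LS N) (T) : splitOp N w φ [T] = 0 := rfl
@[simp] theorem splitOp_cons (w : K) (φ : LS N) (T U z) : splitOp N w φ (T :: U :: z) =
    if Disjoint T U then w ^ (-ell T U) * φ ((T ∪ U) :: z) else 0 := rfl

/-- The projection to `Λ_q^a` in the leftmost factor. -/
def gradeOp (N a : ℕ) : Op N := Matrix.diagonal fun S => if S.card = a then 1 else 0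

theorem tensOp_diagonal_apply (c : Finset (Fin N) → K) (X : LOp N) (φ : LS N) (S z) :
    tensOp (Matrix.diagonal c) X φ (S :: z) = c S * X (headOp S φ) z := by
  simp [Matrix.diagonal_apply]

theorem gradeOp_comm_move (a : ℕ) (l l' : Fin N) :
    gradeOp N a * moveOp l l' = moveOp l l' * gradeOp N a := by
  ext S T
  simp only [gradeOp, Matrix.diagonal_mul, Matrix.mul_diagonal, moveOp, Matrix.of_apply]
  by_cases h : l ∈ T ∧ l' ∉ T ∧ S = insert l' (T.erase l)
  · have : S.card = T.card := by
      rw [h.2.2, card_insert_of_notMem (by simp [h.2.1]), card_erase_of_mem h.1]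
      have := card_pos.mpr ⟨l, h.1⟩
      omega
    rw [if_pos h, this, mul_one, one_mul]
  · simp [h]

theorem gradeOp_equivariant (a : ℕ) :
    Equivariant (tensOp (gradeOp N a) 1) (tensOp (gradeOp N a) 1) 1 1 where
  lower n i := by
    have h₁ : gradeOp N a * F₁ N i = F₁ N i * gradeOp N a := by
      rcases F_one_cases (N := N) i with h | ⟨l, l', hl, -, h⟩
      · simp [(h 0 0).1]
      · rw [h, gradeOp_comm_move]
    have h₂ : gradeOp N a * weightOp q⁻¹ i = weightOp q⁻¹ i * gradeOp N a := by
      simp [gradeOp, weightOp, Matrix.diagonal_mul_diagonal]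
    simp only [Fop, add_mul, mul_add, tensOp_mul _ _ _ _, h₁, h₂, one_mul, mul_one]
  bar n := by
    rw [Psi, mul_assoc, tensOp_mul, ← mul_assoc, ← Theta_tensOp_left, mul_assoc, tensOp_mul]
    · simp
    · intro i
      rcases E_one_cases (N := N) i with h | ⟨l, l', hl, -, h⟩
      · simp [h]
      · rw [h, gradeOp_comm_move]

theorem weight_univ {l l' : Fin N} (hl : l'.val = l.val + 1) :
    weight l (univ : Finset (Fin N)) = 0 := by
  rw [weight_eq hl]; simp

/-- `x_univ` spans a trivial representation: it has weight `0`, and no move starts from it. -/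
theorem consOp_univ_equivariant : Equivariant (consOp (univ : Finset (Fin N))) (consOp univ) 0 1
    where
  lower n i := by
    rcases F_one_cases (N := N) i with h | ⟨l, l', hl, rfl, h⟩
    · simp [(h _ _).2]
    · simp only [Fop, add_mul, add_zero, tensOp_consOp]
      rw [sum_eq_zero, sum_eq_single univ]
      · simp [weightOp, weight_univ hl]
      · intro T _ hT
        simp [weightOp, hT]
      · simp
      · intro T _
        simp [h, moveOp]
  bar n := by
    have : DownClosed (univ : Finset (Fin N)) := fun _ _ _ _ => mem_univ _
    rw [Psi, mul_assoc, tensOp_consOp, sum_eq_single univ]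
    · rw [Matrix.one_apply_eq, one_smul, ← mul_assoc, Theta_consOp this]; rfl
    · intro T _ hT
      rw [Matrix.one_apply_ne hT, zero_smul]
    · simp

theorem headOp_univ_equivariant : Equivariant (headOp (univ : Finset (Fin N))) (headOp univ) 1 0
    where
  lower n i := by
    rcases F_one_cases (N := N) i with h | ⟨l, l', hl, rfl, h⟩
    · simp [(h _ _).2]
    · simp only [Fop, mul_add, add_zero, headOp_tensOp]
      rw [sum_eq_zero, sum_eq_single univ]
      · simp [weightOp, weight_univ hl]
      · intro T _ hT
        simp [weightOp, hT.symm]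
      · simp
      · intro T _
        have : ¬ (l ∈ T ∧ l' ∉ T ∧ univ = insert l' (T.erase l)) := by
          rintro ⟨-, -, h⟩
          have : l ∈ insert l' (T.erase l) := h ▸ mem_univ _
          simp at this
          omega
        simp only [h, moveOp, Matrix.of_apply, if_neg this, zero_smul]
  bar n := by
    have : UpClosed (univ : Finset (Fin N)) := fun _ _ _ _ => mem_univ _
    rw [Psi, ← mul_assoc, headOp_Theta this, headOp_tensOp, sum_eq_single univ]
    · rw [Matrix.one_apply_eq, one_smul]; rfl
    · intro T _ hT
      rw [Matrix.one_apply_ne hT.symm, zero_smul]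
    · simp

end Equivariance
end SLWeb

namespace SLWeb
open Finset

set_option linter.unusedSimpArgs false
set_option linter.flexible false

/-! ### Merge and split commute with the lowering operators -/

noncomputable section MergeSplit

variable {N : ℕ}

theorem ell_eq_sum (S T : Finset (Fin N)) :
    ell S T = ∑ s ∈ S, ∑ t ∈ T, if s < t then 1 else 0 := by
  rw [ell, card_filter, sum_product]
  push_cast
  rfl

theorem ell_mv_left {l l' : Fin N} (hl : l'.val = l.val + 1) {S : Finset (Fin N)} (h : l ∈ S)
    (h' : l' ∉ S) (T : Finset (Fin N)) :
    ell (mv l l' S) T = ell S T - if l' ∈ T then 1 else 0 := by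
  have key : ∀ t : Fin N, ((if l < t then 1 else 0 : ℤ)) =
      (if l' < t then 1 else 0) + if t = l' then 1 else 0 := by
    intro t
    simp only [Fin.lt_def, Fin.ext_iff]
    split_ifs <;> omega
  rw [ell_eq_sum, ell_eq_sum, mv, sum_insert (by simp [h']), ← add_sum_erase S _ h]
  simp only [key, sum_add_distrib, sum_ite_eq']
  ring

theorem ell_mv_right {l l' : Fin N} (hl : l'.val = l.val + 1) {S : Finset (Fin N)} (h : l ∈ S)
    (h' : l' ∉ S) (T : Finset (Fin N)) :
    ell T (mv l l' S) = ell T S + if l ∈ T then 1 else 0 := by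
  have key : ∀ t : Fin N, ((if t < l' then 1 else 0 : ℤ)) =
      (if t < l then 1 else 0) + if t = l then 1 else 0 := by
    intro t
    simp only [Fin.lt_def, Fin.ext_iff]
    split_ifs <;> omega
  rw [ell_eq_sum, ell_eq_sum, sum_comm, sum_comm (s := T), mv, sum_insert (by simp [h']),
    ← add_sum_erase S _ h]
  simp only [key, sum_add_distrib, sum_ite_eq']
  ring

theorem mv_mv {a b : Fin N} {S : Finset (Fin N)} (ha : a ∈ S) (hb : b ∉ S) :
    mv b a (mv a b S) = S := by
  have hab : a ≠ b := fun h => hb (h ▸ ha)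
  ext t; simp only [mem_mv]; grind

theorem sum_moveOp_row (a b : Fin N) (T : Finset (Fin N)) (g : Finset (Fin N) → K) :
    ∑ T', moveOp a b T T' * g T' = if b ∈ T ∧ a ∉ T then g (mv b a T) else 0 := by
  by_cases hab : a = b
  · subst hab
    rw [if_neg (by tauto)]
    refine sum_eq_zero fun T' _ => ?_
    simp only [moveOp, Matrix.of_apply]
    rw [if_neg (by tauto), zero_mul]
  split_ifs with h
  · rw [sum_eq_single (mv b a T)]
    · have h₁ : mv a b (mv b a T) = T := mv_mv h.1 h.2
      have h₂ : a ∈ mv b a T := by simp [mem_mv]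
      have h₃ : b ∉ mv b a T := by simp [mem_mv, Ne.symm hab]
      simp only [moveOp, Matrix.of_apply]
      rw [if_pos ⟨h₂, h₃, h₁.symm⟩, one_mul]
    · intro T' _ hT'
      simp only [moveOp, Matrix.of_apply]
      rw [if_neg, zero_mul]
      rintro ⟨h₁, h₂, h₃⟩
      exact hT' (by rw [h₃]; exact (mv_mv h₁ h₂).symm)
    · simp
  · refine sum_eq_zero fun T' _ => ?_
    simp only [moveOp, Matrix.of_apply]
    rw [if_neg, zero_mul]
    rintro ⟨h₁, h₂, rfl⟩
    exact h ⟨by simp, by simp [hab]⟩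

theorem sum_moveOp_col (a b : Fin N) (T : Finset (Fin N)) (g : Finset (Fin N) → K) :
    ∑ T', g T' * moveOp a b T' T = if a ∈ T ∧ b ∉ T then g (mv a b T) else 0 := by
  split_ifs with h
  · rw [sum_eq_single (mv a b T)]
    · simp [moveOp, h, mv]
    · intro T' _ hT'
      simp only [moveOp, Matrix.of_apply]
      rw [if_neg, mul_zero]
      exact fun c => hT' c.2.2
    · simp
  · refine sum_eq_zero fun T' _ => ?_
    simp only [moveOp, Matrix.of_apply]
    rw [if_neg (by tauto), mul_zero]

theorem weight_union {l l' : Fin N} (hl : l'.val = l.val + 1) {T U : Finset (Fin N)}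
    (h : Disjoint T U) : weight l (T ∪ U) = weight l T + weight l U := by
  have h₁ : l ∈ T → l ∉ U := fun a => disjoint_left.mp h a
  have h₂ : l' ∈ T → l' ∉ U := fun a => disjoint_left.mp h a
  rw [weight_eq hl, weight_eq hl, weight_eq hl]
  by_cases a : l ∈ T <;> by_cases b : l' ∈ T <;> by_cases c : l ∈ U <;> by_cases d : l' ∈ U <;>
    simp_all

theorem Fop_apply_cons {p : K} {l l' : Fin N} (hl : l'.val = l.val + 1) (n : ℕ) (φ : LS N) (T z) :
    Fop N p l (n + 1) φ (T :: z) = (if l' ∈ T ∧ l ∉ T then φ (mv l' l T :: z) else 0) +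
      p⁻¹ ^ weight l T * Fop N p l n (headOp T φ) z := by
  rw [Fop, LinearMap.add_apply, Pi.add_apply, tensOp_cons, weightOp, tensOp_diagonal_apply,
    F_one_eq hl]
  simp only [Module.End.one_apply, headOp_apply]
  rw [sum_moveOp_row l l' T fun T => φ (T :: z)]

/-- The coefficient identity behind `splitOp_lower`. When `l'` lies in both `T` and `U`, and `l` in
neither, the right side is zero and the terms on the left must cancel; this forces the sign in the
base `-p⁻¹`, hence in `v = -q⁻¹`. -/
theorem split_row {p : K} (hp : p ≠ 0) {l l' : Fin N} (hl : l'.val = l.val + 1)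
    (T U : Finset (Fin N)) (g : Finset (Fin N) → K) :
    (if l' ∈ T ∧ l ∉ T then if Disjoint (mv l' l T) U then
        (-p⁻¹) ^ (-ell (mv l' l T) U) * g (mv l' l T ∪ U) else 0 else 0) +
      p⁻¹ ^ weight l T * (if l' ∈ U ∧ l ∉ U then if Disjoint T (mv l' l U) then
        (-p⁻¹) ^ (-ell T (mv l' l U)) * g (T ∪ mv l' l U) else 0 else 0) =
    if Disjoint T U then (-p⁻¹) ^ (-ell T U) *
      (if l' ∈ T ∪ U ∧ l ∉ T ∪ U then g (mv l' l (T ∪ U)) else 0) else 0 := by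
  have hll : l ≠ l' := fun h => by simp [h] at hl
  have hw : -p⁻¹ ≠ 0 := by simpa
  by_cases hT : l' ∈ T ∧ l ∉ T
  · have eT : ell T U = ell (mv l' l T) U - if l' ∈ U then 1 else 0 := by
      rw [← ell_mv_left hl (by simp [mem_mv]) (by simp [mem_mv, hll.symm]), mv_mv hT.1 hT.2]
    by_cases h₁ : l ∈ U
    · have : ¬ Disjoint (mv l' l T) U := fun h => disjoint_left.mp h (by simp [mem_mv]) h₁
      simp [hT, h₁, this]
    by_cases h₂ : l' ∈ U
    · have h₃ : ¬ Disjoint T U := fun h => disjoint_left.mp h hT.1 h₂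
      have h₄ : Disjoint T (mv l' l U) ↔ Disjoint (mv l' l T) U := by
        simp only [disjoint_left, mem_mv]; grind
      have h₅ : T ∪ mv l' l U = mv l' l T ∪ U := by
        ext t; simp only [mem_union, mem_mv]; grind
      have eU : ell T U = ell T (mv l' l U) := by
        have := ell_mv_right hl (S := mv l' l U) (by simp [mem_mv]) (by simp [mem_mv, hll.symm]) T
        rw [mv_mv h₂ h₁] at this
        simpa [hT.2] using this
      have e : ell (mv l' l T) U = ell T U + 1 := by rw [eT]; simp [h₂]
      rw [weight_eq hl]
      simp only [hT, h₁, h₂, h₃, h₄, h₅, ← eU, e, not_false_eq_true, and_self, if_true, if_false]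
      split_ifs
      · have hi : (-p⁻¹)⁻¹ = -p := by rw [neg_inv, inv_inv]
        rw [neg_add, zpow_add₀ hw, zpow_neg_one, hi]
        simp
        ring
      · simp
    · have h₃ : Disjoint (mv l' l T) U ↔ Disjoint T U := by
        simp only [disjoint_left, mem_mv]; grind
      have h₅ : mv l' l T ∪ U = mv l' l (T ∪ U) := by
        ext t; simp only [mem_union, mem_mv]; grind
      simp only [h₂, if_false, sub_zero] at eT
      simp [hT, h₁, h₂, h₃, h₅, ← eT]
  · by_cases hU : l' ∈ U ∧ l ∉ U
    · by_cases h₁ : l ∈ T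
      · have : ¬ Disjoint T (mv l' l U) := fun h => disjoint_left.mp h h₁ (by simp [mem_mv])
        simp [hU, h₁, this]
      · have h₂ : l' ∉ T := by tauto
        have h₃ : Disjoint T (mv l' l U) ↔ Disjoint T U := by
          simp only [disjoint_left, mem_mv]; grind
        have h₅ : T ∪ mv l' l U = mv l' l (T ∪ U) := by
          ext t; simp only [mem_union, mem_mv]; grind
        have eU : ell T U = ell T (mv l' l U) := by
          have := ell_mv_right hl (S := mv l' l U) (by simp [mem_mv]) (by simp [mem_mv, hll.symm]) T
          rw [mv_mv hU.1 hU.2] at this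
          simpa [h₁] using this
        rw [weight_eq hl]
        simp [hU, h₁, h₂, h₃, h₅, ← eU]
    · have : ¬ (l' ∈ T ∪ U ∧ l ∉ T ∪ U) := by simp only [mem_union]; tauto
      rw [if_neg hT, if_neg hU, if_neg this]
      simp

/-- The counterpart of `split_row` for the merge; the cancelling case is `l` in both `S` and `T`,
with `l'` in neither. -/
theorem merge_col {p : K} (hp : p ≠ 0) {l l' : Fin N} (hl : l'.val = l.val + 1)
    (S T U : Finset (Fin N)) :
    (if l ∈ S ∧ l' ∉ S then if Disjoint (mv l l' S) T ∧ mv l l' S ∪ T = U then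
        (-p⁻¹) ^ ell T (mv l l' S) else 0 else 0) +
      p⁻¹ ^ weight l S * (if l ∈ T ∧ l' ∉ T then if Disjoint S (mv l l' T) ∧ S ∪ mv l l' T = U then
        (-p⁻¹) ^ ell (mv l l' T) S else 0 else 0) =
    (if Disjoint S T then (-p⁻¹) ^ ell T S else 0) * moveOp l l' U (S ∪ T) := by
  have hll : l ≠ l' := fun h => by simp [h] at hl
  have hw : -p⁻¹ ≠ 0 := by simpa
  have hM : moveOp l l' U (S ∪ T) =
      if (l ∈ S ∪ T ∧ l' ∉ S ∪ T) ∧ mv l l' (S ∪ T) = U then (1 : K) else 0 := by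
    simp only [moveOp, Matrix.of_apply, and_assoc, mv, eq_comm]
  rw [hM]
  by_cases hS : l ∈ S ∧ l' ∉ S
  · have eS := ell_mv_right hl hS.1 hS.2 T
    by_cases h₁ : l' ∈ T
    · have : ¬ Disjoint (mv l l' S) T := fun h => disjoint_left.mp h (by simp [mem_mv]) h₁
      simp [hS, h₁, this]
    by_cases h₂ : l ∈ T
    · have h₃ : ¬ Disjoint S T := fun h => disjoint_left.mp h hS.1 h₂
      have h₄ : Disjoint S (mv l l' T) ↔ Disjoint (mv l l' S) T := by
        simp only [disjoint_left, mem_mv]; grind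
      have h₅ : S ∪ mv l l' T = mv l l' S ∪ T := by
        ext t; simp only [mem_union, mem_mv]; grind
      have eT := ell_mv_left hl h₂ h₁ S
      rw [weight_eq hl]
      simp only [hS, if_false, sub_zero] at eT
      simp only [hS, h₁, h₂, h₃, h₄, h₅, eT, eS, not_false_eq_true, and_self, if_true, if_false,
        zero_mul]
      split_ifs
      · rw [zpow_add₀ hw]
        simp
        ring
      · simp
    · have h₃ : Disjoint (mv l l' S) T ↔ Disjoint S T := by
        simp only [disjoint_left, mem_mv]; grind
      have h₅ : mv l l' S ∪ T = mv l l' (S ∪ T) := by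
        ext t; simp only [mem_union, mem_mv]; grind
      simp only [h₂, if_false, add_zero] at eS
      simp [hS, h₁, h₂, h₃, h₅, eS, ite_and]
      split_ifs <;> rfl
  · by_cases hT : l ∈ T ∧ l' ∉ T
    · by_cases h₁ : l' ∈ S
      · have : ¬ Disjoint S (mv l l' T) := fun h => disjoint_left.mp h h₁ (by simp [mem_mv])
        simp [hT, h₁, this]
      · have h₂ : l ∉ S := by tauto
        have h₃ : Disjoint S (mv l l' T) ↔ Disjoint S T := by
          simp only [disjoint_left, mem_mv]; grind
        have h₅ : S ∪ mv l l' T = mv l l' (S ∪ T) := by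
          ext t; simp only [mem_union, mem_mv]; grind
        have eT := ell_mv_left hl hT.1 hT.2 S
        simp only [h₁, if_false, sub_zero] at eT
        rw [weight_eq hl]
        simp [hT, h₁, h₂, h₃, h₅, eT, ite_and]
        split_ifs <;> rfl
    · have : ¬ (l ∈ S ∪ T ∧ l' ∉ S ∪ T) := by simp only [mem_union]; tauto
      have h₆ : ¬ ((l ∈ S ∪ T ∧ l' ∉ S ∪ T) ∧ mv l l' (S ∪ T) = U) := fun c => this c.1
      rw [if_neg hS, if_neg hT, if_neg h₆]
      simp

theorem splitOp_lower {p : K} (hp : p ≠ 0) (i n : ℕ) :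
    Fop N p i (n + 2) * splitOp N (-p⁻¹) = splitOp N (-p⁻¹) * Fop N p i (n + 1) := by
  rcases F_one_cases (N := N) i with h | ⟨l, l', hl, rfl, -⟩
  · rw [(h _ _).2, (h _ _).2]; simp
  refine LinearMap.ext fun φ => funext fun y => ?_
  have hnil : ∀ m (χ : LS N), Fop N p l m χ [] = 0 := by
    intro m χ; cases m <;> simp [Fop]
  rcases y with _ | ⟨T, _ | ⟨U, z⟩⟩
  · simp [hnil]
  · rw [Module.End.mul_apply, Fop_apply_cons hl, hnil]
    simp
  · have hh : headOp U (headOp T (splitOp N (-p⁻¹) φ)) =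
        (if Disjoint T U then (-p⁻¹) ^ (-ell T U) else 0) • headOp (T ∪ U) φ := by
      ext z; simp
    rw [Module.End.mul_apply, Module.End.mul_apply, Fop_apply_cons hl, Fop_apply_cons hl,
      splitOp_cons, splitOp_cons, hh, map_smul, headOp_apply, splitOp_cons, Fop_apply_cons hl,
      mul_add, ← add_assoc, split_row hp hl T U fun V => φ (V :: z)]
    split_ifs with h₁ <;>
      simp [weight_union hl, h₁, zpow_add₀ hp] <;> ring

theorem mergeOp_lower {p : K} (hp : p ≠ 0) (i n : ℕ) :
    Fop N p i (n + 1) * mergeOp N (-p⁻¹) = mergeOp N (-p⁻¹) * Fop N p i (n + 2) := by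
  rcases F_one_cases (N := N) i with h | ⟨l, l', hl, rfl, hF⟩
  · rw [(h _ _).2, (h _ _).2]; simp
  refine LinearMap.ext fun φ => funext fun y => ?_
  rcases y with _ | ⟨U, z⟩
  · simp [Fop]
  set M : Finset (Fin N) → Finset (Fin N) → Finset (Fin N) → K := fun U S T =>
    if Disjoint S T ∧ S ∪ T = U then (-p⁻¹) ^ ell T S else 0 with hM
  have hm : ∀ (χ : LS N) (U : Finset (Fin N)) z, mergeOp N (-p⁻¹) χ (U :: z) =
      ∑ S, ∑ T, M U S T * χ (S :: T :: z) := fun _ _ _ => rfl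
  have hF2 : ∀ (m : ℕ) (χ : LS N) (S : Finset (Fin N)) z, Fop N p l (m + 1) χ (S :: z) =
      ∑ S', moveOp l l' S S' * χ (S' :: z) + p⁻¹ ^ weight l S * Fop N p l m (headOp S χ) z := by
    intro m χ S z
    rw [Fop_apply_cons hl, sum_moveOp_row l l' S fun S => χ (S :: z)]
  have hh : headOp U (mergeOp N (-p⁻¹) φ) = ∑ S, ∑ T, M U S T • headOp T (headOp S φ) := by
    ext z
    simp only [headOp_apply, hm, Finset.sum_apply, Pi.smul_apply, smul_eq_mul]
  simp only [Module.End.mul_apply, hm, hF2, hh, map_sum, map_smul, Finset.sum_apply, Pi.smul_apply,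
    smul_eq_mul, headOp_apply, mul_add, sum_add_distrib, mul_sum]
  rw [← add_assoc]
  congr 1
  -- The triple sums are regrouped by `φ (S :: T :: z)`, whose coefficients `merge_col` compares.
  · have e₁ : ∑ U', ∑ S, ∑ T, moveOp l l' U U' * (M U' S T * φ (S :: T :: z)) =
        ∑ S, ∑ T, (∑ U', moveOp l l' U U' * M U' S T) * φ (S :: T :: z) := by
      simp only [sum_mul]
      rw [sum_comm]
      refine sum_congr rfl fun S _ => ?_
      rw [sum_comm]
      simp only [mul_assoc]
    have e₂ : ∑ S, ∑ T, ∑ S', M U S T * (moveOp l l' S S' * φ (S' :: T :: z)) =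
        ∑ S, ∑ T, (∑ S', M U S' T * moveOp l l' S' S) * φ (S :: T :: z) := by
      simp only [sum_mul]
      rw [sum_congr rfl fun S _ => sum_comm, sum_comm]
      refine sum_congr rfl fun S _ => ?_
      rw [sum_comm]
      simp only [mul_assoc]
    have e₃ : ∑ S, ∑ T, ∑ T', M U S T * (p⁻¹ ^ weight l S *
          (moveOp l l' T T' * φ (S :: T' :: z))) =
        ∑ S, ∑ T, (p⁻¹ ^ weight l S * ∑ T', M U S T' * moveOp l l' T' T) * φ (S :: T :: z) := by
      simp only [mul_sum, sum_mul]
      refine sum_congr rfl fun S _ => ?_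
      rw [sum_comm]
      refine sum_congr rfl fun T _ => sum_congr rfl fun T' _ => ?_
      ring
    rw [e₁, e₂, e₃, ← sum_add_distrib]
    refine sum_congr rfl fun S _ => ?_
    rw [← sum_add_distrib]
    refine sum_congr rfl fun T _ => ?_
    rw [← add_mul, sum_moveOp_col l l' S fun S' => M U S' T, sum_moveOp_col l l' T fun T' => M U S T',
      merge_col hp hl]
    congr 1
    simp only [hM]
    rw [sum_eq_single (S ∪ T)]
    · simp [mul_comm]
    · intro U' _ hU'
      rw [if_neg fun c => hU' c.2.symm, mul_zero]
    · simp
  · refine sum_congr rfl fun S _ => sum_congr rfl fun T _ => ?_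
    simp only [hM]
    split_ifs with h
    · rw [← h.2, weight_union hl h.1, zpow_add₀ (inv_ne_zero hp)]
      ring
    · simp

end MergeSplit
end SLWeb

namespace SLWeb
open Finset

set_option linter.unusedSimpArgs false
set_option linter.flexible false

/-! ### Merge and split commute with the bar involution -/

noncomputable section BarMergeSplit

variable {N : ℕ}

/-- Exterior multiplication by `x_S` on the left, up to powers of `v`. -/
def joinOp (S : Finset (Fin N)) : Op N :=
  Matrix.of fun U T => if Disjoint S T ∧ S ∪ T = U then 1 else 0

theorem moveOp_apply' {a b : Fin N} (hab : a ≠ b) (S W : Finset (Fin N)) :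
    moveOp a b S W = if b ∈ S ∧ a ∉ S ∧ W = mv b a S then 1 else 0 := by
  simp only [moveOp, Matrix.of_apply]
  refine if_congr ⟨?_, ?_⟩ rfl rfl
  · rintro ⟨h₁, h₂, rfl⟩
    exact ⟨by simp, by simp [hab], (mv_mv h₁ h₂).symm⟩
  · rintro ⟨h₁, h₂, rfl⟩
    exact ⟨by simp [mem_mv], by simp [mem_mv, hab.symm], (mv_mv h₁ h₂).symm⟩

/-- No raising move takes an element out of an initial segment `S`, and one that moves an element of
`T` into `S` destroys disjointness. So raising acts on `T` alone. -/
theorem joinOp_comm {S : Finset (Fin N)} (hS : DownClosed S) (i : ℕ) :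
    joinOp S * E₁ N i = E₁ N i * joinOp S := by
  rcases E_one_cases (N := N) i with h | ⟨l, l', hl, -, h⟩
  · simp [h]
  have hll : l ≠ l' := fun h => by simp [h] at hl
  have hSl := hS l l' hl
  ext U T
  rw [h, Matrix.mul_apply, Matrix.mul_apply, sum_moveOp_col l' l T fun T' => joinOp S U T']
  have e : ∑ W, moveOp l' l U W * joinOp S W T =
      if Disjoint S T then moveOp l' l U (S ∪ T) else 0 := by
    rw [sum_eq_single (S ∪ T)]
    · simp [joinOp]
    · intro W _ hW
      simp [joinOp, hW.symm]
    · simp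
  rw [e]
  simp only [joinOp, moveOp, Matrix.of_apply]
  rw [← ite_and, ← ite_and]
  refine if_congr ?_ rfl rfl
  constructor
  · rintro ⟨⟨h₁, h₂⟩, h₃, rfl⟩
    rw [disjoint_left] at h₃ ⊢
    simp only [mem_mv] at h₃
    refine ⟨?_, ?_, ?_, ?_⟩
    · grind
    · grind
    · grind
    · ext t; simp only [mem_union, mem_mv, mem_insert, mem_erase]; grind
  · rintro ⟨h₁, h₂, h₃, rfl⟩
    rw [disjoint_left] at h₁ ⊢
    simp only [mem_mv, mem_union] at *
    refine ⟨?_, ?_, ?_⟩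
    · grind
    · grind
    · ext t; simp only [mem_union, mem_mv, mem_insert, mem_erase]; grind

theorem joinOp_transpose_comm {S : Finset (Fin N)} (hS : UpClosed S) (i : ℕ) :
    (joinOp S).transpose * E₁ N i = E₁ N i * (joinOp S).transpose := by
  rcases E_one_cases (N := N) i with h | ⟨l, l', hl, -, h⟩
  · simp [h]
  have hll : l ≠ l' := fun h => by simp [h] at hl
  have hSl := hS l l' hl
  ext U W
  rw [h, Matrix.mul_apply, Matrix.mul_apply,
    sum_moveOp_row l' l U fun V => (joinOp S).transpose V W]
  have e : ∑ V, (joinOp S).transpose U V * moveOp l' l V W =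
      if Disjoint S U then moveOp l' l (S ∪ U) W else 0 := by
    rw [sum_eq_single (S ∪ U)]
    · simp [joinOp]
    · intro W _ hW
      simp [joinOp, hW.symm]
    · simp
  rw [e, moveOp_apply' hll.symm]
  simp only [joinOp, Matrix.of_apply, Matrix.transpose_apply]
  rw [← ite_and, ← ite_and]
  refine if_congr ?_ rfl rfl
  constructor
  · rintro ⟨h₁, h₂, h₃, rfl⟩
    rw [disjoint_left] at h₁ ⊢
    simp only [mem_mv, mem_union] at *
    refine ⟨?_, ?_, ?_⟩
    · grind
    · grind
    · ext t; simp only [mem_union, mem_mv]; grind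
  · rintro ⟨⟨h₁, h₂⟩, h₃, rfl⟩
    rw [disjoint_left] at h₃ ⊢
    simp only [mem_mv] at h₃
    refine ⟨?_, ?_, ?_, ?_⟩
    · grind
    · grind
    · grind
    · ext t; simp only [mem_union, mem_mv]; grind

theorem ell_downClosed {S T : Finset (Fin N)} (hS : DownClosed S) (h : Disjoint S T) :
    ell T S = 0 := by
  have key : ∀ s ∈ S, ∀ d t : ℕ, (ht : t < N) → t + d = s.val → (⟨t, ht⟩ : Fin N) ∈ S := by
    intro s hs d
    induction d with
    | zero => intro t ht h; rwa [show (⟨t, ht⟩ : Fin N) = s from Fin.ext h]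
    | succ d ih =>
      intro t ht h
      have h' : t + 1 < N := by have := s.2; omega
      exact hS ⟨t, ht⟩ ⟨t + 1, h'⟩ rfl (ih (t + 1) h' (by omega))
  rw [ell, filter_false_of_mem]
  · simp
  · rintro ⟨t, s⟩ hts hlt
    rw [mem_product] at hts
    rw [Fin.lt_def] at hlt
    exact disjoint_left.mp h (key s hts.2 (s - t) t t.2 (by simp at hlt ⊢; omega)) hts.1

theorem ell_upClosed {S T : Finset (Fin N)} (hS : UpClosed S) (h : Disjoint S T) :
    ell S T = 0 := by
  have key : ∀ s ∈ S, ∀ d t : ℕ, (ht : t < N) → s.val + d = t → (⟨t, ht⟩ : Fin N) ∈ S := by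
    intro s hs d
    induction d with
    | zero => intro t ht h; rwa [show (⟨t, ht⟩ : Fin N) = s from Fin.ext h.symm]
    | succ d ih =>
      intro t ht h
      exact hS ⟨s.val + d, by omega⟩ ⟨t, ht⟩ h.symm (ih (s.val + d) (by omega) rfl)
  rw [ell, filter_false_of_mem]
  · simp
  · rintro ⟨s, t⟩ hts hlt
    rw [mem_product] at hts
    rw [Fin.lt_def] at hlt
    exact disjoint_left.mp h (key s hts.1 (t - s) t t.2 (by simp at hlt ⊢; omega)) hts.2

/-- Nothing disjoint from an initial segment lies below one of its elements, so no power of `w`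
appears. Hence merges with parameters `v` and `v⁻¹` agree on such factors. -/
theorem mergeOp_consOp (w : K) {S : Finset (Fin N)} (hS : DownClosed S) :
    mergeOp N w * consOp S = tensOp (joinOp S) 1 := by
  refine LinearMap.ext fun φ => funext fun y => ?_
  rcases y with _ | ⟨U, z⟩
  · simp
  · rw [Module.End.mul_apply, mergeOp_cons, tensOp_cons, sum_eq_single S]
    · refine sum_congr rfl fun T _ => ?_
      simp only [consOp_cons, if_true, joinOp, Matrix.of_apply, Module.End.one_apply, headOp_apply]
      congr 1
      split_ifs with h
      · rw [ell_downClosed hS h.1, zpow_zero]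
      · rfl
    · intro S' _ hS'
      refine sum_eq_zero fun T _ => ?_
      simp [hS']
    · simp

theorem headOp_splitOp (w : K) {S : Finset (Fin N)} (hS : UpClosed S) :
    headOp S * splitOp N w = tensOp (joinOp S).transpose 1 := by
  refine LinearMap.ext fun φ => funext fun y => ?_
  rcases y with _ | ⟨U, z⟩
  · simp
  · rw [Module.End.mul_apply, headOp_apply, splitOp_cons, tensOp_cons, sum_eq_single (S ∪ U)]
    · simp only [joinOp, Matrix.of_apply, Module.End.one_apply, headOp_apply,
        Matrix.transpose_apply, and_true]
      split_ifs with h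
      · rw [ell_upClosed hS h, neg_zero, zpow_zero]
      · simp
    · intro W _ hW
      simp [joinOp, hW.symm]
    · simp

theorem Psi_succ_mul_one (n : ℕ) : Psi N (n + 1) * tensOp 1 1 = Psi N (n + 1) := by
  rw [Psi, mul_assoc, tensOp_mul, one_mul, mul_one]

theorem one_mul_Psi_succ (n : ℕ) : tensOp 1 1 * Psi N (n + 1) = Psi N (n + 1) := by
  rw [Psi, ← mul_assoc, ← Theta_tensOp_left (by simp), mul_assoc, tensOp_mul, one_mul, one_mul]

theorem mergeOp_mul_one (w : K) : mergeOp N w * tensOp 1 1 = mergeOp N w := by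
  refine LinearMap.ext fun φ => funext fun y => ?_
  rcases y with _ | ⟨U, z⟩
  · simp
  · simp [Matrix.one_apply]

theorem one_mul_splitOp (w : K) : tensOp 1 1 * splitOp N w = splitOp N w := by
  refine LinearMap.ext fun φ => funext fun y => ?_
  rcases y with _ | ⟨U, z⟩
  · simp
  · simp [Matrix.one_apply]

theorem Fop_consOp {p : K} {l l' : Fin N} (hl : l'.val = l.val + 1) (n : ℕ)
    {S : Finset (Fin N)} (h : l ∈ S) (h' : l' ∉ S) :
    Fop N p l (n + 1) * consOp S =
      consOp (mv l l' S) + p⁻¹ ^ weight l S • (consOp S * Fop N p l n) := by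
  rw [Fop, add_mul, tensOp_consOp, tensOp_consOp, F_one_eq hl]
  congr 1
  · rw [sum_eq_single (mv l l' S)]
    · simp [moveOp, mv, h, h']
    · intro T _ hT
      simp only [moveOp, Matrix.of_apply]
      rw [if_neg, zero_smul]
      exact fun c => hT c.2.2
    · simp
  · rw [sum_eq_single S]
    · simp [weightOp]
    · intro T _ hT
      simp [weightOp, hT]
    · simp

theorem headOp_Fop {p : K} {l l' : Fin N} (hl : l'.val = l.val + 1) (n : ℕ)
    {S : Finset (Fin N)} (h : l' ∈ S) (h' : l ∉ S) :
    headOp S * Fop N p l (n + 1) =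
      headOp (mv l' l S) + p⁻¹ ^ weight l S • (Fop N p l n * headOp S) := by
  refine LinearMap.ext fun φ => funext fun z => ?_
  rw [Module.End.mul_apply, headOp_apply, Fop_apply_cons hl, if_pos ⟨h, h'⟩]
  rfl

/-- If `S` is not an initial segment, it arises from a set with smaller element sum by one lowering
move. Lowering a tensor with that set on the left gives `x_S` on the left plus a multiple of a
tensor whose left factor is unchanged. As `D` intertwines lowering operators, induction on the sum
of the elements applies. -/
theorem eq_zero_of_lower_consOp {D : LOp N} {s t : ℕ}
    (hD : ∀ i, D * Fop N q⁻¹ i (s + 1) = Fop N q i t * D)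
    (h₀ : ∀ S, DownClosed S → D * consOp S = 0) (S : Finset (Fin N)) : D * consOp S = 0 := by
  by_cases hS : DownClosed S
  · exact h₀ S hS
  · rw [DownClosed] at hS
    push Not at hS
    obtain ⟨l, l', hl, h₁, h₂⟩ := hS
    have hll : l ≠ l' := fun h => by simp [h] at hl
    have : ∑ t ∈ mv l' l S, t.val < ∑ t ∈ S, t.val := by
      rw [mv, sum_insert (by simp [h₂]), ← add_sum_erase S _ h₁]
      omega
    have ih := eq_zero_of_lower_consOp hD h₀ (mv l' l S)
    have h := Fop_consOp (p := q⁻¹) hl s (S := mv l' l S) (by simp [mem_mv])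
      (by simp [mem_mv, hll.symm])
    rw [mv_mv h₁ h₂] at h
    have h₃ := congrArg (D * ·) h
    simp only [mul_add, mul_smul_comm] at h₃
    rw [← mul_assoc, hD, mul_assoc, ih, mul_zero, ← mul_assoc, ih, zero_mul, smul_zero,
      add_zero] at h₃
    exact h₃.symm
termination_by ∑ t ∈ S, t.val

/-- The dual induction on coordinates, from lowest weight vectors upwards; the measure `N - t`
decreases when an element moves to the right. -/
theorem eq_zero_of_headOp_lower {D : LOp N} {s t : ℕ}
    (hD : ∀ i, D * Fop N q⁻¹ i s = Fop N q i (t + 1) * D)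
    (h₀ : ∀ S, UpClosed S → headOp S * D = 0) (S : Finset (Fin N)) : headOp S * D = 0 := by
  by_cases hS : UpClosed S
  · exact h₀ S hS
  · rw [UpClosed] at hS
    push Not at hS
    obtain ⟨l, l', hl, h₁, h₂⟩ := hS
    have hll : l ≠ l' := fun h => by simp [h] at hl
    have : ∑ t ∈ mv l l' S, (N - t.val) < ∑ t ∈ S, (N - t.val) := by
      rw [mv, sum_insert (by simp [h₂]), ← add_sum_erase S _ h₁]
      have := l'.2
      omega
    have ih := eq_zero_of_headOp_lower hD h₀ (mv l l' S)
    have h := headOp_Fop (p := q) hl t (S := mv l l' S) (by simp [mem_mv])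
      (by simp [mem_mv, hll])
    rw [mv_mv h₁ h₂] at h
    have h₃ := congrArg (· * D) h
    simp only [add_mul, smul_mul_assoc] at h₃
    rw [mul_assoc, ← hD, ← mul_assoc, ih, zero_mul, mul_assoc, ih, mul_zero, smul_zero,
      add_zero] at h₃
    exact h₃.symm
termination_by ∑ t ∈ S, (N - t.val)

theorem v_inv : v⁻¹ = -(q⁻¹)⁻¹ := by rw [v]; exact (neg_inv (a := q⁻¹)).symm

theorem mergeOp_equivariant : Equivariant (mergeOp N v) (mergeOp N v⁻¹) 2 1 where
  lower n i := mergeOp_lower q_ne_zero i n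
  bar n := by
    -- The defect in commutation intertwines the barred with the unbarred lowering operators, so
    -- only highest weight vectors in the leftmost factor need checking. There the merge is a
    -- `joinOp`, which passes through `Theta`.
    have key : ∀ S : Finset (Fin N), (mergeOp N v * Psi N (n + 1 + 1) -
        Psi N (n + 1) * mergeOp N v⁻¹) * consOp S = 0 := by
      refine eq_zero_of_lower_consOp (s := n + 1) (t := n + 1) (fun i => ?_) fun S hS => ?_
      · rw [sub_mul, mul_sub, mul_assoc, Psi_Fop, ← mul_assoc, v,
          ← mergeOp_lower q_ne_zero i n, mul_assoc, mul_assoc, ← v, v_inv,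
          ← mergeOp_lower (inv_ne_zero q_ne_zero) i n, ← mul_assoc (Psi N (n + 1)), Psi_Fop]
        simp only [mul_assoc]
      · have h₁ : Psi N (n + 1 + 1) * consOp S = consOp S * Psi N (n + 1) := by
          rw [Psi, mul_assoc, tensOp_consOp, sum_eq_single S, Matrix.one_apply_eq, one_smul,
            ← mul_assoc, Theta_consOp hS]
          · intro T _ hT
            rw [Matrix.one_apply_ne hT, zero_smul]
          · simp
        rw [sub_mul, mul_assoc, mul_assoc, h₁, ← mul_assoc, mergeOp_consOp _ hS,
          mergeOp_consOp _ hS, Psi, ← mul_assoc, ← Theta_tensOp_left (joinOp_comm hS), mul_assoc,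
          mul_assoc, tensOp_mul, tensOp_mul]
        simp
    -- Summing over the leftmost factor gives vanishing only after composition with `tensOp 1 1`,
    -- which both terms absorb.
    have h : (mergeOp N v * Psi N (n + 1 + 1) - Psi N (n + 1) * mergeOp N v⁻¹) * tensOp 1 1 = 0 := by
      rw [tensOp_one_one, mul_sum]
      refine sum_eq_zero fun S _ => ?_
      rw [← mul_assoc, key, zero_mul]
    rw [sub_mul, mul_assoc, Psi_succ_mul_one, mul_assoc, mergeOp_mul_one, sub_eq_zero] at h
    exact h.symm

theorem splitOp_equivariant : Equivariant (splitOp N v) (splitOp N v⁻¹) 1 2 where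
  lower n i := splitOp_lower q_ne_zero i n
  bar n := by
    have key : ∀ S : Finset (Fin N), headOp S * (splitOp N v * Psi N (n + 1) -
        Psi N (n + 1 + 1) * splitOp N v⁻¹) = 0 := by
      refine eq_zero_of_headOp_lower (s := n + 1) (t := n + 1) (fun i => ?_) fun S hS => ?_
      · rw [sub_mul, mul_sub, mul_assoc, Psi_Fop, ← mul_assoc, v,
          ← splitOp_lower q_ne_zero i n, mul_assoc, mul_assoc, ← v, v_inv,
          ← splitOp_lower (inv_ne_zero q_ne_zero) i n, ← mul_assoc (Psi N (n + 1 + 1)), Psi_Fop]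
        simp only [mul_assoc]
      · have h₁ : headOp S * Psi N (n + 1 + 1) = Psi N (n + 1) * headOp S := by
          rw [Psi, ← mul_assoc, headOp_Theta hS, headOp_tensOp, sum_eq_single S,
            Matrix.one_apply_eq, one_smul]
          · intro T _ hT
            rw [Matrix.one_apply_ne hT.symm, zero_smul]
          · simp
        rw [mul_sub, ← mul_assoc, ← mul_assoc, h₁, headOp_splitOp _ hS, mul_assoc,
          headOp_splitOp _ hS, Psi, ← mul_assoc, ← Theta_tensOp_left (joinOp_transpose_comm hS),
          mul_assoc, mul_assoc, tensOp_mul, tensOp_mul]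
        simp
    have h : tensOp 1 1 * (splitOp N v * Psi N (n + 1) - Psi N (n + 1 + 1) * splitOp N v⁻¹) = 0 := by
      rw [tensOp_one_one, sum_mul]
      refine sum_eq_zero fun S _ => ?_
      rw [mul_assoc, key, mul_zero]
    rw [mul_sub, ← mul_assoc, ← mul_assoc, one_mul_Psi_succ, one_mul_splitOp, sub_eq_zero] at h
    exact h.symm

end BarMergeSplit
end SLWeb

namespace SLWeb
open Finset

set_option linter.unusedSimpArgs false
set_option linter.flexible false

/-! ### Webs as operators on tensors without dual factors -/

noncomputable section WebOperators

variable {N : ℕ}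

/-- The operator `X` acting on what is to the right of the `k` leftmost factors. -/
def liftN : ℕ → LOp N → LOp N
  | 0, X => X
  | k + 1, X => tensOp 1 (liftN k X)

theorem tensOp_one_apply (X : LOp N) (φ : LS N) (S z) :
    tensOp 1 X φ (S :: z) = X (headOp S φ) z := by
  simp [Matrix.one_apply]

theorem liftN_apply (X : LOp N) (φ : LS N) (x z : List (Finset (Fin N))) :
    liftN x.length X φ (x ++ z) = X (fun y => φ (x ++ y)) z := by
  induction x generalizing φ with
  | nil => rfl
  | cons S x ih =>
    change tensOp 1 (liftN x.length X) φ (S :: (x ++ z)) = _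
    rw [tensOp_one_apply, ih]; rfl

theorem Equivariant.liftN {g g' : LOp N} {s t : ℕ} (h : Equivariant g g' s t) (k : ℕ) :
    Equivariant (SLWeb.liftN k g) (SLWeb.liftN k g') (s + k) (t + k) := by
  induction k with
  | zero => exact h
  | succ k ih => exact ih.lift

/-- The action of a web with parameter `w` on tensors, a dual factor `x_T^*` being turned into
a multiple of the factor `x_{Tᶜ}`. -/
def Web.op (w : K) {s t : List Label} : Web N s t → LOp N
  | .empty => 1
  | .strand _ _ => 1
  -- A cup splits `x_univ` and a cap merges onto it. The projection `gradeOp` fixes the cardinality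
  -- of the left end, which for `capR` is `N - a` because that end is dual.
  | .cupL _ _ => splitOp N w * consOp univ
  | .cupR _ _ => splitOp N w * consOp univ
  | .capL a _ => headOp univ * (mergeOp N w * tensOp (gradeOp N a) 1)
  | .capR a _ => headOp univ * (mergeOp N w * tensOp (gradeOp N (N - a)) 1)
  | .split _ _ _ => splitOp N w
  | .merge a _ _ => mergeOp N w * tensOp (gradeOp N a) 1
  | .sinkL _ _ => 1
  | .sinkR a _ => (-1 : K) ^ (a * (N - a)) • 1
  | .sourceL _ _ => 1
  | .sourceR a _ => (-1 : K) ^ (a * (N - a)) • 1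
  | .comp f g => g.op w * f.op w
  -- `g` acts before `f`, while the bottom boundary `r` of `f` still stands on its left.
  | .tens (r := r) f g => f.op w * liftN r.length (g.op w)

theorem merge_grade_equivariant (a : ℕ) : Equivariant (mergeOp N v * tensOp (gradeOp N a) 1)
    (mergeOp N v⁻¹ * tensOp (gradeOp N a) 1) 2 1 :=
  mergeOp_equivariant.mul ((gradeOp_equivariant a).shift 1)

theorem Web.op_equivariant {s t : List Label} (f : Web N s t) :
    Equivariant (f.op v) (f.op v⁻¹) s.length t.length := by
  induction f with
  | empty => exact .one 0
  | strand x hx => exact .one 1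
  | cupL a ha => exact splitOp_equivariant.mul consOp_univ_equivariant
  | cupR a ha => exact splitOp_equivariant.mul consOp_univ_equivariant
  | capL a ha => exact headOp_univ_equivariant.mul (merge_grade_equivariant a)
  | capR a ha => exact headOp_univ_equivariant.mul (merge_grade_equivariant (N - a))
  | split a b hab => exact splitOp_equivariant
  | merge a b hab => exact merge_grade_equivariant a
  | sinkL a ha => exact .one 1
  | sinkR a ha => exact (Equivariant.one 1).smul _
  | sourceL a ha => exact .one 1
  | sourceR a ha => exact (Equivariant.one 1).smul _
  | comp f g hf hg => exact hg.mul hf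
  | @tens r s t u f g hf hg =>
    have h₁ := hf.shift u.length
    have h₂ := hg.liftN r.length
    rw [add_comm u.length r.length] at h₁
    rw [add_comm t.length, add_comm u.length] at h₂
    rw [add_comm u.length s.length] at h₁
    simpa only [List.length_append, Web.op] using h₁.mul h₂

/-! ### Bar conjugation -/

theorem bar_q : bar q = q⁻¹ := by
  have h := RatFunc.liftRingHom_algebraMap (Polynomial.aeval (R := ℂ) (q⁻¹ : K)).toRingHom
    (nonZeroDivisors_le_comap_nonZeroDivisors_of_injective _ aeval_inv_injective) Polynomial.X
  rw [RatFunc.algebraMap_X] at h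
  exact h.trans (by simp)

theorem bar_v : bar v = v⁻¹ := by
  rw [v_inv, v, map_neg, map_inv₀, bar_q]

theorem bar_bar_q : bar (bar q) = q := by rw [bar_q, map_inv₀, bar_q, inv_inv]

theorem bar_bar (x : K) : bar (bar x) = x := by
  have hC : ∀ c : ℂ, bar (algebraMap ℂ K c) = algebraMap ℂ K c := by
    intro c
    have h := RatFunc.liftRingHom_algebraMap (Polynomial.aeval (R := ℂ) (q⁻¹ : K)).toRingHom
      (nonZeroDivisors_le_comap_nonZeroDivisors_of_injective _ aeval_inv_injective)
      (Polynomial.C c)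
    rw [RatFunc.algebraMap_C] at h
    refine Eq.trans ?_ (h.trans ?_)
    · rfl
    · simp
  have hp : ∀ p : Polynomial ℂ, bar (bar (algebraMap _ K p)) = algebraMap _ K p := by
    intro p
    induction p using Polynomial.induction_on' with
    | add p r hp hr => simp [hp, hr]
    | monomial n c =>
      rw [← Polynomial.C_mul_X_pow_eq_monomial, map_mul, map_pow, RatFunc.algebraMap_X,
        RatFunc.algebraMap_C]
      change bar (bar (algebraMap ℂ K c * q ^ n)) = algebraMap ℂ K c * q ^ n
      rw [map_mul, map_mul, hC, hC, map_pow, map_pow, bar_bar_q]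
  induction x using RatFunc.induction_on with
  | _ p r hr => rw [map_div₀, map_div₀, hp, hp]

/-- `g'` is the conjugate of `g` by the bar involution of the coefficients. -/
def BarConj (g g' : LOp N) : Prop := ∀ φ y, bar (g φ y) = g' (fun x => bar (φ x)) y

theorem BarConj.mul {g g' h h' : LOp N} (hg : BarConj g g') (hh : BarConj h h') :
    BarConj (g * h) (g' * h') := by
  intro φ y
  rw [Module.End.mul_apply, hg, Module.End.mul_apply]
  exact congrFun (congrArg g' (funext (hh φ))) y

theorem BarConj.one : BarConj (1 : LOp N) 1 := fun _ _ => rfl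

theorem BarConj.smul {g g' : LOp N} (h : BarConj g g') {c c' : K} (hc : bar c = c') :
    BarConj (c • g) (c' • g') := by
  intro φ y
  simp only [LinearMap.smul_apply, Pi.smul_apply, smul_eq_mul, map_mul, hc, h φ y]

theorem BarConj.tensOp {g g' : LOp N} (h : BarConj g g') {A : Op N}
    (hA : ∀ S T, bar (A S T) = A S T) : BarConj (tensOp A g) (tensOp A g') := by
  rintro φ (_ | ⟨S, y⟩)
  · simp
  · simp only [tensOp_cons, map_sum, map_mul, hA, h _ y]; rfl

theorem BarConj.liftN {g g' : LOp N} (h : BarConj g g') (k : ℕ) :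
    BarConj (SLWeb.liftN k g) (SLWeb.liftN k g') := by
  induction k with
  | zero => exact h
  | succ k ih =>
    refine ih.tensOp fun S T => ?_
    rw [Matrix.one_apply]; split_ifs <;> simp

theorem barConj_split : BarConj (splitOp N v) (splitOp N v⁻¹) := by
  rintro φ (_ | ⟨S, _ | ⟨T, z⟩⟩)
  · simp
  · simp
  · simp only [splitOp_cons]
    split_ifs
    · rw [map_mul, map_zpow₀, bar_v]
    · simp

theorem barConj_merge_grade (a : ℕ) : BarConj (mergeOp N v * tensOp (gradeOp N a) 1)
    (mergeOp N v⁻¹ * tensOp (gradeOp N a) 1) := by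
  refine BarConj.mul ?_ (BarConj.one.tensOp fun S T => ?_)
  · rintro φ (_ | ⟨S, z⟩)
    · simp
    · simp only [mergeOp_cons, map_sum, map_mul, apply_ite bar, map_zpow₀, bar_v, map_zero]
  · rw [gradeOp, Matrix.diagonal_apply]
    split_ifs <;> simp

theorem barConj_head (S : Finset (Fin N)) : BarConj (headOp S) (headOp S) := fun _ _ => rfl

theorem barConj_cons (S : Finset (Fin N)) : BarConj (consOp S) (consOp S) := by
  rintro φ (_ | ⟨T, z⟩)
  · simp
  · simp only [consOp_cons]; split_ifs <;> simp

theorem Web.op_barConj {s t : List Label} (f : Web N s t) : BarConj (f.op v) (f.op v⁻¹) := by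
  induction f with
  | empty => exact .one
  | strand x hx => exact .one
  | cupL a ha => exact barConj_split.mul (barConj_cons _)
  | cupR a ha => exact barConj_split.mul (barConj_cons _)
  | capL a ha => exact (barConj_head _).mul (barConj_merge_grade a)
  | capR a ha => exact (barConj_head _).mul (barConj_merge_grade (N - a))
  | split a b hab => exact barConj_split
  | merge a b hab => exact barConj_merge_grade a
  | sinkL a ha => exact .one
  | sinkR a ha => exact BarConj.one.smul (by simp)
  | sourceL a ha => exact .one
  | sourceR a ha => exact BarConj.one.smul (by simp)
  | comp f g hf hg => exact hg.mul hf
  | tens f g hf hg => exact hf.mul (hg.liftN _)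

/-! ### Coefficients of webs -/

theorem sum_basisStates_cons {M : Type*} [AddCommMonoid M] (x : Label) (o : List Label)
    (g : List (Finset (Fin N)) → M) :
    ∑ y ∈ basisStates N (x :: o), g y =
      ∑ S ∈ powersetCard x.1 univ, ∑ z ∈ basisStates N o, g (S :: z) := by
  rw [basisStates, sum_image, sum_product]
  intro p _ p' _ h
  simp only [List.cons.injEq] at h
  exact Prod.ext h.1 h.2

theorem sum_basisStates_nil {M : Type*} [AddCommMonoid M] (g : List (Finset (Fin N)) → M) :
    ∑ y ∈ basisStates N [], g y = g [] := by
  simp [basisStates]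

theorem sum_basisStates_append {M : Type*} [AddCommMonoid M] (r t : List Label)
    (g : List (Finset (Fin N)) → M) :
    ∑ y ∈ basisStates N (r ++ t), g y =
      ∑ y ∈ basisStates N r, ∑ z ∈ basisStates N t, g (y ++ z) := by
  induction r generalizing g with
  | nil => simp [sum_basisStates_nil]
  | cons x r ih => simp only [List.cons_append, sum_basisStates_cons, ih]

@[simp] theorem mem_basisStates_nil {y : List (Finset (Fin N))} :
    y ∈ basisStates N [] ↔ y = [] := by simp [basisStates]

@[simp] theorem mem_basisStates_cons {x : Label} {o : List Label} {y : List (Finset (Fin N))} :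
    y ∈ basisStates N (x :: o) ↔ ∃ S z, S.card = x.1 ∧ z ∈ basisStates N o ∧ y = S :: z := by
  simp only [basisStates, mem_image, mem_product, mem_powersetCard_univ, Prod.exists]
  constructor
  · rintro ⟨S, z, ⟨h, h'⟩, rfl⟩; exact ⟨S, z, h, h', rfl⟩
  · rintro ⟨S, z, h, h', rfl⟩; exact ⟨S, z, ⟨h, h'⟩, rfl⟩

theorem mem_basisStates_append {r t : List Label} {y : List (Finset (Fin N))} :
    y ∈ basisStates N (r ++ t) ↔
      ∃ y₁ ∈ basisStates N r, ∃ y₂ ∈ basisStates N t, y = y₁ ++ y₂ := by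
  induction r generalizing y with
  | nil => simp
  | cons x r ih =>
    simp only [List.cons_append, mem_basisStates_cons, ih]
    constructor
    · rintro ⟨S, z, hS, ⟨y₁, h₁, y₂, h₂, rfl⟩, rfl⟩
      exact ⟨S :: y₁, ⟨S, y₁, hS, h₁, rfl⟩, y₂, h₂, rfl⟩
    · rintro ⟨_, ⟨S, y₁, hS, h₁, rfl⟩, y₂, h₂, rfl⟩
      exact ⟨S, y₁ ++ y₂, hS, ⟨y₁, h₁, y₂, h₂, rfl⟩, rfl⟩

theorem length_of_mem_basisStates {r : List Label} {y : List (Finset (Fin N))}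
    (h : y ∈ basisStates N r) : y.length = r.length := by
  induction r generalizing y with
  | nil => simp_all
  | cons x r ih =>
    obtain ⟨S, z, -, hz, rfl⟩ := mem_basisStates_cons.mp h
    simp [ih hz]

/-- Complementing the sets at the labels that point down. -/
def complementDown : List Label → List (Finset (Fin N)) → List (Finset (Fin N))
  | x :: o, S :: y => (if x.2 then S else Sᶜ) :: complementDown o y
  | _, _ => []

/-- The scalar relating `x_T^*` with `x_{Tᶜ}`, over all factors that point down. -/
def downScale : List Label → List (Finset (Fin N)) → K
  | x :: o, S :: y => (if x.2 then 1 else v ^ ell S Sᶜ) * downScale o y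
  | _, _ => 1

theorem length_complementDown {r : List Label} {y : List (Finset (Fin N))}
    (h : y.length = r.length) : (complementDown r y).length = r.length := by
  induction r generalizing y with
  | nil => simp [complementDown]
  | cons x r ih =>
    obtain _ | ⟨S, y⟩ := y
    · simp at h
    · simp [complementDown, ih (by simpa using h)]

theorem complementDown_append {r : List Label} {y : List (Finset (Fin N))}
    (h : y.length = r.length) (t : List Label) (z : List (Finset (Fin N))) :
    complementDown (r ++ t) (y ++ z) = complementDown r y ++ complementDown t z := by
  induction r generalizing y with
  | nil => simp_all [complementDown]
  | cons x r ih =>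
    obtain _ | ⟨S, y⟩ := y
    · simp at h
    · simp [complementDown, ih (by simpa using h)]

theorem downScale_append {r : List Label} {y : List (Finset (Fin N))}
    (h : y.length = r.length) (t : List Label) (z : List (Finset (Fin N))) :
    downScale (r ++ t) (y ++ z) = downScale r y * downScale t z := by
  induction r generalizing y with
  | nil => simp_all [downScale]
  | cons x r ih =>
    obtain _ | ⟨S, y⟩ := y
    · simp at h
    · simp [downScale, ih (by simpa using h), mul_assoc]

theorem v_ne_zero : v ≠ 0 := neg_ne_zero.mpr (inv_ne_zero q_ne_zero)

end WebOperators
end SLWeb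

namespace SLWeb
open Finset

set_option linter.unusedSimpArgs false
set_option linter.flexible false

/-! ### The operator of a web computes its matrix -/

noncomputable section WebCoefficients

variable {N : ℕ}

/-- The operator `X` computes the matrix `c` between the boundaries `s` and `t`. -/
def HasCoeff (s t : List Label) (X : LOp N)
    (c : List (Finset (Fin N)) → List (Finset (Fin N)) → K) : Prop :=
  ∀ φ z, ∀ y ∈ basisStates N t, X φ (complementDown t y ++ z) * downScale t y =
    ∑ x ∈ basisStates N s, c x y * downScale s x * φ (complementDown s x ++ z)

theorem HasCoeff.smul {s t : List Label} {X : LOp N} {c} (h : HasCoeff s t X c) (a : K) :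
    HasCoeff s t (a • X) fun x y => a * c x y := by
  intro φ z y hy
  have := congrArg (a * ·) (h φ z y hy)
  simpa [mul_sum, mul_assoc] using this

theorem HasCoeff.comp {r s t : List Label} {X Y : LOp N} {c d} (hX : HasCoeff r s X c)
    (hY : HasCoeff s t Y d) :
    HasCoeff r t (Y * X) fun x y => ∑ z ∈ basisStates N s, c x z * d z y := by
  intro φ z y hy
  rw [Module.End.mul_apply, hY _ _ _ hy]
  simp only [sum_mul]
  rw [sum_comm]
  refine sum_congr rfl fun x hx => ?_
  rw [mul_assoc, mul_comm (downScale s x), hX _ _ _ hx, mul_sum]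
  refine sum_congr rfl fun x' _ => ?_
  ring

theorem HasCoeff.tens {r s t u : List Label} {X Y : LOp N} {c d} (hX : HasCoeff r s X c)
    (hY : HasCoeff t u Y d) :
    HasCoeff (r ++ t) (s ++ u) (X * liftN r.length Y) fun x y =>
      c (x.take r.length) (y.take s.length) * d (x.drop r.length) (y.drop s.length) := by
  intro φ z y hy
  obtain ⟨y₁, h₁, y₂, h₂, rfl⟩ := mem_basisStates_append.mp hy
  have l₁ := length_of_mem_basisStates h₁
  rw [complementDown_append l₁, downScale_append l₁, Module.End.mul_apply, List.append_assoc,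
    ← mul_assoc, hX _ _ _ h₁, sum_basisStates_append, sum_mul]
  refine sum_congr rfl fun x₁ hx₁ => ?_
  have k₁ := length_of_mem_basisStates hx₁
  have e := liftN_apply Y φ (complementDown r x₁) (complementDown u y₂ ++ z)
  rw [length_complementDown k₁] at e
  rw [e, mul_assoc, hY _ _ _ h₂, mul_sum]
  refine sum_congr rfl fun x₂ _ => ?_
  rw [complementDown_append k₁, downScale_append k₁, ← l₁, ← k₁]
  simp only [List.take_left', List.drop_left', List.append_assoc]
  ring

theorem hasCoeff_one (x : Label) :
    HasCoeff (N := N) [x] [x] 1 fun x y => if x = y then 1 else 0 := by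
  intro φ z y hy
  rw [sum_eq_single y]
  · simp [mul_comm]
  · intro x _ hx; simp [hx]
  · exact fun h => absurd hy h

theorem merge_grade_apply (w : K) (a : ℕ) (φ : LS N) (U z) :
    (mergeOp N w * tensOp (gradeOp N a) 1) φ (U :: z) =
      ∑ S, ∑ T, (if Disjoint S T ∧ S ∪ T = U ∧ S.card = a then w ^ ell T S else 0) *
        φ (S :: T :: z) := by
  rw [Module.End.mul_apply, mergeOp_cons]
  refine sum_congr rfl fun S _ => sum_congr rfl fun T _ => ?_
  rw [gradeOp, tensOp_diagonal_apply]
  by_cases h : S.card = a <;> simp [h]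

theorem disjoint_union_univ {S T : Finset (Fin N)} :
    (Disjoint S T ∧ S ∪ T = univ) ↔ T = Sᶜ := by
  constructor
  · rintro ⟨h₁, h₂⟩
    exact (IsCompl.compl_eq ⟨h₁, codisjoint_iff.mpr h₂⟩).symm
  · rintro rfl
    exact ⟨disjoint_compl_right, union_compl S⟩

theorem cap_apply (w : K) (a : ℕ) (φ : LS N) (z) :
    (headOp univ * (mergeOp N w * tensOp (gradeOp N a) 1) : LOp N) φ z =
      ∑ S ∈ powersetCard a univ, w ^ ell Sᶜ S * φ (S :: Sᶜ :: z) := by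
  rw [Module.End.mul_apply, headOp_apply, merge_grade_apply, powersetCard_eq_filter, sum_filter,
    powerset_univ]
  refine sum_congr rfl fun S _ => ?_
  simp only [← and_assoc, disjoint_union_univ]
  rw [sum_eq_single Sᶜ]
  · by_cases h : S.card = a <;> simp [h]
  · intro T _ hT; simp [hT]
  · simp

theorem cup_apply (w : K) (φ : LS N) (S T : Finset (Fin N)) (z) :
    (splitOp N w * consOp univ : LOp N) φ (S :: T :: z) = if T = Sᶜ then w ^ (-ell S T) * φ z else 0 := by
  rw [Module.End.mul_apply, splitOp_cons, consOp_cons]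
  simp only [← disjoint_union_univ]
  by_cases h : Disjoint S T <;> by_cases h' : S ∪ T = univ <;> simp [h, h']

/-- The scale `v ^ ell T Tᶜ` given to `x_T^*` is the coefficient of `D_a`, so the tag becomes the
identity. -/
theorem hasCoeff_sink {a : ℕ} (ha : a ≤ N) :
    HasCoeff (N := N) [up a] [dn (N - a)] 1 sinkCoeff := by
  intro φ z y hy
  simp only [mem_basisStates_cons, mem_basisStates_nil] at hy
  obtain ⟨T, _, hT, rfl, rfl⟩ := hy
  simp only [complementDown, downScale, if_true, List.cons_append, List.nil_append,
    mul_one, sum_basisStates_cons, sum_basisStates_nil, sinkCoeff,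
    Bool.false_eq_true, if_false, Module.End.one_apply]
  rw [sum_eq_single Tᶜ]
  · simp [mul_comm]
  · intro S _ hS
    rw [if_neg (fun h => hS (by rw [h, compl_compl]))]; simp
  · intro h
    refine absurd ?_ h
    simp only [mem_powersetCard_univ]
    rw [card_compl, hT, Fintype.card_fin]
    exact Nat.sub_sub_self ha

theorem hasCoeff_source {a : ℕ} :
    HasCoeff (N := N) [dn (N - a)] [up a] 1 sourceCoeff := by
  intro φ z y hy
  simp only [mem_basisStates_cons, mem_basisStates_nil] at hy
  obtain ⟨T, _, hT, rfl, rfl⟩ := hy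
  simp only [complementDown, downScale, if_true, List.cons_append, List.nil_append,
    mul_one, sum_basisStates_cons, sum_basisStates_nil, sourceCoeff,
    Bool.false_eq_true, if_false, Module.End.one_apply]
  rw [sum_eq_single Tᶜ]
  · simp only [compl_compl, if_true]
    rw [← zpow_add₀ v_ne_zero]; simp
  · intro S _ hS
    rw [if_neg hS]; simp
  · intro h
    refine absurd ?_ h
    simp only [mem_powersetCard_univ]
    rw [card_compl, hT, Fintype.card_fin]

theorem Web.op_hasCoeff {s t : List Label} (f : Web N s t) :
    HasCoeff s t (f.op v) f.coeff := by
  have hv := v_ne_zero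
  induction f with
  | empty =>
    intro φ z y hy
    simp_all [complementDown, downScale, sum_basisStates_nil, Web.op, Web.coeff]
  | strand x hx => exact hasCoeff_one x
  | cupL a ha =>
    intro φ z y hy
    simp only [mem_basisStates_cons, mem_basisStates_nil] at hy
    obtain ⟨S, _, hS, ⟨T, _, hT, rfl, rfl⟩, rfl⟩ := hy
    simp only [complementDown, downScale, sum_basisStates_nil, Web.op, List.cons_append,
      List.nil_append, cup_apply, Web.coeff, cupLCoeff, if_true, Bool.false_eq_true, if_false,
      compl_inj_iff]
    by_cases h : S = T
    · subst h
      simp only [if_true, one_mul, mul_one]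
      rw [mul_right_comm, ← zpow_add₀ hv, neg_add_cancel, zpow_zero, one_mul]
    · simp [h, Ne.symm h]
  | cupR a ha =>
    intro φ z y hy
    simp only [mem_basisStates_cons, mem_basisStates_nil] at hy
    obtain ⟨S, _, hS, ⟨T, _, hT, rfl, rfl⟩, rfl⟩ := hy
    simp only [complementDown, downScale, sum_basisStates_nil, Web.op, List.cons_append,
      List.nil_append, cup_apply, Web.coeff, cupRCoeff, if_true, Bool.false_eq_true, if_false,
      compl_compl]
    by_cases h : S = T
    · subst h
      simp only [if_true, one_mul, mul_one]
      rw [mul_right_comm, ← zpow_add₀ hv, neg_add_eq_sub]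
    · simp [h, Ne.symm h]
  | capL a ha =>
    intro φ z y hy
    obtain rfl := mem_basisStates_nil.mp hy
    simp only [Web.op, complementDown, downScale, List.nil_append, mul_one]
    rw [cap_apply, sum_basisStates_cons]
    refine sum_congr rfl fun S hS => ?_
    rw [sum_basisStates_cons, sum_eq_single S]
    · simp only [sum_basisStates_nil, Web.coeff, capLCoeff, complementDown, downScale, if_true,
        Bool.false_eq_true, if_false, mul_one, one_mul, List.cons_append, List.nil_append]
      rw [← zpow_add₀ hv, sub_add_cancel]
    · intro T _ hT
      simp [sum_basisStates_nil, Web.coeff, capLCoeff, hT.symm]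
    · exact fun h => absurd hS h
  | capR a ha =>
    intro φ z y hy
    obtain rfl := mem_basisStates_nil.mp hy
    simp only [Web.op, complementDown, downScale, List.nil_append, mul_one]
    rw [cap_apply, sum_basisStates_cons]
    symm
    refine sum_bij' (fun S _ => Sᶜ) (fun S _ => Sᶜ) ?_ ?_ ?_ ?_ ?_
    · intro S hS
      simp only [mem_powersetCard_univ] at hS ⊢
      rw [card_compl, hS, Fintype.card_fin]
    · intro S hS
      simp only [mem_powersetCard_univ] at hS ⊢
      rw [card_compl, hS, Fintype.card_fin]; omega
    · simp
    · simp
    intro S hS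
    rw [sum_basisStates_cons, sum_eq_single S]
    · simp [sum_basisStates_nil, Web.coeff, capRCoeff, complementDown, downScale]
    · intro T _ hT
      simp [sum_basisStates_nil, Web.coeff, capRCoeff, hT.symm]
    · exact fun h => absurd hS h
  -- No projection is needed: `y` already prescribes the cardinalities of both upper sets.
  | split a b hab =>
    intro φ z y hy
    simp only [mem_basisStates_cons, mem_basisStates_nil] at hy
    obtain ⟨S, _, hS, ⟨T, _, hT, rfl, rfl⟩, rfl⟩ := hy
    simp only [complementDown, downScale, Web.op, if_true, List.cons_append, List.nil_append,
      splitOp_cons, mul_one]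
    rw [sum_basisStates_cons]
    by_cases h : Disjoint S T
    · rw [if_pos h, sum_eq_single (S ∪ T)]
      · simp [sum_basisStates_nil, Web.coeff, splitCoeff, h, complementDown, downScale]
      · intro U _ hU
        simp [sum_basisStates_nil, Web.coeff, splitCoeff, hU.symm]
      · intro h'
        exact absurd (by simp [card_union_of_disjoint h, hS, hT]) h'
    · rw [if_neg h]
      simp [sum_basisStates_nil, Web.coeff, splitCoeff, h]
  | merge a b hab =>
    intro φ z y hy
    simp only [mem_basisStates_cons, mem_basisStates_nil] at hy
    obtain ⟨U, _, hU, rfl, rfl⟩ := hy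
    simp only [complementDown, downScale, Web.op, if_true, List.cons_append, List.nil_append,
      mul_one, merge_grade_apply, sum_basisStates_cons, sum_basisStates_nil, Web.coeff, mergeCoeff]
    symm
    rw [powersetCard_eq_filter, sum_filter, powerset_univ]
    refine sum_congr rfl fun S _ => ?_
    by_cases h : S.card = a
    · rw [if_pos h, powersetCard_eq_filter, sum_filter, powerset_univ]
      refine sum_congr rfl fun T _ => ?_
      by_cases h' : Disjoint S T ∧ S ∪ T = U
      -- The projection prescribes only the cardinality of `S`; that of `T` follows from `hU`.
      · rw [if_pos, if_pos h', if_pos ⟨h'.1, h'.2, h⟩]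
        rw [← h'.2, card_union_of_disjoint h'.1] at hU
        change S.card + T.card = a + b at hU
        omega
      · rw [if_neg h', if_neg (c := Disjoint S T ∧ S ∪ T = U ∧ S.card = a) fun c => h' ⟨c.1, c.2.1⟩]; simp
    · rw [if_neg h]; simp [h]
  | sinkL a ha => exact hasCoeff_sink ha
  | sinkR a ha => exact (hasCoeff_sink ha).smul _
  | sourceL a ha => exact hasCoeff_source
  | sourceR a ha => exact (hasCoeff_source).smul _
  | comp f g hf hg => exact hf.comp hg
  | tens f g hf hg => exact hf.tens hg

end WebCoefficients
end SLWeb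

namespace SLWeb
open Finset

set_option linter.unusedSimpArgs false
set_option linter.flexible false

/-! ### The matrix of ψ, and webs as its fixed vectors -/

noncomputable section PsiMatrix

variable {N : ℕ}

theorem stateList_succ {n : ℕ} (S : Fin (n + 1) → Finset (Fin N)) :
    stateList S = S (Fin.last n) :: stateList (Fin.init S) := by
  rw [stateList, List.ofFn_succ', List.concat_eq_append, List.reverse_append]
  rfl

theorem boundary_succ {n : ℕ} (k : Fin (n + 1) → ℕ) :
    boundary k = up (k (Fin.last n)) :: boundary (Fin.init k) := by
  rw [boundary, List.ofFn_succ', List.concat_eq_append, List.reverse_append]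
  rfl

theorem stateList_injective {n : ℕ} :
    Function.Injective (stateList : (Fin n → Finset (Fin N)) → List (Finset (Fin N))) :=
  List.reverse_injective.comp List.ofFn_injective

theorem stateList_mem {n : ℕ} {k : Fin n → ℕ} (S : BasisIndex N k) :
    stateList S.1 ∈ basisStates N (boundary k) := by
  induction n with
  | zero => simp [stateList, boundary]
  | succ n ih =>
    rw [stateList_succ, boundary_succ, mem_basisStates_cons]
    exact ⟨_, _, S.2 _, ih (k := Fin.init k) ⟨Fin.init S.1, fun i => S.2 _⟩, rfl⟩

theorem exists_stateList {n : ℕ} {k : Fin n → ℕ} {y : List (Finset (Fin N))}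
    (hy : y ∈ basisStates N (boundary k)) : ∃ S : BasisIndex N k, stateList S.1 = y := by
  induction n generalizing y with
  | zero => exact ⟨⟨Fin.elim0, fun i => i.elim0⟩, by simp_all [stateList, boundary]⟩
  | succ n ih =>
    rw [boundary_succ, mem_basisStates_cons] at hy
    obtain ⟨U, z, hU, hz, rfl⟩ := hy
    obtain ⟨S, rfl⟩ := ih hz
    refine ⟨⟨Fin.snoc S.1 U, fun i => ?_⟩, ?_⟩
    · induction i using Fin.lastCases with
      | last => simpa using hU
      | cast i => simpa [Fin.init] using S.2 i
    · rw [stateList_succ]; simp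

theorem sum_basisStates_boundary {n : ℕ} {k : Fin n → ℕ} (g : List (Finset (Fin N)) → K) :
    ∑ y ∈ basisStates N (boundary k), g y = ∑ S : BasisIndex N k, g (stateList S.1) := by
  symm
  refine sum_bij (fun S _ => stateList S.1) (fun S _ => stateList_mem S) ?_ ?_ (fun _ _ => rfl)
  · exact fun S _ T _ h => Subtype.ext (stateList_injective h)
  · intro y hy
    obtain ⟨S, hS⟩ := exists_stateList hy
    exact ⟨S, mem_univ _, hS⟩

/-- The matrix `M` is homogeneous of degree `0` and describes the operator `X` on tensors with `n`
factors. -/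
structure Represents {n : ℕ} (M : TensorOp N n) (X : LOp N) : Prop where
  apply : ∀ φ S, X φ (stateList S) = ∑ T, M S T * φ (stateList T)
  graded : ∀ S T i, (S i).card ≠ (T i).card → M S T = 0

/-- `A` preserves the degree. -/
def Graded (A : Op N) : Prop := ∀ S T : Finset (Fin N), S.card ≠ T.card → A S T = 0

theorem sum_succ {n : ℕ} (g : (Fin (n + 1) → Finset (Fin N)) → K) :
    ∑ T, g T = ∑ U, ∑ T : Fin n → Finset (Fin N), g (Fin.snoc T U) := by
  rw [← Fintype.sum_prod_type']
  exact (Fintype.sum_equiv (Fin.snocEquiv fun _ => Finset (Fin N)) _ _ fun _ => rfl).symm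

section
variable {n : ℕ} {M M' : TensorOp N n} {X X' : LOp N}

theorem Represents.zero : Represents (0 : TensorOp N n) (0 : LOp N) :=
  ⟨fun φ S => by simp, fun S T i _ => by simp⟩

theorem Represents.one : Represents (1 : TensorOp N n) (1 : LOp N) :=
  ⟨fun φ S => by simp [Matrix.one_apply],
    fun S T i h => Matrix.one_apply_ne fun e => h (by rw [e])⟩

theorem Represents.add (h : Represents M X) (h' : Represents M' X') :
    Represents (M + M') (X + X') :=
  ⟨fun φ S => by simp [h.apply, h'.apply, add_mul, sum_add_distrib],
    fun S T i hi => by simp [h.graded S T i hi, h'.graded S T i hi]⟩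

theorem Represents.smul (h : Represents M X) (c : K) : Represents (c • M) (c • X) :=
  ⟨fun φ S => by simp [h.apply, mul_sum, mul_assoc],
    fun S T i hi => by simp [h.graded S T i hi]⟩

theorem Represents.sub (h : Represents M X) (h' : Represents M' X') :
    Represents (M - M') (X - X') :=
  ⟨fun φ S => by simp [h.apply, h'.apply, sub_mul, sum_sub_distrib],
    fun S T i hi => by simp [h.graded S T i hi, h'.graded S T i hi]⟩

theorem Represents.mul (h : Represents M X) (h' : Represents M' X') :
    Represents (M * M') (X * X') := by
  refine ⟨fun φ S => ?_, fun S T i hi => ?_⟩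
  · rw [Module.End.mul_apply, h.apply]
    simp only [h'.apply, Matrix.mul_apply, mul_sum, sum_mul]
    rw [sum_comm]
    simp only [mul_assoc]
  · rw [Matrix.mul_apply]
    refine sum_eq_zero fun U _ => ?_
    by_cases hU : (S i).card = (U i).card
    · rw [h'.graded U T i (hU ▸ hi), mul_zero]
    · rw [h.graded S U i hU, zero_mul]

theorem Represents.kron {A : Op N} (hA : Graded A) (h : Represents M X) :
    Represents (SLWeb.kron A M) (tensOp A X) := by
  refine ⟨fun φ S => ?_, fun S T i hi => ?_⟩
  · rw [stateList_succ, tensOp_cons, sum_succ]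
    refine sum_congr rfl fun U _ => ?_
    rw [h.apply, mul_sum]
    refine sum_congr rfl fun T _ => ?_
    rw [stateList_succ (Fin.snoc T U)]
    simp [SLWeb.kron, mul_assoc]
  · simp only [SLWeb.kron, Matrix.of_apply]
    induction i using Fin.lastCases with
    | last => rw [hA _ _ hi, zero_mul]
    | cast i => rw [h.graded _ _ i hi, mul_zero]

theorem Graded.add {A B : Op N} (hA : Graded A) (hB : Graded B) : Graded (A + B) :=
  fun S T h => by simp [hA S T h, hB S T h]

theorem Graded.sub {A B : Op N} (hA : Graded A) (hB : Graded B) : Graded (A - B) :=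
  fun S T h => by simp [hA S T h, hB S T h]

theorem Graded.smul {A : Op N} (hA : Graded A) (c : K) : Graded (c • A) :=
  fun S T h => by simp [hA S T h]

theorem Graded.mul {A B : Op N} (hA : Graded A) (hB : Graded B) : Graded (A * B) := by
  intro S T h
  rw [Matrix.mul_apply]
  refine sum_eq_zero fun U _ => ?_
  by_cases hU : S.card = U.card
  · rw [hB U T (hU ▸ h), mul_zero]
  · rw [hA S U hU, zero_mul]

theorem graded_diagonal (c : Finset (Fin N) → K) : Graded (Matrix.diagonal c) :=
  fun _ _ h => Matrix.diagonal_apply_ne _ fun e => h (by rw [e])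

theorem graded_one : Graded (1 : Op N) := graded_diagonal _

theorem graded_move (a b : Fin N) : Graded (moveOp a b) := by
  intro S T h
  simp only [moveOp, Matrix.of_apply]
  rw [if_neg]
  rintro ⟨ha, hb, rfl⟩
  rw [card_insert_of_notMem (by simp [hb]), card_erase_of_mem ha] at h
  have := card_pos.mpr ⟨a, ha⟩
  omega

theorem graded_zero : Graded (0 : Op N) := fun _ _ _ => rfl

theorem graded_E (i : ℕ) : Graded (E₁ N i) := by
  rcases E_one_cases (N := N) i with h | ⟨l, l', -, -, h⟩ <;> rw [h]
  exacts [graded_zero, graded_move _ _]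

theorem graded_F (i : ℕ) : Graded (F₁ N i) := by
  rcases F_one_cases (N := N) i with h | ⟨l, l', -, -, h⟩
  · rw [(h 0 0).1]; exact graded_zero
  · rw [h]; exact graded_move _ _

theorem graded_rootE (p : K) (i d : ℕ) : Graded (rootE p (E₁ N) i d) := by
  induction d with
  | zero => exact graded_E i
  | succ d ih => exact (ih.mul (graded_E _)).sub (((graded_E _).mul ih).smul _)

end

theorem represents_F (i n : ℕ) : Represents (F N i n) (Fop N q i n) := by
  induction n with
  | zero => exact .zero
  | succ n ih =>
    rw [F, Fop, Kinv_eq]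
    exact (Represents.one.kron (graded_F i)).add (ih.kron (graded_diagonal _))

theorem represents_root (p : K) (n i d : ℕ) :
    Represents (rootF p (fun j => F N j n) i d) (rootVec p (fun j => Fop N q j n) i d) := by
  induction d with
  | zero => exact represents_F i n
  | succ d ih =>
    exact ((represents_F _ n).mul ih).sub ((ih.mul (represents_F _ n)).smul p)

theorem represents_prod {n : ℕ} {a : ℕ → ℕ → TensorOp N n} {b : ℕ → ℕ → LOp N}
    (h : ∀ i d, Represents (a i d) (b i d)) (l : List ℕ) (l' : ℕ → List ℕ) :
    Represents (l.flatMap fun i => (l' i).map (a i)).prod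
      (l.flatMap fun i => (l' i).map (b i)).prod := by
  have inner : ∀ i (m : List ℕ), Represents (m.map (a i)).prod (m.map (b i)).prod := by
    intro i m
    induction m with
    | nil => exact .one
    | cons d m ih => simp only [List.map_cons, List.prod_cons]; exact (h i d).mul ih
  induction l with
  | nil => exact .one
  | cons i l ih =>
    simp only [List.flatMap_cons, List.prod_append]
    exact (inner i _).mul ih

theorem represents_theta (n : ℕ) : Represents (theta N n q⁻¹) (Theta N n) :=
  represents_prod (fun i d => Represents.one.add
    (((represents_root q⁻¹ n i d).kron (graded_rootE q⁻¹ i d)).smul _)) _ _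

theorem represents_psi (n : ℕ) : Represents (psiMatrix N n) (Psi N n) := by
  induction n with
  | zero => exact .one
  | succ n ih => exact (represents_theta n).mul (ih.kron graded_one)

/-! ### Webs are fixed by the bar involution -/

/-- The basis tensor with the given factors. -/
def indicator (y : List (Finset (Fin N))) : LS N := fun x => if x = y then 1 else 0

theorem indicator_cons (S : Finset (Fin N)) (y) :
    indicator (S :: y) = consOp S (indicator y) := by
  ext x
  obtain _ | ⟨T, x⟩ := x
  · simp [indicator]
  · simp only [indicator, consOp_cons, List.cons.injEq]
    by_cases h : T = S <;> simp [h]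

/-- A tensor product of highest weight vectors is fixed, since every `Theta` that occurs acts
trivially on its leftmost factor. -/
theorem Psi_indicator {y : List (Finset (Fin N))} (hy : ∀ S ∈ y, DownClosed S) :
    Psi N y.length (indicator y) = indicator y := by
  induction y with
  | nil => rfl
  | cons S y ih =>
    have h : Psi N (y.length + 1) * consOp S = consOp S * Psi N y.length := by
      rw [Psi, mul_assoc, tensOp_consOp, sum_eq_single S, Matrix.one_apply_eq, one_smul,
        ← mul_assoc, Theta_consOp (hy S (by simp))]
      · intro T _ hT
        rw [Matrix.one_apply_ne hT, zero_smul]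
      · simp
    rw [List.length_cons, indicator_cons, ← Module.End.mul_apply, h, Module.End.mul_apply,
      ih fun T hT => hy T (by simp [hT])]

theorem complementDown_eq_self {r : List Label} {y : List (Finset (Fin N))}
    (h : y.length = r.length) (hr : ∀ x ∈ r, x.2 = true) :
    complementDown r y = y ∧ downScale r y = 1 := by
  induction r generalizing y with
  | nil => simp_all [complementDown, downScale]
  | cons x r ih =>
    obtain _ | ⟨S, y⟩ := y
    · simp at h
    · have := ih (by simpa using h) (fun x hx => hr x (by simp [hx]))
      simp [complementDown, downScale, this, hr x (by simp)]

theorem boundary_up {n : ℕ} (k : Fin n → ℕ) : ∀ x ∈ boundary k, x.2 = true := by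
  intro x hx
  simp only [boundary, List.mem_reverse, List.mem_ofFn] at hx
  obtain ⟨i, rfl⟩ := hx
  rfl

variable {ℓ : ℕ}

/-- The label of the only basis tensor of `Λ_q^{(N^ℓ)}`. -/
def topIndex (N ℓ : ℕ) : BasisIndex N (topWeight N ℓ) :=
  ⟨fun i => if (i : ℕ) < ℓ then univ else ∅, fun i => by
    by_cases h : (i : ℕ) < ℓ <;> simp [topWeight, h]⟩

theorem topIndex_unique (S : BasisIndex N (topWeight N ℓ)) : S = topIndex N ℓ := by
  refine Subtype.ext (funext fun i => ?_)
  have := S.2 i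
  simp only [topWeight, topIndex] at this ⊢
  split_ifs at this ⊢ with h
  · exact (card_eq_iff_eq_univ _).mp (by simpa using this)
  · exact card_eq_zero.mp this

theorem length_topState : (topState N ℓ).length = N * ℓ := by simp [topState, stateList]

theorem downClosed_topState : ∀ S ∈ topState N ℓ, DownClosed S := by
  intro S hS
  simp only [topState, stateList, List.mem_reverse, List.mem_ofFn] at hS
  obtain ⟨i, rfl⟩ := hS
  intro l l' hl h
  split_ifs at h ⊢
  · exact mem_univ _
  · simp at h

variable {k : Fin (N * ℓ) → ℕ}

theorem length_boundary {n : ℕ} (k : Fin n → ℕ) : (boundary k).length = n := by simp [boundary]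

theorem webVector_eq (w : MonomialWeb N ℓ k) (S : BasisIndex N k) :
    webVector w S = w.op v (indicator (topState N ℓ)) (stateList S.1) := by
  have h := w.op_hasCoeff (indicator (topState N ℓ)) [] _ (stateList_mem S)
  have up₁ := fun y (hy : y ∈ basisStates N (boundary (topWeight N ℓ))) =>
    complementDown_eq_self (length_of_mem_basisStates hy) (boundary_up _)
  obtain ⟨e₁, e₂⟩ := complementDown_eq_self (length_of_mem_basisStates (stateList_mem S))
    (boundary_up _)
  rw [e₁, e₂, mul_one, List.append_nil] at h
  rw [h, sum_basisStates_boundary, Fintype.sum_eq_single (topIndex N ℓ)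
    fun T hT => absurd (topIndex_unique T) hT]
  obtain ⟨e₃, e₄⟩ := up₁ _ (stateList_mem (topIndex N ℓ))
  rw [e₃, e₄, List.append_nil]
  simp [indicator, webVector, topState, topIndex]

/-- The web commutes with `ψ`, and its bottom vector is fixed because each factor is `x_univ` or
`x_∅`. Barring the coordinates of the web vector replaces `w.op v` by `w.op v⁻¹`, the form in which
equivariance is stated. -/
theorem psi_webVector (w : MonomialWeb N ℓ k) : psi (webVector w) = webVector w := by
  funext S
  have h := (w.op_equivariant).bar 0
  rw [length_boundary, length_boundary, zero_add] at h
  have h₁ := congrFun (LinearMap.congr_fun h (indicator (topState N ℓ))) (stateList S.1)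
  have h₂ := Psi_indicator (downClosed_topState (N := N) (ℓ := ℓ))
  rw [length_topState] at h₂
  rw [Module.End.mul_apply, Module.End.mul_apply, h₂, ← webVector_eq,
    (represents_psi _).apply] at h₁
  rw [← h₁, psi]
  have h₃ : ∀ T : BasisIndex N k, bar (webVector w T) =
      w.op v⁻¹ (indicator (topState N ℓ)) (stateList T.1) := by
    intro T
    rw [webVector_eq, w.op_barConj]
    refine congrFun (congrArg _ (funext fun x => ?_)) _
    simp only [indicator]; split_ifs <;> simp
  simp only [h₃]
  -- The sum over all families reduces to `BasisIndex N k`, since `psiMatrix` preserves the degree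
  -- of each factor.
  have h₄ := Fintype.sum_subtype_add_sum_subtype (fun T : Fin (N * ℓ) → Finset (Fin N) =>
    ∀ i, (T i).card = k i) fun T => psiMatrix N (N * ℓ) S.1 T *
      w.op v⁻¹ (indicator (topState N ℓ)) (stateList T)
  rw [← h₄, left_eq_add]
  refine sum_eq_zero fun T _ => ?_
  obtain ⟨i, hi⟩ := not_forall.mp T.2
  rw [(represents_psi _).graded _ _ i (by rw [S.2 i]; exact Ne.symm hi), zero_mul]

/-- A closed web vector is `ev w` times a vector fixed by `ψ`, so `psi_webVector` bars only the
scalar. -/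
theorem bar_ev (w : MonomialWeb N ℓ (topWeight N ℓ)) : bar (ev w) = ev w := by
  have h₁ : psiMatrix N (N * ℓ) (topIndex N ℓ).1 (topIndex N ℓ).1 = 1 := by
    have h₂ := Psi_indicator (downClosed_topState (N := N) (ℓ := ℓ))
    have h₃ := (represents_psi (N := N) (N * ℓ)).apply (indicator (topState N ℓ)) (topIndex N ℓ).1
    rw [length_topState] at h₂
    rw [h₂, Fintype.sum_eq_single (topIndex N ℓ).1] at h₃
    · have e : stateList (topIndex N ℓ).1 = topState N ℓ := rfl
      simpa [e, indicator, eq_comm] using h₃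
    · intro T hT
      have : stateList T ≠ topState N ℓ := fun e => hT (stateList_injective e)
      simp [indicator, this]
  have h := congrFun (psi_webVector w) (topIndex N ℓ)
  rw [psi, Fintype.sum_eq_single (topIndex N ℓ) fun T hT => absurd (topIndex_unique T) hT, h₁,
    one_mul] at h
  exact h

end PsiMatrix
end SLWeb

namespace SLWeb
open Finset

set_option linter.unusedSimpArgs false
set_option linter.flexible false

/-! ### Reflection of webs, conservation of weight and the normalising exponent -/

noncomputable section StarWeight

variable {N : ℕ}

theorem ell_add_left {S T : Finset (Fin N)} (h : Disjoint S T) (U : Finset (Fin N)) :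
    ell (S ∪ T) U = ell S U + ell T U := by
  simp only [ell, union_product, filter_union]
  rw [card_union_of_disjoint, Nat.cast_add]
  refine disjoint_filter_filter ?_
  rw [disjoint_product]; exact Or.inl h

theorem ell_add_right {S T : Finset (Fin N)} (h : Disjoint S T) (U : Finset (Fin N)) :
    ell U (S ∪ T) = ell U S + ell U T := by
  simp only [ell, product_union, filter_union]
  rw [card_union_of_disjoint, Nat.cast_add]
  refine disjoint_filter_filter ?_
  rw [disjoint_product]; exact Or.inr h

/-- The right side is the exponent by which the merge differs from the transposed split; the left
side exhibits it as a difference of boundary terms. -/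
theorem ell_compl_union {T U : Finset (Fin N)} (h : Disjoint T U) :
    -ell (T ∪ U)ᶜ (T ∪ U) + ell Tᶜ T + ell Uᶜ U = ell U T + ell T U := by
  have h₁ : Tᶜ = (T ∪ U)ᶜ ∪ U := by
    ext x; have : x ∈ T → x ∉ U := fun hx => Finset.disjoint_left.mp h hx; simp; tauto
  have h₂ : Uᶜ = (T ∪ U)ᶜ ∪ T := by
    ext x; have : x ∈ T → x ∉ U := fun hx => Finset.disjoint_left.mp h hx; simp; tauto
  have d₁ : Disjoint (T ∪ U)ᶜ U := disjoint_compl_left.mono_right subset_union_right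
  have d₂ : Disjoint (T ∪ U)ᶜ T := disjoint_compl_left.mono_right subset_union_left
  rw [h₁, h₂, ell_add_left d₁, ell_add_left d₂, ell_add_right h]
  ring

/-- The sum over the factors of an integer that depends on the orientation and the set. -/
def totalExp (e : Bool → Finset (Fin N) → ℤ) : List Label → List (Finset (Fin N)) → ℤ
  | x :: o, S :: y => e x.2 S + totalExp e o y
  | _, _ => 0

theorem totalExp_append (e : Bool → Finset (Fin N) → ℤ) {r : List Label}
    {y : List (Finset (Fin N))} (h : y.length = r.length) (t : List Label)
    (z : List (Finset (Fin N))) :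
    totalExp e (r ++ t) (y ++ z) = totalExp e r y + totalExp e t z := by
  induction r generalizing y with
  | nil => simp_all [totalExp]
  | cons x r ih =>
    obtain _ | ⟨S, y⟩ := y
    · simp at h
    · simp [totalExp, ih (by simpa using h), add_assoc]

theorem totalExp_boundary (e : Bool → Finset (Fin N) → ℤ) {n : ℕ} (k : Fin n → ℕ)
    (S : Fin n → Finset (Fin N)) :
    totalExp e (boundary k) (stateList S) = ∑ i, e true (S i) := by
  induction n with
  | zero => simp [boundary, totalExp]
  | succ n ih =>
    rw [boundary_succ, stateList_succ, totalExp, ih, Fin.sum_univ_castSucc, add_comm]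
    rfl

/-- The exponent of a factor in the comparison of a web with its reflection. -/
def starExp (b : Bool) (S : Finset (Fin N)) : ℤ := if b then -ell Sᶜ S else ell S Sᶜ

/-- The matrices `c` and `d` are adjoint up to the powers of `v` given by `starExp`. -/
def StarRelated (s t : List Label) (c d : List (Finset (Fin N)) → List (Finset (Fin N)) → K) :
    Prop :=
  ∀ x ∈ basisStates N s, ∀ y ∈ basisStates N t,
    d y x = v ^ (totalExp starExp s x - totalExp starExp t y) * c x y

theorem StarRelated.symm {s t : List Label} {c d : List (Finset (Fin N)) → _}
    (h : StarRelated s t c d) : StarRelated t s d c := by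
  intro y hy x hx
  rw [h x hx y hy, ← mul_assoc, ← zpow_add₀ v_ne_zero]
  simp

theorem StarRelated.smul {s t : List Label} {c d : List (Finset (Fin N)) → _}
    (h : StarRelated s t c d) (a : K) :
    StarRelated s t (fun x y => a * c x y) (fun x y => a * d x y) := by
  intro x hx y hy
  simp only [h x hx y hy]
  ring

theorem starRelated_cupL (a : ℕ) :
    StarRelated (N := N) [] [up a, dn a] cupLCoeff capLCoeff := by
  intro x hx y hy
  simp only [mem_basisStates_cons, mem_basisStates_nil] at hx hy
  obtain ⟨S, _, hS, ⟨T, _, hT, rfl, rfl⟩, rfl⟩ := hy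
  subst hx
  by_cases h : S = T
  · subst h
    simp [totalExp, starExp, cupLCoeff, capLCoeff, sub_eq_add_neg, add_comm]
  · simp [cupLCoeff, capLCoeff, h]

theorem starRelated_cupR (a : ℕ) :
    StarRelated (N := N) [] [dn a, up a] cupRCoeff capRCoeff := by
  intro x hx y hy
  simp only [mem_basisStates_cons, mem_basisStates_nil] at hx hy
  obtain ⟨S, _, hS, ⟨T, _, hT, rfl, rfl⟩, rfl⟩ := hy
  subst hx
  by_cases h : S = T
  · subst h
    simp only [totalExp, starExp, cupRCoeff, capRCoeff, if_true, Bool.false_eq_true, if_false]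
    rw [← zpow_add₀ v_ne_zero]
    simp [← sub_eq_add_neg]
  · simp [cupRCoeff, capRCoeff, h]

theorem starRelated_split (a b : ℕ) :
    StarRelated (N := N) [up (a + b)] [up a, up b] splitCoeff mergeCoeff := by
  intro x hx y hy
  simp only [mem_basisStates_cons, mem_basisStates_nil] at hx hy
  obtain ⟨T, _, -, ⟨U, _, -, rfl, rfl⟩, rfl⟩ := hy
  obtain ⟨S, _, -, rfl, rfl⟩ := hx
  by_cases h : Disjoint T U ∧ T ∪ U = S
  · obtain ⟨h, rfl⟩ := h
    simp only [totalExp, starExp, splitCoeff, mergeCoeff, h, if_true, true_and]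
    rw [← zpow_add₀ v_ne_zero]
    congr 1
    have := ell_compl_union h
    linarith
  · simp [splitCoeff, mergeCoeff, h]

theorem starRelated_sink (a : ℕ) :
    StarRelated (N := N) [up a] [dn (N - a)] sinkCoeff sourceCoeff := by
  intro x hx y hy
  simp only [mem_basisStates_cons, mem_basisStates_nil] at hx hy
  obtain ⟨T, _, -, rfl, rfl⟩ := hy
  obtain ⟨S, _, -, rfl, rfl⟩ := hx
  by_cases h : T = Sᶜ
  · subst h
    simp only [totalExp, starExp, sinkCoeff, sourceCoeff, if_true, Bool.false_eq_true, if_false,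
      compl_compl]
    rw [← zpow_add₀ v_ne_zero]
    congr 1
    ring
  · have : S ≠ Tᶜ := fun e => h (by rw [e, compl_compl])
    simp [sinkCoeff, sourceCoeff, h, this]

theorem starRelated_one (s : List Label) : StarRelated (N := N) s s
    (fun x y => if x = y then 1 else 0) (fun x y => if x = y then 1 else 0) := by
  intro x _ y _
  by_cases h : x = y
  · subst h; simp
  · simp [h, Ne.symm h]

/-- A check on generators suffices, because the exponents telescope under glueing and add under
juxtaposition. -/
theorem Web.star_coeff {s t : List Label} (f : Web N s t) :
    StarRelated s t f.coeff f.star.coeff := by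
  induction f with
  | empty => exact starRelated_one _
  | strand x hx => exact starRelated_one _
  | cupL a ha => exact starRelated_cupL a
  | cupR a ha => exact starRelated_cupR a
  | capL a ha => exact (starRelated_cupL a).symm
  | capR a ha => exact (starRelated_cupR a).symm
  | split a b hab => exact starRelated_split a b
  | merge a b hab => exact (starRelated_split a b).symm
  | sinkL a ha => exact starRelated_sink a
  | sinkR a ha => exact (starRelated_sink a).smul _
  | sourceL a ha => exact (starRelated_sink a).symm
  | sourceR a ha => exact (starRelated_sink a).symm.smul _
  | @comp r s t f g hf hg =>
    intro x hx y hy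
    simp only [Web.star, Web.coeff, mul_sum]
    refine sum_congr rfl fun z hz => ?_
    have e := zpow_add₀ v_ne_zero (totalExp starExp r x - totalExp starExp s z)
      (totalExp starExp s z - totalExp starExp t y)
    rw [sub_add_sub_cancel] at e
    rw [hf x hx z hz, hg z hz y hy, e]
    ring
  | tens f g hf hg =>
    intro x hx y hy
    obtain ⟨x₁, hx₁, x₂, hx₂, rfl⟩ := mem_basisStates_append.mp hx
    obtain ⟨y₁, hy₁, y₂, hy₂, rfl⟩ := mem_basisStates_append.mp hy
    have lx := length_of_mem_basisStates hx₁
    have ly := length_of_mem_basisStates hy₁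
    rw [totalExp_append _ lx, totalExp_append _ ly]
    simp only [Web.star, Web.coeff, ← lx, ← ly, List.take_left', List.drop_left']
    rw [hf _ hx₁ _ hy₁, hg _ hx₂ _ hy₂, add_sub_add_comm, zpow_add₀ v_ne_zero]
    ring

/-! ### Conservation of weight -/

/-- The contribution of a factor to the weight in the direction `c`. -/
def columnWeight (c : Fin N) (b : Bool) (S : Finset (Fin N)) : ℤ :=
  (if b then 1 else -1) * if c ∈ S then 1 else 0

/-- The matrix `M` preserves the weight of `sl_N`. -/
def PreservesWeight (s t : List Label) (M : List (Finset (Fin N)) → List (Finset (Fin N)) → K) :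
    Prop :=
  ∀ x ∈ basisStates N s, ∀ y ∈ basisStates N t, M x y ≠ 0 →
    ∃ n : ℤ, ∀ c, totalExp (columnWeight c) t y = totalExp (columnWeight c) s x + n

theorem PreservesWeight.symm {s t : List Label} {M M' : List (Finset (Fin N)) → _}
    (h : PreservesWeight s t M) (h' : StarRelated s t M M') : PreservesWeight t s M' := by
  intro y hy x hx hxy
  rw [h' x hx y hy] at hxy
  obtain ⟨n, hn⟩ := h x hx y hy (right_ne_zero_of_mul hxy)
  exact ⟨-n, fun c => by rw [hn c]; ring⟩

theorem PreservesWeight.smul {s t : List Label} {M : List (Finset (Fin N)) → _}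
    (h : PreservesWeight s t M) (a : K) : PreservesWeight s t fun x y => a * M x y :=
  fun x hx y hy hxy => h x hx y hy (right_ne_zero_of_mul hxy)

theorem preservesWeight_one (s : List Label) :
    PreservesWeight (N := N) s s fun x y => if x = y then 1 else 0 := by
  intro x _ y _ h
  obtain rfl : x = y := by by_contra h'; simp [h'] at h
  exact ⟨0, fun c => (add_zero _).symm⟩

theorem preservesWeight_cupL (a : ℕ) :
    PreservesWeight (N := N) [] [up a, dn a] cupLCoeff := by
  intro x hx y hy h
  simp only [mem_basisStates_cons, mem_basisStates_nil] at hx hy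
  obtain ⟨S, _, hS, ⟨T, _, hT, rfl, rfl⟩, rfl⟩ := hy
  subst hx
  obtain rfl : S = T := by by_contra h'; simp [cupLCoeff, h'] at h
  exact ⟨0, fun c => by by_cases h' : c ∈ S <;> simp [totalExp, columnWeight, h']⟩

theorem preservesWeight_cupR (a : ℕ) :
    PreservesWeight (N := N) [] [dn a, up a] cupRCoeff := by
  intro x hx y hy h
  simp only [mem_basisStates_cons, mem_basisStates_nil] at hx hy
  obtain ⟨S, _, hS, ⟨T, _, hT, rfl, rfl⟩, rfl⟩ := hy
  subst hx
  obtain rfl : S = T := by by_contra h'; simp [cupRCoeff, h'] at h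
  exact ⟨0, fun c => by by_cases h' : c ∈ S <;> simp [totalExp, columnWeight, h']⟩

theorem preservesWeight_split (a b : ℕ) :
    PreservesWeight (N := N) [up (a + b)] [up a, up b] splitCoeff := by
  intro x hx y hy h
  simp only [mem_basisStates_cons, mem_basisStates_nil] at hx hy
  obtain ⟨T, _, -, ⟨U, _, -, rfl, rfl⟩, rfl⟩ := hy
  obtain ⟨S, _, -, rfl, rfl⟩ := hx
  obtain ⟨hd, rfl⟩ : Disjoint T U ∧ T ∪ U = S := by
    by_contra h'; simp [splitCoeff, h'] at h
  refine ⟨0, fun c => ?_⟩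
  have : c ∈ T → c ∉ U := fun hc => Finset.disjoint_left.mp hd hc
  by_cases h₁ : c ∈ T <;> by_cases h₂ : c ∈ U <;> simp_all [totalExp, columnWeight]

/-- Passing to the complement and reversing the orientation lowers every column by `1`. This is why
weights are compared only up to a common integer. -/
theorem preservesWeight_sink (a : ℕ) :
    PreservesWeight (N := N) [up a] [dn (N - a)] sinkCoeff := by
  intro x hx y hy h
  simp only [mem_basisStates_cons, mem_basisStates_nil] at hx hy
  obtain ⟨T, _, -, rfl, rfl⟩ := hy
  obtain ⟨S, _, -, rfl, rfl⟩ := hx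
  obtain rfl : T = Sᶜ := by by_contra h'; simp [sinkCoeff, h'] at h
  refine ⟨-1, fun c => ?_⟩
  by_cases h₁ : c ∈ S <;> simp [totalExp, columnWeight, h₁]

theorem Web.preservesWeight {s t : List Label} (f : Web N s t) : PreservesWeight s t f.coeff := by
  induction f with
  | empty => exact preservesWeight_one _
  | strand x hx => exact preservesWeight_one _
  | cupL a ha => exact preservesWeight_cupL a
  | cupR a ha => exact preservesWeight_cupR a
  | capL a ha => exact (preservesWeight_cupL a).symm (starRelated_cupL a)
  | capR a ha => exact (preservesWeight_cupR a).symm (starRelated_cupR a)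
  | split a b hab => exact preservesWeight_split a b
  | merge a b hab => exact (preservesWeight_split a b).symm (starRelated_split a b)
  | sinkL a ha => exact preservesWeight_sink a
  | sinkR a ha => exact (preservesWeight_sink a).smul _
  | sourceL a ha => exact (preservesWeight_sink a).symm (starRelated_sink a)
  | sourceR a ha => exact ((preservesWeight_sink a).symm (starRelated_sink a)).smul _
  | comp f g hf hg =>
    intro x hx y hy h
    obtain ⟨z, hz, hxy⟩ := exists_ne_zero_of_sum_ne_zero h
    obtain ⟨n, hn⟩ := hf x hx z hz (left_ne_zero_of_mul hxy)
    obtain ⟨n', hn'⟩ := hg z hz y hy (right_ne_zero_of_mul hxy)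
    exact ⟨n + n', fun c => by rw [hn', hn, add_assoc]⟩
  | tens f g hf hg =>
    intro x hx y hy h
    obtain ⟨x₁, hx₁, x₂, hx₂, rfl⟩ := mem_basisStates_append.mp hx
    obtain ⟨y₁, hy₁, y₂, hy₂, rfl⟩ := mem_basisStates_append.mp hy
    have lx := length_of_mem_basisStates hx₁
    have ly := length_of_mem_basisStates hy₁
    simp only [Web.coeff, ← lx, ← ly, List.take_left', List.drop_left'] at h
    obtain ⟨n, hn⟩ := hf _ hx₁ _ hy₁ (left_ne_zero_of_mul h)
    obtain ⟨n', hn'⟩ := hg _ hx₂ _ hy₂ (right_ne_zero_of_mul h)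
    refine ⟨n + n', fun c => ?_⟩
    rw [totalExp_append _ lx, totalExp_append _ ly, hn, hn']
    ring

variable {ℓ : ℕ} {k : Fin (N * ℓ) → ℕ}

/-- The bottom tensor has the same count in every column, and a web shifts all counts equally. So
the `N` counts agree, and their total `N * ℓ` makes each equal to `ℓ`. -/
theorem webVector_support (hN : 0 < N) (hsum : ∑ i, k i = N * ℓ) (w : MonomialWeb N ℓ k)
    (S : BasisIndex N k) (h : webVector w S ≠ 0) (c : Fin N) :
    (univ.filter fun i => c ∈ S.1 i).card = ℓ := by
  obtain ⟨n, hn⟩ := w.preservesWeight _ (stateList_mem (topIndex N ℓ)) _ (stateList_mem S) h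
  simp only [totalExp_boundary, columnWeight, if_true, one_mul] at hn
  have htop : ∀ c c' : Fin N, (∑ i, if c ∈ (topIndex N ℓ).1 i then (1 : ℤ) else 0) =
      ∑ i, if c' ∈ (topIndex N ℓ).1 i then (1 : ℤ) else 0 := by
    intro c c'
    refine sum_congr rfl fun i _ => ?_
    simp only [topIndex]
    split_ifs <;> simp_all
  have hcard : ∀ c', ∑ i, (if c' ∈ S.1 i then (1 : ℤ) else 0) =
      ∑ i, (if c ∈ S.1 i then (1 : ℤ) else 0) := by
    intro c'
    rw [hn, hn, htop c' c]
  have htotal : ∑ c' : Fin N, ∑ i, (if c' ∈ S.1 i then (1 : ℤ) else 0) = N * ℓ := by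
    rw [sum_comm]
    have : ∀ i, ∑ c' : Fin N, (if c' ∈ S.1 i then (1 : ℤ) else 0) = k i := by
      intro i; rw [← S.2 i]; simp
    simp only [this]
    exact_mod_cast hsum
  simp only [hcard, sum_const, card_univ, Fintype.card_fin, nsmul_eq_mul] at htotal
  have h₀ : (N : ℤ) ≠ 0 := by exact_mod_cast hN.ne'
  have := mul_left_cancel₀ h₀ htotal
  rw [sum_boole] at this
  exact_mod_cast this

/-! ### The normalisation -/

theorem ell_self (S : Finset (Fin N)) : 2 * ell S S = (S.card : ℤ) * (S.card - 1) := by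
  have h₁ : ell S S = ∑ i ∈ S, ∑ j ∈ S, if i < j then (1 : ℤ) else 0 := ell_eq_sum S S
  have h₂ : ell S S = ∑ i ∈ S, ∑ j ∈ S, if j < i then (1 : ℤ) else 0 := by
    rw [h₁, sum_comm]
  have h₃ : (S.card : ℤ) * S.card = ∑ i ∈ S, ∑ j ∈ S, (1 : ℤ) := by simp
  have h₄ : (S.card : ℤ) = ∑ i ∈ S, ∑ j ∈ S, if i = j then (1 : ℤ) else 0 := by simp
  rw [two_mul, mul_sub, mul_one, h₃]
  nth_rewrite 1 [h₁]
  rw [h₂, eq_sub_iff_add_eq, h₄]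
  simp only [← sum_add_distrib]
  refine sum_congr rfl fun i _ => sum_congr rfl fun j _ => ?_
  rcases lt_trichotomy i j with h | h | h
  · simp [h, h.ne, h.not_gt]
  · simp [h]
  · simp [h, h.ne', h.not_gt]

theorem ell_univ (S : Finset (Fin N)) : ell univ S = ∑ s ∈ S, (s.val : ℤ) := by
  rw [ell, card_filter, sum_product_right]
  push_cast
  refine sum_congr rfl fun s _ => ?_
  rw [sum_boole]
  have : (univ.filter fun i : Fin N => i < s) = Iio s := by ext; simp
  simp [this]

theorem two_mul_ell_compl (S : Finset (Fin N)) :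
    2 * ell Sᶜ S = ∑ s ∈ S, 2 * (s.val : ℤ) - S.card * (S.card - 1) := by
  have h : ell univ S = ell Sᶜ S + ell S S := by
    rw [← ell_add_left disjoint_compl_left, union_comm, union_compl]
  rw [← ell_self, ← mul_sum, ← ell_univ, h]
  ring

/-- Each `ell Sᶜ S` is the sum of the elements of `S`, counted from `0`, minus half of `|S| (|S| -
1)`. Since every column number occurs `ℓ` times, the elements add up to `ℓ N (N - 1) / 2`. -/
theorem sum_ell_compl {S : BasisIndex N k}
    (h : ∀ c : Fin N, (univ.filter fun i => c ∈ S.1 i).card = ℓ) :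
    ∑ i, ell (S.1 i)ᶜ (S.1 i) = normExp N ℓ k := by
  have h₁ : 2 * ∑ i, ell (S.1 i)ᶜ (S.1 i) =
      (N : ℤ) * (N - 1) * ℓ - ∑ i, (k i : ℤ) * (k i - 1) := by
    rw [mul_sum]
    simp only [two_mul_ell_compl, sum_sub_distrib, S.2]
    congr 1
    have : ∀ i, ∑ s ∈ S.1 i, 2 * (s.val : ℤ) =
        ∑ s : Fin N, if s ∈ S.1 i then 2 * (s.val : ℤ) else 0 := by intro i; simp
    simp only [this]
    rw [sum_comm]
    have : ∀ c : Fin N, (∑ i, if c ∈ S.1 i then 2 * (c.val : ℤ) else 0) = ℓ * (2 * c.val) := by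
      intro c
      rw [← sum_filter, sum_const, h c, nsmul_eq_mul]
    simp only [this]
    rw [← mul_sum, ← mul_sum, mul_comm]
    congr 1
    have hu := ell_self (univ : Finset (Fin N))
    rw [ell_univ] at hu
    simpa using hu
  rw [normExp, ← h₁]
  simp

/-- Glueing sums over the basis tensors of the middle boundary. Reflection replaces the coefficient
of `u^*` by that of `u` times a power of `v`, which is constant on the support of `u`. -/
theorem ev_comp_star (hN : 0 < N) (hsum : ∑ i, k i = N * ℓ) (u w : MonomialWeb N ℓ k) :
    ev (w.comp u.star) = v ^ normExp N ℓ k * lusztigForm (webVector u) (webVector w) := by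
  change ∑ z ∈ basisStates N (boundary k), w.coeff _ z * u.star.coeff z _ = _
  rw [sum_basisStates_boundary, lusztigForm, mul_sum]
  refine sum_congr rfl fun S _ => ?_
  have h := u.star_coeff _ (stateList_mem (topIndex N ℓ)) _ (stateList_mem S)
  simp only [totalExp_boundary, starExp, if_true, sum_neg_distrib] at h
  have h₀ : ∑ i, ell ((topIndex N ℓ).1 i)ᶜ ((topIndex N ℓ).1 i) = 0 := by
    refine sum_eq_zero fun i _ => ?_
    simp only [topIndex]
    split_ifs <;> simp [ell]
  change w.coeff (stateList (topIndex N ℓ).1) (stateList S.1) *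
    u.star.coeff (stateList S.1) (stateList (topIndex N ℓ).1) =
    _ * (u.coeff (stateList (topIndex N ℓ).1) (stateList S.1) *
      w.coeff (stateList (topIndex N ℓ).1) (stateList S.1))
  rw [h, h₀, neg_zero, sub_neg_eq_add, zero_add]
  by_cases hS : u.coeff (stateList (topIndex N ℓ).1) (stateList S.1) = 0
  · simp [hS]
  · rw [sum_ell_compl (webVector_support hN hsum u S hS)]
    ring

end StarWeight
end SLWeb

namespace SLWeb
open Finset

/-! ### The two web forms and the expansion in tableaux -/

noncomputable section Forms

variable {N ℓ : ℕ}

theorem psi_add {m : ℕ} {k : Fin m → ℕ} (x y : TensorSpace N k) :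
    psi (x + y) = psi x + psi y := by
  funext S
  simp [psi, mul_add, sum_add_distrib]

theorem psi_smul {m : ℕ} {k : Fin m → ℕ} (c : K) (x : TensorSpace N k) :
    psi (c • x) = bar c • psi x := by
  funext S
  simp [psi, mul_sum, mul_left_comm]

theorem psi_zero {m : ℕ} {k : Fin m → ℕ} : psi (0 : TensorSpace N k) = 0 := by
  funext S
  simp [psi]

variable {k : Fin (N * ℓ) → ℕ}

theorem psi_mem {x : TensorSpace N k} (hx : x ∈ webSpace N ℓ k) : psi x ∈ webSpace N ℓ k := by
  induction hx using Submodule.span_induction with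
  | mem x h =>
    obtain ⟨w, rfl⟩ := h
    rw [psi_webVector]
    exact (webElement w).2
  | zero => rw [psi_zero]; exact Submodule.zero_mem _
  | add x y _ _ hx hy => rw [psi_add]; exact Submodule.add_mem _ hx hy
  | smul c x _ hx => rw [psi_smul]; exact Submodule.smul_mem _ _ hx

/-- Needed for uniqueness of the bilinear form: every web space element must be of the form `ψ y`.
It follows from the fixed spanning set and `bar_bar`. -/
theorem psi_psi {x : TensorSpace N k} (hx : x ∈ webSpace N ℓ k) : psi (psi x) = x := by
  induction hx using Submodule.span_induction with
  | mem x h =>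
    obtain ⟨w, rfl⟩ := h
    rw [psi_webVector, psi_webVector]
  | zero => rw [psi_zero, psi_zero]
  | add x y _ _ hx hy => rw [psi_add, psi_add, hx, hy]
  | smul c x _ hx => rw [psi_smul, psi_smul, hx, bar_bar]

theorem span_webElement :
    Submodule.span K (Set.range (webElement (N := N) (ℓ := ℓ) (k := k))) = ⊤ := by
  have h := Submodule.span_span_coe_preimage (R := K)
    (s := Set.range (webVector (N := N) (ℓ := ℓ) (k := k)))
  have e : Set.range (webElement (N := N) (ℓ := ℓ) (k := k)) =
      (fun x : webSpace N ℓ k => (x : TensorSpace N k)) ⁻¹' Set.range webVector := by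
    ext x
    constructor
    · rintro ⟨w, rfl⟩
      exact ⟨w, rfl⟩
    · rintro ⟨w, hw⟩
      exact ⟨w, Subtype.ext hw⟩
  rw [e]
  exact h

/-- Lusztig's form restricted to the web space. -/
def lusztigBilin (N ℓ : ℕ) (k : Fin (N * ℓ) → ℕ) : LinearMap.BilinForm K (webSpace N ℓ k) :=
  LinearMap.mk₂ K (fun x y => lusztigForm (x : TensorSpace N k) (y : TensorSpace N k))
    (fun x x' y => by simp [lusztigForm, add_mul, sum_add_distrib])
    (fun c x y => by simp [lusztigForm, mul_sum, mul_assoc])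
    (fun x y y' => by simp [lusztigForm, mul_add, sum_add_distrib])
    (fun c x y => by simp [lusztigForm, mul_sum, mul_left_comm])

/-- The sesquilinear form attached to Lusztig's form. -/
def lusztigSesq (N ℓ : ℕ) (k : Fin (N * ℓ) → ℕ) :
    webSpace N ℓ k →ₛₗ[bar] webSpace N ℓ k →ₗ[K] K :=
  LinearMap.mk₂'ₛₗ bar (RingHom.id K)
    (fun x y => bar (lusztigForm (x : TensorSpace N k) (psi (y : TensorSpace N k))))
    (fun x x' y => by simp [lusztigForm, add_mul, sum_add_distrib])
    (fun c x y => by simp [lusztigForm, mul_sum, mul_assoc])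
    (fun x y y' => by simp [lusztigForm, psi_add, mul_add, sum_add_distrib])
    (fun c x y => by simp [lusztigForm, psi_smul, mul_sum, mul_left_comm, bar_bar])

/-- Barring `ev = v^d L` and using `bar_ev` gives `ev = v^(-d) bar L`. The normalising factor `v^d`
is therefore exactly what leaves `bar L`. -/
theorem lusztigSesq_isWebForm (hN : 0 < N) (hsum : ∑ i, k i = N * ℓ) :
    IsSesquilinearWebForm (lusztigSesq N ℓ k) := by
  intro u w
  have h := ev_comp_star hN hsum u w
  have h' : bar (lusztigForm (webVector u) (webVector w)) =
      v ^ normExp N ℓ k * ev (w.comp u.star) := by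
    have hv := zpow_ne_zero (normExp N ℓ k) v_ne_zero
    rw [← bar_ev, h, map_mul, map_zpow₀, bar_v, inv_zpow, mul_inv_cancel_left₀ hv]
  rw [← h']
  change bar (lusztigForm (webVector u) (psi (webVector w))) = _
  rw [psi_webVector]

theorem sesq_unique {S S' : webSpace N ℓ k →ₛₗ[bar] webSpace N ℓ k →ₗ[K] K}
    (h : IsSesquilinearWebForm S) (h' : IsSesquilinearWebForm S') : S = S' := by
  refine LinearMap.ext_on span_webElement ?_
  rintro _ ⟨u, rfl⟩
  refine LinearMap.ext_on span_webElement ?_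
  rintro _ ⟨w, rfl⟩
  rw [h u w, h' u w]

theorem bilin_unique {S : webSpace N ℓ k →ₛₗ[bar] webSpace N ℓ k →ₗ[K] K}
    {B B' : LinearMap.BilinForm K (webSpace N ℓ k)} (h : IsBilinearWebForm S B)
    (h' : IsBilinearWebForm S B') : B = B' := by
  refine LinearMap.ext fun x => LinearMap.ext fun y => bar.injective ?_
  have hy := (psi_psi y.2).symm
  rw [← h x ⟨psi y, psi_mem y.2⟩ y hy, ← h' x ⟨psi y, psi_mem y.2⟩ y hy]

theorem lusztigBilin_isWebForm : IsBilinearWebForm (lusztigSesq N ℓ k) (lusztigBilin N ℓ k) := by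
  intro x y y' h
  change bar (lusztigForm (x : TensorSpace N k) (psi (y : TensorSpace N k))) =
    bar (lusztigForm (x : TensorSpace N k) (y' : TensorSpace N k))
  rw [h]

/-! ### Tableaux -/

theorem Col.index_injective : Function.Injective (Col.index (N := N) (ℓ := ℓ) (k := k)) := by
  intro τ τ' h
  refine Subtype.ext (funext fun r => funext fun c => ?_)
  have hr : Set.range (fun r => τ.1 r c) = Set.range fun r => τ'.1 r c := by
    ext i
    have h₁ := congrFun (congrArg Subtype.val h) i
    have h₂ := Finset.ext_iff.mp h₁ c
    simpa [Col.index] using h₂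
  exact congrFun ((StrictMono.range_inj (τ.2.1 c) (τ'.2.1 c)).mp hr) r

/-- Column `c` of the tableau is the increasing enumeration of the indices `i` with `c ∈ S_i`; the
hypothesis makes it have length `ℓ`. -/
theorem Col.exists_index (S : BasisIndex N k)
    (h : ∀ c : Fin N, (univ.filter fun i => c ∈ S.1 i).card = ℓ) :
    ∃ τ : Col N ℓ k, τ.index = S := by
  have hmem : ∀ c i, (∃ r, (univ.filter fun i => c ∈ S.1 i).orderEmbOfFin (h c) r = i) ↔
      c ∈ S.1 i := by
    intro c i
    rw [← Set.mem_range, range_orderEmbOfFin]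
    simp
  refine ⟨⟨fun r c => (univ.filter fun i => c ∈ S.1 i).orderEmbOfFin (h c) r,
    fun c => OrderEmbedding.strictMono _, fun i => ?_⟩, ?_⟩
  · rw [← S.2 i]
    refine card_bij (fun p _ => p.2) ?_ ?_ ?_
    · intro p hp
      exact (hmem p.2 i).mp ⟨p.1, (mem_filter.mp hp).2⟩
    · rintro ⟨r, c⟩ hp ⟨r', c'⟩ hp' (rfl : c = c')
      have := (mem_filter.mp hp).2.trans (mem_filter.mp hp').2.symm
      exact congrArg (·, c) (((univ.filter fun i => c ∈ S.1 i).orderEmbOfFin (h c)).injective this)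
    · intro c hc
      obtain ⟨r, hr⟩ := (hmem c i).mpr hc
      exact ⟨(r, c), by simpa using hr, rfl⟩
  · refine Subtype.ext (funext fun i => ?_)
    ext c
    simpa [Col.index] using hmem c i

theorem tableau_sum_apply (c : Col N ℓ k → K) (τ : Col N ℓ k) :
    (∑ σ, c σ • tableauTensor σ) τ.index = c τ := by
  rw [Finset.sum_apply, Fintype.sum_eq_single τ]
  · simp [tableauTensor]
  · intro σ hσ
    have : τ.index ≠ σ.index := fun e => hσ (Col.index_injective e).symm
    simp [tableauTensor, this]

theorem webVector_eq_zero (hN : 0 < N) (hsum : ∑ i, k i = N * ℓ) (w : MonomialWeb N ℓ k)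
    {S : BasisIndex N k} (hS : S ∉ Set.range (Col.index (N := N) (ℓ := ℓ) (k := k))) :
    webVector w S = 0 := by
  by_contra h
  exact hS (Col.exists_index S (webVector_support hN hsum w S h))

theorem webVector_eq_sum (hN : 0 < N) (hsum : ∑ i, k i = N * ℓ) (w : MonomialWeb N ℓ k) :
    webVector w = ∑ τ, webVector w τ.index • tableauTensor τ := by
  funext S
  by_cases hS : S ∈ Set.range (Col.index (N := N) (ℓ := ℓ) (k := k))
  · obtain ⟨τ, rfl⟩ := hS
    rw [tableau_sum_apply fun τ => webVector w τ.index]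
  · rw [webVector_eq_zero hN hsum w hS, Finset.sum_apply, sum_eq_zero]
    intro τ _
    have : S ≠ τ.index := fun e => hS ⟨τ, e.symm⟩
    simp [tableauTensor, this]

theorem lusztigForm_webVector_self (hN : 0 < N) (hsum : ∑ i, k i = N * ℓ)
    (w : MonomialWeb N ℓ k) {c : Col N ℓ k → K} (hc : webVector w = ∑ τ, c τ • tableauTensor τ) :
    lusztigForm (webVector w) (webVector w) = ∑ τ, c τ ^ 2 := by
  symm
  refine Fintype.sum_of_injective Col.index Col.index_injective _ _ (fun S hS => ?_) fun τ => ?_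
  · rw [webVector_eq_zero hN hsum w hS, zero_mul]
  · rw [hc, tableau_sum_apply, sq]

end Forms
end SLWeb

theorem lemma4p9 (N ℓ : ℕ) (hN : 2 ≤ N) (k : Fin (N * ℓ) → ℕ)
    (hk : ∀ i, k i ≤ N) (hsum : ∑ i, k i = N * ℓ) :
    (∃! S : SLWeb.webSpace N ℓ k →ₛₗ[SLWeb.bar] SLWeb.webSpace N ℓ k →ₗ[SLWeb.K] SLWeb.K,
      SLWeb.IsSesquilinearWebForm S) ∧
    (∀ x ∈ SLWeb.webSpace N ℓ k, SLWeb.psi x ∈ SLWeb.webSpace N ℓ k) ∧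
    ∀ S : SLWeb.webSpace N ℓ k →ₛₗ[SLWeb.bar] SLWeb.webSpace N ℓ k →ₗ[SLWeb.K] SLWeb.K,
      SLWeb.IsSesquilinearWebForm S →
      (∃! B : LinearMap.BilinForm SLWeb.K (SLWeb.webSpace N ℓ k),
        SLWeb.IsBilinearWebForm S B) ∧
      ∀ B : LinearMap.BilinForm SLWeb.K (SLWeb.webSpace N ℓ k),
        SLWeb.IsBilinearWebForm S B →
        (∀ x y, B x y = B y x) ∧
        (∀ w : SLWeb.MonomialWeb N ℓ k,
          (∃! c : SLWeb.Col N ℓ k → SLWeb.K,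
            SLWeb.webVector w = ∑ τ, c τ • SLWeb.tableauTensor τ) ∧
          ∀ c : SLWeb.Col N ℓ k → SLWeb.K,
            SLWeb.webVector w = ∑ τ, c τ • SLWeb.tableauTensor τ →
            B (SLWeb.webElement w) (SLWeb.webElement w) = ∑ τ, c τ ^ 2) ∧
        (∀ x y : SLWeb.webSpace N ℓ k,
          B x y = SLWeb.lusztigForm (x : SLWeb.TensorSpace N k) (y : SLWeb.TensorSpace N k)) := by
  have hN' : 0 < N := by omega
  have hS₀ := SLWeb.lusztigSesq_isWebForm hN' hsum
  refine ⟨⟨_, hS₀, fun S hS => SLWeb.sesq_unique hS hS₀⟩, fun x hx => SLWeb.psi_mem hx, ?_⟩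
  intro S hS
  obtain rfl := SLWeb.sesq_unique hS hS₀
  have hB₀ := SLWeb.lusztigBilin_isWebForm (N := N) (ℓ := ℓ) (k := k)
  refine ⟨⟨_, hB₀, fun B hB => SLWeb.bilin_unique hB hB₀⟩, ?_⟩
  intro B hB
  obtain rfl := SLWeb.bilin_unique hB hB₀
  refine ⟨fun x y => ?_, fun w => ⟨⟨_, SLWeb.webVector_eq_sum hN' hsum w, fun c hc => ?_⟩,
    fun c hc => SLWeb.lusztigForm_webVector_self hN' hsum w hc⟩, fun x y => rfl⟩
  · change SLWeb.lusztigForm _ _ = SLWeb.lusztigForm _ _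
    exact Finset.sum_congr rfl fun S _ => mul_comm _ _
  · funext τ
    rw [hc, SLWeb.tableau_sum_apply]
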